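/- Let $\hbar\in\mathbb C\setminus\{0\}$, let $V'(x)$ be a rational function over $\mathbb C$, and let $s_1,\dots,s_m\in\mathbb C$ be pairwise distinct points, none of which is a pole of $V'$. Let $G(x_0,x)$ and $K(x_0,x)$, defined for $x_0\notin\{s_1,\dots,s_m\}$, satisfy the following conditions. 1. As a function of $x$, $G(x_0,x)$ is rational, with poles at most at the $s_i$ and at $x=x_0$, where it has a simple pole of residue $+1$; and $G(x_0,x)=O(1/x)$ as $x\to\infty$. 2. As a function of $x_0$, $G(x_0,x)$ is rational, with poles (possibly multiple) at most at the $s_i$ and a simple pole at $x_0=x$; and $G(x_0,x)=O(1/x_0)$ as $x_0\to\infty$. 3. $B(x_0,x):=-\tfrac12\,\partial_x G(x_0,x)$ is symmetric: $B(x_0,x)=B(x,x_0)$. 4. Near every $s_i$, $\Big(2\hbar\sum_{j=1}^m\frac1{x-s_j}-V'(x)-\hbar\,\partial_x\Big)K(x_0,x)=G(x_0,x)$. 5. $K(x_0,x)$ is analytic in $x$ at every $s_i$. (Only the germs of $K(x_0,\cdot)$ at the $s_i$ matter; any choice of local branches is allowed.) Define functions $W_n^{(g)}(x_1,\dots,x_n)$,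 for $g\ge 0$, $n\ge1$ and $x_1,\dots,x_n\in\mathbb C\setminus\{s_1,\dots,s_m\}$, by $$W_1^{(0)}(x)=\hbar\sum_{i=1}^m\frac1{x-s_i},\qquad W_2^{(0)}(x_1,x_2)=B(x_1,x_2)\quad(x_1\ne x_2),$$ and, for $2g+n\ge2$ and $J=(x_1,\dots,x_n)$, by the recursion $$W_{n+1}^{(g)}(x_0,J)=\sum_{i=1}^m\operatorname*{Res}_{x\to s_i}K(x_0,x)\Big(\overline W_{n+2}^{(g-1)}(x,x,J)+\sum_{h=0}^g\ {\sum_{I\subset J}}'\,W_{|I|+1}^{(h)}(x,I)\,W_{n-|I|+1}^{(g-h)}(x,J\setminus I)\Big).$$ Here $\sum'$ omits the terms $(h,I)=(0,\emptyset)$ and $(h,I)=(g,J)$; the subsets of $J$ are taken in the order of the indices; the first term is absent if $g=0$; and $\overline W_n^{(g)}=W_n^{(g)}$ except that $\overline W_2^{(0)}(x_1,x_2)=B(x_1,x_2)-\frac1{2(x_1-x_2)^2}$, extended to the diagonal $x_1=x_2$ as a limit. Then this recursion is meaningful, that is, the limit defining $\overline W_2^{(0)}(x,x)$ exists for all $x\notin\{s_1,\dots,s_m\}$,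 and in every step the function whose residue is taken at $s_i$ is meromorphic there. Moreover every $W_n^{(g)}$ is a symmetric function of all its arguments: for all $g\ge0$, $n\ge1$, every permutation $\sigma$ of $\{1,\dots,n\}$ and all $x_1,\dots,x_n\in\mathbb C\setminus\{s_1,\dots,s_m\}$ (distinct if $(g,n)=(0,2)$), $$W_n^{(g)}(x_{\sigma(1)},\dots,x_{\sigma(n)})=W_n^{(g)}(x_1,\dots,x_n).$$ -/

import Mathlib

open Filter Topology

noncomputable section

namespace QuantumTR

/-- `f` agrees off `S` with a rational function all of whose poles lie in `S`. -/
def IsRationalOff (S : Set ℂ) (f : ℂ → ℂ) : Prop :=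
  ∃ r : RatFunc ℂ, (∀ x, r.denom.eval x = 0 → x ∈ S) ∧
    ∀ x, x ∉ S → f x = r.eval (RingHom.id ℂ) x

/-- The residue of `f` at `a`: the limit, as `r → 0+` (in fact the eventually constant value, for
`f` meromorphic at `a`), of `(2πi)⁻¹ ∮ f` over the circle of centre `a` and radius `r`. -/
def residue (f : ℂ → ℂ) (a : ℂ) : ℂ :=
  limUnder (𝓝[>] (0 : ℝ)) fun r : ℝ =>
    (2 * (Real.pi : ℂ) * Complex.I)⁻¹ * ∮ z in C(a, r), f z

/-- `B(x₀,x) = -½ ∂G(x₀,x)/∂x`. -/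
def bergman (G : ℂ → ℂ → ℂ) (x₀ x : ℂ) : ℂ := -(1 / 2) * deriv (G x₀) x

/-- The defining conditions on the kernels `G(x₀,x)` and `K(x₀,x)` attached to `ħ`, to the rational
function `dV = V'` and to the points `s₁, …, s_m`.

Every global solution `K(x₀,·)` of the differential equation is multivalued (it has a logarithmic
singularity at `x₀`), and only its germs at the points `sᵢ` are ever used; so the equation and the
analyticity of `K` are required in a neighbourhood of every `sᵢ`, and `K(x₀,·)` may be any choice of
branches there. -/
structure IsKernelPair (hbar : ℂ) (dV : RatFunc ℂ) {m : ℕ} (s : Fin m → ℂ)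
    (G K : ℂ → ℂ → ℂ) : Prop where
  /-- `G(x₀,x)` is rational in `x`, with poles only at the `sᵢ` and at `x₀`. -/
  rational_right : ∀ x₀, x₀ ∉ Set.range s → IsRationalOff (insert x₀ (Set.range s)) (G x₀)
  /-- The pole of `G(x₀,x)` at `x = x₀` is simple, with residue `1`. -/
  pole_right : ∀ x₀, x₀ ∉ Set.range s →
    Tendsto (fun x => (x - x₀) * G x₀ x) (𝓝[≠] x₀) (𝓝 1)
  /-- `G(x₀,x) = O(1/x)` at `x → ∞`. -/
  infty_right : ∀ x₀, x₀ ∉ Set.range s →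
    Asymptotics.IsBigO (Bornology.cobounded ℂ) (G x₀) (fun x => x⁻¹)
  /-- `G(x₀,x)` is rational in `x₀`, with poles only at the `sᵢ` and at `x`. -/
  rational_left : ∀ x, x ∉ Set.range s →
    IsRationalOff (insert x (Set.range s)) (fun x₀ => G x₀ x)
  /-- The pole of `G(x₀,x)` at `x₀ = x` is simple. -/
  pole_left : ∀ x, x ∉ Set.range s →
    ∃ c : ℂ, c ≠ 0 ∧ Tendsto (fun x₀ => (x₀ - x) * G x₀ x) (𝓝[≠] x) (𝓝 c)
  /-- `G(x₀,x) = O(1/x₀)` at `x₀ → ∞`. -/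
  infty_left : ∀ x, x ∉ Set.range s →
    Asymptotics.IsBigO (Bornology.cobounded ℂ) (fun x₀ => G x₀ x) (fun x₀ => x₀⁻¹)
  /-- `B(x₀,x) = B(x,x₀)`. -/
  bergman_symm : ∀ x₀ x, x₀ ∉ Set.range s → x ∉ Set.range s → x₀ ≠ x →
    bergman G x₀ x = bergman G x x₀
  /-- `(2ħ ∑ⱼ 1/(x-sⱼ) - V'(x) - ħ ∂/∂x) K(x₀,x) = G(x₀,x)`. -/
  ode : ∀ x₀, x₀ ∉ Set.range s → ∀ i, ∀ᶠ x in 𝓝[≠] (s i),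
    (2 * hbar * ∑ j, 1 / (x - s j) - dV.eval (RingHom.id ℂ) x) * K x₀ x
      - hbar * deriv (K x₀) x = G x₀ x
  /-- `K(x₀,x)` is analytic in `x` at every `sᵢ`. -/
  analytic : ∀ x₀, x₀ ∉ Set.range s → ∀ i, AnalyticAt ℂ (K x₀) (s i)

/-- The part `x_I` of `J = (x₁, …, xₙ)`, in increasing order of the indices. -/
def pick {n : ℕ} (J : Fin n → ℂ) (I : Finset (Fin n)) : Fin I.card → ℂ :=
  fun k => J (I.orderEmbOfFin rfl k)

/-- `W̄₂⁽⁰⁾(x,x)`, the value at `y = x` of `B(x,y) - ½ (x-y)⁻²`, which has a removable singularity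
there. -/
def bergmanDiag (G : ℂ → ℂ → ℂ) (x : ℂ) : ℂ :=
  limUnder (𝓝[≠] x) fun y => bergman G x y - 1 / (2 * (x - y) ^ 2)

/-- The bracket of the recursion for `W_{n+1}^{(g)}(x₀, J)`, `J = (x₁, …, xₙ)`, as a function of `x`,
where `F g n x₀ J` stands for `W_{n+1}^{(g)}(x₀, J)`:
`W̄_{n+2}^{(g-1)}(x, x, J) + ∑_{h ≤ g} ∑'_{I ⊆ J} W_{|I|+1}^{(h)}(x, I) W_{n-|I|+1}^{(g-h)}(x, J \ I)`.
The first term is absent for `g = 0`, and `∑'` omits `(h, I) = (0, ∅)` and `(h, I) = (g, J)`. -/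
def bracket (G : ℂ → ℂ → ℂ) (F : ℕ → (n : ℕ) → ℂ → (Fin n → ℂ) → ℂ)
    (g n : ℕ) (J : Fin n → ℂ) (x : ℂ) : ℂ :=
  (if g = 0 then 0
    else if g = 1 ∧ n = 0 then bergmanDiag G x
    else F (g - 1) (n + 1) x (Fin.cons x J)) +
  ∑ h ∈ Finset.range (g + 1),
    ∑ I : Finset (Fin n) with (h, I) ≠ (0, ∅) ∧ (h, I) ≠ (g, Finset.univ),
      F h I.card x (pick J I) * F (g - h) Iᶜ.card x (pick J Iᶜ)

/-- The correlators: `W hbar s G K g n x₀ J` is `W_{n+1}^{(g)}(x₀, J)` with `J = (x₁, …, xₙ)`.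
The recursion runs over `2g + n`; as `W_recursion` below shows, the truncation in the last line
only serves to make this visible, and discards no term. -/
def W {m : ℕ} (hbar : ℂ) (s : Fin m → ℂ) (G K : ℂ → ℂ → ℂ)
    (g n : ℕ) (x₀ : ℂ) (J : Fin n → ℂ) : ℂ :=
  if g = 0 ∧ n = 0 then hbar * ∑ i, 1 / (x₀ - s i)
  else if h : g = 0 ∧ n = 1 then bergman G x₀ (J ⟨0, by omega⟩)
  else ∑ i, residue (fun x => K x₀ x * bracket G
    (fun g' n' x' J' => if _h : 2 * g' + n' < 2 * g + n then W hbar s G K g' n' x' J' else 0)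
    g n J x) (s i)
termination_by 2 * g + n

theorem bracket_congr (G : ℂ → ℂ → ℂ) {F F' : ℕ → (n : ℕ) → ℂ → (Fin n → ℂ) → ℂ} {g n : ℕ}
    (hF : ∀ g' n', 2 * g' + n' < 2 * g + n → F g' n' = F' g' n') (J : Fin n → ℂ) (x : ℂ) :
    bracket G F g n J x = bracket G F' g n J x := by
  unfold bracket
  congr 1
  · split_ifs with h1 h2
    · rfl
    · rfl
    · rw [hF _ _ (by omega)]
  · refine Finset.sum_congr rfl fun h hh => Finset.sum_congr rfl fun I hI => ?_
    simp only [Finset.mem_range] at hh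
    simp only [Finset.mem_filter, Finset.mem_univ, true_and, ne_eq, Prod.mk.injEq, not_and] at hI
    have hc : I.card + Iᶜ.card = n := by simp
    have h0 : ¬ (h = 0 ∧ I.card = 0) := fun hz => hI.1 hz.1 (Finset.card_eq_zero.1 hz.2)
    have h1 : ¬ (h = g ∧ Iᶜ.card = 0) := fun hz =>
      hI.2 hz.1 ((Finset.compl_eq_empty_iff I).1 (Finset.card_eq_zero.1 hz.2))
    rw [hF h I.card (by omega), hF (g - h) Iᶜ.card (by omega)]

section equations

variable {m : ℕ} (hbar : ℂ) (s : Fin m → ℂ) (G K : ℂ → ℂ → ℂ)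

/-- `W₁⁽⁰⁾(x) = ħ ∑ᵢ 1/(x-sᵢ)`. -/
theorem W_zero_zero (x₀ : ℂ) (J : Fin 0 → ℂ) :
    W hbar s G K 0 0 x₀ J = hbar * ∑ i, 1 / (x₀ - s i) := by
  rw [W]; simp

/-- `W₂⁽⁰⁾(x₀,x₁) = B(x₀,x₁)`. -/
theorem W_zero_one (x₀ : ℂ) (J : Fin 1 → ℂ) :
    W hbar s G K 0 1 x₀ J = bergman G x₀ (J 0) := by
  rw [W]; simp

/-- The recursion for the stable correlators. -/
theorem W_recursion (g n : ℕ) (hgn : 2 ≤ 2 * g + n) (x₀ : ℂ) (J : Fin n → ℂ) :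
    W hbar s G K g n x₀ J =
      ∑ i, residue (fun x => K x₀ x * bracket G (W hbar s G K) g n J x) (s i) := by
  rw [W, if_neg (by omega), dif_neg (by omega)]
  refine Finset.sum_congr rfl fun i _ => ?_
  congr 1
  funext x
  congr 1
  refine bracket_congr G (fun g' n' h => ?_) J x
  funext x' J'
  simp [h]

end equations

/-- `W_n^{(g)}(x₁, …, xₙ)`, for `n ≥ 1`, as a function of the tuple of its arguments
(here `n + 1` of them). -/
def correlator {m : ℕ} (hbar : ℂ) (s : Fin m → ℂ) (G K : ℂ → ℂ → ℂ) (g n : ℕ)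
    (p : Fin (n + 1) → ℂ) : ℂ :=
  W hbar s G K g n (p 0) (Fin.tail p)

end QuantumTR

end

/-! ### Formal Gaussian integration on a formal disc -/

noncomputable section

namespace QuantumTR

/-! The recursion computes cumulants of an eigenvalue ensemble, and cumulants are symmetric by
construction. Take eigenvalues `λᵢ = sᵢ + Xᵢ` and the formal integral of `Δ² exp(-U/T)`, where `Δ`
is the Vandermonde determinant and `∂ᵢU = V'(λᵢ) - 2ħ ∑_{j≠i} 1/(λᵢ-λⱼ)`; this is a β-ensemble whose
Vandermonde exponent is `2(1 + ħ/T)`. If `s` is a critical point of `U` with invertible Hessian, the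
perturbative expansion is pure algebra: Wick's formula defines a normalised functional with values
in power series that satisfies integration by parts (`FormalDisc.exists_functional`).

Give each observable `∑ᵢ 1/(x-λᵢ)` the weight `κ = T + ħ`, and let `T` solve `Tκ = X`, with `X` the
genus variable. Integration by parts then becomes a loop equation whose derivative term has
coefficient `ħ` and whose contact term has coefficient `X` (`loop_equation`). A connected correlator
of `n + 1` observables is divisible by `X ^ n` (`X_pow_card_dvd_cumulant`), so its coefficient of `X
^ (g + n)` is the candidate for `W_{n+1}^{(g)}`. As a function of `x` it is a combination of powers
`(x-sᵢ)⁻ᵏ⁻¹`.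

The conditions on `G` and `K` supply what the integral needs. Analyticity of `K` makes the poles of
`G` at the `sᵢ` simple with residue `2ħK(x₀,sᵢ)`, and symmetry of `B` makes `K(x₀,sᵢ)` a combination
of the `(x₀-sⱼ)⁻²`. The exponent `2` of the differential equation at `sᵢ` is resonant: its
second-order expansion is a solvability condition, which forces `s` to be critical and exhibits the
inverse Hessian (`IsKernelPair.exists_covariance`).

Finally `K` inverts the linear operator of the loop equation modulo functions regular at the `sᵢ`
(`sum_residue_eq`). The loop equation says that this operator applied to the candidate is minus the
bracket of the recursion, up to regular terms; hence the candidates satisfy the recursion, and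
induction on `2g + n` identifies them with the correlators (`IsKernelPair.W_eq_coeff`). -/

/-- A commutative `ℂ`-algebra that looks like the ring of formal functions on a disc with
coordinates `X i`: commuting partial derivatives `D i` and an evaluation `ev` at the origin. -/
structure FormalDisc (ι A : Type*) [DecidableEq ι] [Fintype ι] [CommRing A] [Algebra ℂ A] where
  D : ι → Derivation ℂ A A
  X : ι → A
  ev : A →ₐ[ℂ] ℂ
  D_comm : ∀ i j a, D i (D j a) = D j (D i a)
  D_X : ∀ i j, D i (X j) = if i = j then 1 else 0
  ev_X : ∀ i, ev (X i) = 0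
  exists_sum_of_ev_eq_zero : ∀ a, ev a = 0 → ∃ c : ι → A, a = ∑ i, c i * X i

namespace FormalDisc

variable {ι A : Type*} [DecidableEq ι] [Fintype ι] [CommRing A] [Algebra ℂ A]
  (S : FormalDisc ι A)

/-- `a` vanishes at the origin together with its partial derivatives of order less than `n`. -/
def Vanishes : ℕ → A → Prop
  | 0, _ => True
  | n + 1, a => S.ev a = 0 ∧ ∀ i, Vanishes n (S.D i a)

variable {S}

theorem Vanishes.zero (n : ℕ) : S.Vanishes n 0 := by
  induction n with
  | zero => trivial
  | succ n ih => exact ⟨map_zero _, fun i => by simpa using ih⟩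

theorem Vanishes.add {n : ℕ} {a b : A} (ha : S.Vanishes n a) (hb : S.Vanishes n b) :
    S.Vanishes n (a + b) := by
  induction n generalizing a b with
  | zero => trivial
  | succ n ih =>
    exact ⟨by rw [map_add, ha.1, hb.1, add_zero],
      fun i => by rw [map_add]; exact ih (ha.2 i) (hb.2 i)⟩

theorem Vanishes.pred {n : ℕ} {a : A} (ha : S.Vanishes (n + 1) a) : S.Vanishes n a := by
  induction n generalizing a with
  | zero => trivial
  | succ n ih => exact ⟨ha.1, fun i => ih (ha.2 i)⟩

theorem Vanishes.mono {n k : ℕ} (h : k ≤ n) {a : A} (ha : S.Vanishes n a) : S.Vanishes k a := by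
  induction n, h using Nat.le_induction with
  | base => exact ha
  | succ n _ ih => exact ih ha.pred

theorem Vanishes.D {n : ℕ} {a : A} (ha : S.Vanishes n a) (i : ι) :
    S.Vanishes (n - 1) (S.D i a) := by
  cases n with
  | zero => trivial
  | succ n => exact ha.2 i

/-- By the Leibniz rule each derivative lowers the order of only one factor, so induction on the
total order applies. -/
theorem Vanishes.mul {n k : ℕ} {a b : A} (ha : S.Vanishes n a) (hb : S.Vanishes k b) :
    S.Vanishes (n + k) (a * b) := by
  obtain ⟨N, hN⟩ : ∃ N, N = n + k := ⟨_, rfl⟩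
  rw [← hN]
  induction N generalizing n k a b with
  | zero => trivial
  | succ N ih =>
    refine ⟨?_, fun i => ?_⟩
    · rw [map_mul]
      rcases n with _ | n
      · rcases k with _ | k
        · omega
        · rw [hb.1, mul_zero]
      · rw [ha.1, zero_mul]
    · rw [Derivation.leibniz, smul_eq_mul, smul_eq_mul]
      refine Vanishes.add ?_ ?_
      · rcases k with _ | k
        · obtain rfl : n = N + 1 := by omega
          exact ih ha.pred (k := 0) trivial (by omega)
        · exact ih ha (hb.D i) (by omega)
      · rcases n with _ | n
        · obtain rfl : k = N + 1 := by omega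
          exact ih hb.pred (k := 0) trivial (by omega)
        · exact ih hb (ha.D i) (by omega)

theorem Vanishes.mul_left {n : ℕ} {a : A} (ha : S.Vanishes n a) (b : A) : S.Vanishes n (b * a) := by
  have := Vanishes.mul (S := S) (n := 0) (a := b) trivial ha
  rwa [zero_add] at this

theorem Vanishes.mul_right {n : ℕ} {a : A} (ha : S.Vanishes n a) (b : A) :
    S.Vanishes n (a * b) := by
  rw [mul_comm]; exact ha.mul_left b

theorem Vanishes.smul {n : ℕ} {a : A} (ha : S.Vanishes n a) (c : ℂ) : S.Vanishes n (c • a) := by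
  rw [Algebra.smul_def]; exact ha.mul_left _

theorem Vanishes.sum {n : ℕ} {κ : Type*} (s : Finset κ) {f : κ → A}
    (h : ∀ i ∈ s, S.Vanishes n (f i)) : S.Vanishes n (∑ i ∈ s, f i) := by
  classical
  induction s using Finset.induction_on with
  | empty => simpa using Vanishes.zero n
  | insert a s ha ih =>
    rw [Finset.sum_insert ha]
    exact (h a (by simp)).add (ih fun i hi => h i (by simp [hi]))

theorem Vanishes.pow {n : ℕ} {a : A} (ha : S.Vanishes n a) (k : ℕ) : S.Vanishes (n * k) (a ^ k) := by
  induction k with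
  | zero => trivial
  | succ k ih => rw [pow_succ, mul_add, mul_one]; exact ih.mul ha

theorem vanishes_one {a : A} (h : S.ev a = 0) : S.Vanishes 1 a := ⟨h, fun _ => trivial⟩

theorem vanishes_X (i : ι) : S.Vanishes 1 (S.X i) := vanishes_one (S.ev_X i)

variable (S) in
/-- Half the Laplacian of the quadratic form `C`. -/
def lap (C : Matrix ι ι ℂ) : A →ₗ[ℂ] A :=
  (1 / 2 : ℂ) • ∑ i, ∑ j, C i j • ((S.D i : A →ₗ[ℂ] A) ∘ₗ (S.D j : A →ₗ[ℂ] A))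

theorem lap_apply (C : Matrix ι ι ℂ) (a : A) :
    S.lap C a = (1 / 2 : ℂ) • ∑ i, ∑ j, C i j • S.D i (S.D j a) := by
  simp [lap]

theorem Vanishes.lap {n : ℕ} {a : A} (ha : S.Vanishes n a) (C : Matrix ι ι ℂ) :
    S.Vanishes (n - 2) (S.lap C a) := by
  rw [lap_apply]
  refine Vanishes.smul (Vanishes.sum _ fun i _ => Vanishes.sum _ fun j _ => Vanishes.smul ?_ _) _
  exact (ha.D j).D i

theorem lap_D (C : Matrix ι ι ℂ) (k : ι) (a : A) : S.lap C (S.D k a) = S.D k (S.lap C a) := by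
  simp only [lap_apply, Derivation.map_smul, map_sum]
  congr 1
  refine Finset.sum_congr rfl fun i _ => Finset.sum_congr rfl fun j _ => ?_
  rw [S.D_comm j k, S.D_comm i k]

/-- The commutator of the Laplacian with a coordinate is a first-order operator. The two cross terms
agree because `C` is symmetric, which cancels the factor `1/2`. -/
theorem lap_X_mul {C : Matrix ι ι ℂ} (hC : ∀ i j, C i j = C j i) (k : ι) (a : A) :
    S.lap C (S.X k * a) = S.X k * S.lap C a + ∑ l, C k l • S.D l a := by
  have h1 : ∀ i j, S.D i (S.D j (S.X k * a)) = S.X k * S.D i (S.D j a)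
      + ((if i = k then S.D j a else 0) + if j = k then S.D i a else 0) := by
    intro i j
    simp only [Derivation.leibniz, smul_eq_mul, map_add, S.D_X]
    split_ifs <;> simp [add_comm, add_assoc]
  simp only [lap_apply, h1, smul_add, Finset.sum_add_distrib]
  have h2 : ∑ i, ∑ j, C i j • (if i = k then S.D j a else 0) = ∑ l, C k l • S.D l a := by
    simp only [smul_ite, smul_zero]
    rw [Finset.sum_comm]
    simp
  have h3 : ∑ i, ∑ j, C i j • (if j = k then S.D i a else 0) = ∑ l, C k l • S.D l a := by
    simp only [smul_ite, smul_zero, Finset.sum_ite_eq', Finset.mem_univ, if_true]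
    simp [hC k]
  rw [h2, h3, ← smul_add, ← two_smul ℂ (∑ l, C k l • S.D l a), smul_smul]
  norm_num
  simp [Finset.mul_sum]

/-- The commutator of `lap` with `X k` commutes with `lap`, so it comes out `p + 1` times. -/
theorem lap_pow_X_mul {C : Matrix ι ι ℂ} (hC : ∀ i j, C i j = C j i) (k : ι) (p : ℕ) (a : A) :
    ((S.lap C) ^ (p + 1)) (S.X k * a) = S.X k * ((S.lap C) ^ (p + 1)) a
      + ((p : ℂ) + 1) • ∑ l, C k l • ((S.lap C) ^ p) (S.D l a) := by
  induction p generalizing a with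
  | zero => simp [lap_X_mul hC]
  | succ p ih =>
    rw [pow_succ, Module.End.mul_apply, lap_X_mul hC, map_add, ih, map_sum]
    have : ∀ l, ((S.lap C) ^ (p + 1)) (C k l • S.D l a)
        = C k l • ((S.lap C) ^ p) (S.D l (S.lap C a)) := fun l => by
      rw [map_smul, pow_succ, Module.End.mul_apply, lap_D]
    simp only [this]
    have h' : ∀ l, ((S.lap C) ^ (p + 1)) (S.D l a) = ((S.lap C) ^ p) (S.D l (S.lap C a)) :=
      fun l => by rw [pow_succ, Module.End.mul_apply, lap_D]
    simp only [h', Module.End.mul_apply]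
    push_cast
    rw [add_smul ((p : ℂ) + 1), one_smul]
    abel

variable (S) in
/-- The homogeneous part of degree `p` in the covariance of the Gaussian expectation. -/
def moment (C : Matrix ι ι ℂ) (p : ℕ) : A →ₗ[ℂ] ℂ :=
  ((p.factorial : ℂ)⁻¹) • ((S.ev : A →ₗ[ℂ] ℂ) ∘ₗ ((S.lap C) ^ p))

theorem moment_apply (C : Matrix ι ι ℂ) (p : ℕ) (a : A) :
    S.moment C p a = (p.factorial : ℂ)⁻¹ * S.ev (((S.lap C) ^ p) a) := rfl

/-- Wick's formula, one contraction at a time: `ev` kills the term with `X k` in front, and `(p + 1)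
/ (p + 1)! = 1 / p!`. -/
theorem moment_X_mul {C : Matrix ι ι ℂ} (hC : ∀ i j, C i j = C j i) (k : ι) (p : ℕ) (a : A) :
    S.moment C (p + 1) (S.X k * a) = ∑ l, C k l * S.moment C p (S.D l a) := by
  rw [moment_apply, lap_pow_X_mul hC, map_add, map_mul, S.ev_X, zero_mul, zero_add, map_smul,
    map_sum, smul_eq_mul, Nat.factorial_succ]
  have h1 : (p.factorial : ℂ) ≠ 0 := by exact_mod_cast p.factorial_ne_zero
  have h2 : (p : ℂ) + 1 ≠ 0 := by exact_mod_cast p.succ_ne_zero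
  push_cast
  rw [mul_inv, mul_comm ((p : ℂ) + 1)⁻¹, mul_assoc, inv_mul_cancel_left₀ h2, Finset.mul_sum]
  refine Finset.sum_congr rfl fun l _ => ?_
  rw [moment_apply, map_smul, smul_eq_mul]
  ring

theorem Vanishes.moment_eq_zero {C : Matrix ι ι ℂ} {n p : ℕ} {a : A} (ha : S.Vanishes n a)
    (h : 2 * p < n) : S.moment C p a = 0 := by
  have key : ∀ p n (a : A), S.Vanishes n a → 2 * p < n → S.ev (((S.lap C) ^ p) a) = 0 := by
    intro p
    induction p with
    | zero =>
      intro n a ha h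
      obtain ⟨k, rfl⟩ : ∃ k, n = k + 1 := ⟨n - 1, by omega⟩
      exact ha.1
    | succ p ih =>
      intro n a ha h
      rw [pow_succ, Module.End.mul_apply]
      exact ih (n - 2) _ (ha.lap C) (by omega)
  rw [moment_apply, key p n a ha h, mul_zero]

variable (S) in
/-- The coefficient of `t ^ k` in the formal integral of `b * exp (-V / t)` against the Gaussian
measure of covariance `t C`. -/
def gaussCoeff (C : Matrix ι ι ℂ) (V : A) (k : ℕ) : A →ₗ[ℂ] ℂ :=
  -- The factor `t ^ (-n)` of the `n`-th term of the exponential pairs with the moment of degree `k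
  -- + n`. That moment sees `2 (k + n)` derivatives while `V ^ n` vanishes to order `3 n`, so
  -- nothing survives for `n > 2 k`.
  ∑ n ∈ Finset.range (2 * k + 1),
    ((-1) ^ n / (n.factorial : ℂ)) • (S.moment C (k + n) ∘ₗ LinearMap.mulRight ℂ (V ^ n))

theorem gaussCoeff_eq {C : Matrix ι ι ℂ} {V : A} (hV : S.Vanishes 3 V) {k N : ℕ}
    (hN : 2 * k + 1 ≤ N) (b : A) : S.gaussCoeff C V k b =
      ∑ n ∈ Finset.range N, (-1) ^ n / (n.factorial : ℂ) * S.moment C (k + n) (b * V ^ n) := by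
  simp only [gaussCoeff, LinearMap.coe_sum, Finset.sum_apply, LinearMap.smul_apply,
    LinearMap.comp_apply, LinearMap.mulRight_apply, smul_eq_mul]
  refine Finset.sum_subset (by simpa using hN) fun n _ hn => ?_
  rw [((hV.pow n).mul_left b).moment_eq_zero (by simp at hn; omega), mul_zero]

theorem gaussCoeff_eq_zero {C : Matrix ι ι ℂ} {V : A} (hV : S.Vanishes 3 V) {k n : ℕ}
    {b : A} (hb : S.Vanishes n b) (hn : 2 * k < n) : S.gaussCoeff C V k b = 0 := by
  rw [gaussCoeff_eq hV le_rfl]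
  refine Finset.sum_eq_zero fun j _ => ?_
  rw [(hb.mul (hV.pow j)).moment_eq_zero (by omega), mul_zero]

theorem gaussCoeff_zero {C : Matrix ι ι ℂ} {V : A} (hV : S.Vanishes 3 V) (b : A) :
    S.gaussCoeff C V 0 b = S.ev b := by
  rw [gaussCoeff_eq hV le_rfl]
  simp [moment_apply]

/-! ### Integration by parts for the formal integral -/

section SchwingerDyson

variable {C H : Matrix ι ι ℂ} {V : A}

/-- With `H` inverse to the covariance, Wick's formula becomes integration by parts against the
gradient of the quadratic form. -/
theorem moment_hess_mul (hC : ∀ i j, C i j = C j i) (hHC : H * C = 1) (i : ι) (p : ℕ) (a : A) :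
    S.moment C (p + 1) (a * ∑ j, H i j • S.X j) = S.moment C p (S.D i a) := by
  rw [mul_comm]
  simp only [Finset.sum_mul, smul_mul_assoc, map_sum, map_smul, smul_eq_mul, moment_X_mul hC,
    Finset.mul_sum]
  rw [Finset.sum_comm]
  have : ∀ l, ∑ j, H i j * (C j l * S.moment C p (S.D l a))
      = (if i = l then 1 else 0) * S.moment C p (S.D l a) := by
    intro l
    rw [← Matrix.one_apply, ← hHC, Matrix.mul_apply, Finset.sum_mul]
    exact Finset.sum_congr rfl fun j _ => by ring
  simp [this]

theorem gaussCoeff_zero_mul_grad (hV : S.Vanishes 3 V) (i : ι) (b : A) :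
    S.gaussCoeff C V 0 (b * (∑ j, H i j • S.X j + S.D i V)) = 0 := by
  rw [gaussCoeff_zero hV, map_mul, map_add, map_sum]
  have : S.ev (S.D i V) = 0 := (hV.2 i).1
  simp [this, S.ev_X]

/-- The quadratic part of the gradient is integrated by parts. The derivative then also falls on `V
^ n / n!`, and the result cancels the contribution of `S.D i V` from the preceding term of the
exponential series. -/
theorem gaussCoeff_succ_mul_grad (hC : ∀ i j, C i j = C j i) (hHC : H * C = 1)
    (hV : S.Vanishes 3 V) (k : ℕ) (i : ι) (b : A) :
    S.gaussCoeff C V (k + 1) (b * (∑ j, H i j • S.X j + S.D i V)) =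
      S.gaussCoeff C V k (S.D i b) := by
  set N := 2 * (k + 1) + 1 with hN
  rw [gaussCoeff_eq hV (N := N) le_rfl, gaussCoeff_eq hV (N := N) (by omega)]
  -- The contribution of `S.D i V` to the `n`-th term; these contributions telescope.
  set g : ℕ → ℂ := fun n => (-1) ^ n / (n.factorial : ℂ)
    * S.moment C (k + 1 + n) (b * S.D i V * V ^ n) with hg
  have step : ∀ n, (-1) ^ n / (n.factorial : ℂ)
      * S.moment C (k + 1 + n) (b * (∑ j, H i j • S.X j + S.D i V) * V ^ n)
      = (-1) ^ n / (n.factorial : ℂ) * S.moment C (k + n) (S.D i b * V ^ n)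
        + (g n - if n = 0 then 0 else g (n - 1)) := by
    intro n
    have e1 : b * (∑ j, H i j • S.X j + S.D i V) * V ^ n
        = (b * V ^ n) * (∑ j, H i j • S.X j) + b * S.D i V * V ^ n := by ring
    rw [e1, map_add, show k + 1 + n = k + n + 1 by ring, moment_hess_mul hC hHC,
      Derivation.leibniz, Derivation.leibniz_pow]
    rcases n with _ | n
    · simp [hg]
    · have e2 : b • ((n + 1) • V ^ (n + 1 - 1) • S.D i V) + V ^ (n + 1) • S.D i b
          = ((n : ℂ) + 1) • (b * S.D i V * V ^ n) + S.D i b * V ^ (n + 1) := by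
        rw [← Nat.cast_smul_eq_nsmul ℂ]
        simp only [smul_eq_mul, Algebra.smul_def]
        push_cast
        ring
      have h1 : (n.factorial : ℂ) ≠ 0 := by exact_mod_cast n.factorial_ne_zero
      have h2 : (n : ℂ) + 1 ≠ 0 := by exact_mod_cast n.succ_ne_zero
      rw [e2, map_add, map_smul, smul_eq_mul]
      simp only [hg, Nat.factorial_succ, Nat.add_eq_zero_iff, one_ne_zero, and_false, if_false,
        add_tsub_cancel_right]
      rw [show k + (n + 1) = k + 1 + n by ring, show k + 1 + n + 1 = k + 1 + (n + 1) by ring]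
      push_cast
      field_simp
      ring
  rw [Finset.sum_congr rfl fun n _ => step n, Finset.sum_add_distrib]
  have tel : ∀ M, ∑ n ∈ Finset.range M, (g n - if n = 0 then 0 else g (n - 1))
      = if M = 0 then 0 else g (M - 1) := by
    intro M
    induction M with
    | zero => simp
    | succ M ih => rw [Finset.sum_range_succ, ih]; simp
  rw [tel, if_neg (by omega)]
  -- The boundary term has order of vanishing at least `2 + 3 (N - 1) = 6 k + 8`, more than the `6 k
  -- + 6` derivatives of the moment.
  have : g (N - 1) = 0 := by
    have : S.Vanishes 2 (S.D i V) := hV.2 i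
    simp only [hg]
    rw [((this.mul_left b).mul (hV.pow (N - 1))).moment_eq_zero (by omega), mul_zero]
  rw [this, add_zero]

end SchwingerDyson

end FormalDisc

end QuantumTR

end

/-! ### The normalised formal integral at a nondegenerate critical point -/

noncomputable section

namespace QuantumTR

namespace FormalDisc

variable {ι A : Type*} [DecidableEq ι] [Fintype ι] [CommRing A] [Algebra ℂ A]
  {S : FormalDisc ι A}

variable (S) in
/-- The difference between a potential and its quadratic part at a critical point. -/
def higherPart (U : A) : A :=
  U - algebraMap ℂ A (S.ev U) - (1 / 2 : ℂ) • ∑ i, ∑ j, S.ev (S.D j (S.D i U)) • (S.X i * S.X j)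

theorem D_higherPart (U : A) (k : ι) :
    S.D k (S.higherPart U) = S.D k U - ∑ j, S.ev (S.D j (S.D k U)) • S.X j := by
  have h1 : ∀ i j, S.D k (S.X i * S.X j)
      = (if j = k then S.X i else 0) + if i = k then S.X j else 0 := by
    intro i j
    rw [Derivation.leibniz, S.D_X, S.D_X, smul_eq_mul, smul_eq_mul]
    simp only [eq_comm (a := k)]
    split_ifs <;> simp
  have h2 : ∑ i, ∑ j, S.ev (S.D j (S.D i U)) • (if j = k then S.X i else 0)
      = ∑ j, S.ev (S.D j (S.D k U)) • S.X j := by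
    simp only [smul_ite, smul_zero, Finset.sum_ite_eq', Finset.mem_univ, if_true]
    exact Finset.sum_congr rfl fun j _ => by rw [S.D_comm]
  have h3 : ∑ i, ∑ j, S.ev (S.D j (S.D i U)) • (if i = k then S.X j else 0)
      = ∑ j, S.ev (S.D j (S.D k U)) • S.X j := by
    simp only [smul_ite, smul_zero]
    rw [Finset.sum_comm]
    simp
  simp only [higherPart, map_sub, Derivation.map_smul, map_sum, Derivation.map_algebraMap, sub_zero,
    h1, smul_add, Finset.sum_add_distrib]
  rw [h2, h3, ← smul_add, ← two_smul ℂ (∑ j, S.ev (S.D j (S.D k U)) • S.X j), smul_smul]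
  norm_num

theorem vanishes_higherPart {U : A} (hU : ∀ i, S.ev (S.D i U) = 0) :
    S.Vanishes 3 (S.higherPart U) := by
  refine ⟨by simp [higherPart, S.ev_X], fun i => ⟨?_, fun j => ⟨?_, fun k => trivial⟩⟩⟩
  · simp [D_higherPart, hU, S.ev_X]
  · rw [D_higherPart]
    simp [S.D_X]

/-- `L a` is the quotient of `∫ a Δ exp(-U/T)` by `∫ Δ exp(-U/T)`. The function `θ` is the
logarithmic derivative of the density `Δ`, which accounts for the extra term in the integration by
parts; the last clause says that a factor of `T` costs two orders of vanishing. -/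
theorem exists_functional {U Δ : A} {θ : ι → A} {C : Matrix ι ι ℂ} {T : PowerSeries ℂ}
    (hΔ : ∀ i, S.D i Δ = Δ * θ i) (hΔ0 : S.ev Δ ≠ 0) (hU : ∀ i, S.ev (S.D i U) = 0)
    (hC : ∀ i j, C i j = C j i)
    (hHC : (Matrix.of fun i j => S.ev (S.D j (S.D i U))) * C = 1)
    (hT : PowerSeries.constantCoeff T = 0) :
    ∃ L : A →ₗ[ℂ] PowerSeries ℂ, L 1 = 1 ∧
      (∀ i a, L (a * S.D i U) = T * L (S.D i a + a * θ i)) ∧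
      ∀ k a, S.Vanishes (2 * k + 1) a → PowerSeries.X ^ (k + 1) ∣ L a := by
  set V := S.higherPart U with hVdef
  have hV : S.Vanishes 3 V := vanishes_higherPart hU
  have hT' : PowerSeries.HasSubst T := PowerSeries.HasSubst.of_constantCoeff_zero' hT
  -- The unnormalised integral in a free parameter `t`; substituting `T` for `t` is legitimate
  -- because `T` has no constant term.
  let seq : A →ₗ[ℂ] PowerSeries ℂ :=
    { toFun := fun a => PowerSeries.mk fun k => S.gaussCoeff C V k (a * Δ)
      map_add' := fun a b => by ext k; simp [add_mul]
      map_smul' := fun c a => by ext k; simp }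
  have seq_coeff : ∀ k a, PowerSeries.coeff k (seq a) = S.gaussCoeff C V k (a * Δ) :=
    fun k a => PowerSeries.coeff_mk k fun k => S.gaussCoeff C V k (a * Δ)
  let L₀ : A →ₗ[ℂ] PowerSeries ℂ := (PowerSeries.substAlgHom (R := ℂ) hT').toLinearMap ∘ₗ seq
  have hL₀ : ∀ a, L₀ a = PowerSeries.substAlgHom (R := ℂ) hT' (seq a) := fun a => rfl
  have grad : ∀ i, S.D i U = ∑ j, S.ev (S.D j (S.D i U)) • S.X j + S.D i V := by
    intro i; rw [hVdef, D_higherPart]; ring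
  have sd : ∀ i a, L₀ (a * S.D i U) = T * L₀ (S.D i a + a * θ i) := by
    intro i a
    have : seq (a * S.D i U) = PowerSeries.X * seq (S.D i a + a * θ i) := by
      ext k
      have e : a * S.D i U * Δ = (a * Δ) * (∑ j, S.ev (S.D j (S.D i U)) • S.X j + S.D i V) := by
        rw [← grad]; ring
      rcases k with _ | k
      · rw [seq_coeff, e, PowerSeries.coeff_zero_X_mul]
        exact gaussCoeff_zero_mul_grad
          (H := Matrix.of fun i j => S.ev (S.D j (S.D i U))) hV i _
      · rw [seq_coeff, e, PowerSeries.coeff_succ_X_mul, seq_coeff]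
        refine (gaussCoeff_succ_mul_grad
          (H := Matrix.of fun i j => S.ev (S.D j (S.D i U))) hC hHC hV k i _).trans ?_
        congr 1
        rw [Derivation.leibniz, hΔ, smul_eq_mul, smul_eq_mul]
        ring
    rw [hL₀, this, map_mul, PowerSeries.substAlgHom_X, ← hL₀]
  have div : ∀ k a, S.Vanishes (2 * k + 1) a → PowerSeries.X ^ (k + 1) ∣ L₀ a := by
    intro k a ha
    have h1 : PowerSeries.X ^ (k + 1) ∣ seq a := by
      rw [PowerSeries.X_pow_dvd_iff]
      intro j hj
      rw [seq_coeff, gaussCoeff_eq_zero hV (ha.mul_right Δ) (by omega)]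
    obtain ⟨q, hq⟩ := h1
    have h2 : (PowerSeries.X : PowerSeries ℂ) ∣ T := PowerSeries.X_dvd_iff.2 hT
    rw [hL₀, hq, map_mul, map_pow, PowerSeries.substAlgHom_X]
    exact (pow_dvd_pow_of_dvd h2 _).mul_right _
  -- The leading term of the total mass is the density at the critical point, so the mass can be
  -- inverted.
  have h0 : PowerSeries.constantCoeff (L₀ 1) ≠ 0 := by
    have e2 : seq 1 = PowerSeries.C (S.ev Δ) +
        PowerSeries.X * PowerSeries.mk fun k => PowerSeries.coeff (k + 1) (seq 1) := by
      ext k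
      rcases k with _ | k
      · simp [seq_coeff, gaussCoeff_zero hV]
      · simp [PowerSeries.coeff_succ_X_mul]
    rw [hL₀, e2, map_add, map_mul, PowerSeries.substAlgHom_X, map_add, map_mul, hT, zero_mul,
      add_zero, PowerSeries.coe_substAlgHom, PowerSeries.subst_C]
    change PowerSeries.constantCoeff (PowerSeries.C (S.ev Δ)) ≠ 0
    rwa [PowerSeries.constantCoeff_C]
  refine ⟨LinearMap.mulLeft ℂ (L₀ 1)⁻¹ ∘ₗ L₀, ?_, fun i a => ?_, fun k a ha => ?_⟩
  · simp [PowerSeries.inv_mul_cancel _ h0]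
  · simp only [LinearMap.comp_apply, LinearMap.mulLeft_apply, sd]
    ring
  · simp only [LinearMap.comp_apply, LinearMap.mulLeft_apply]
    exact (div k a ha).mul_left _

end FormalDisc

end QuantumTR

end

/-! ### Functionals of sources: the ring of functions of a multiset -/

noncomputable section

namespace QuantumTR

/-- Functions of a multiset of points, multiplied by distributing the points among the factors. -/
@[ext] structure MultisetFun (X R : Type*) where
  toFun : Multiset X → R

namespace MultisetFun

instance {X R : Type*} : CoeFun (MultisetFun X R) fun _ => Multiset X → R := ⟨toFun⟩

theorem ext_apply {X R : Type*} {f g : MultisetFun X R} (h : ∀ s, f s = g s) : f = g :=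
  MultisetFun.ext (funext h)

variable {X R : Type*} [CommRing R]

instance : Zero (MultisetFun X R) := ⟨⟨fun _ => 0⟩⟩
instance : Add (MultisetFun X R) := ⟨fun f g => ⟨fun s => f s + g s⟩⟩
instance : Neg (MultisetFun X R) := ⟨fun f => ⟨fun s => -f s⟩⟩
instance : Sub (MultisetFun X R) := ⟨fun f g => ⟨fun s => f s - g s⟩⟩

theorem add_apply (f g : MultisetFun X R) (s : Multiset X) : (f + g) s = f s + g s := rfl
theorem sub_apply (f g : MultisetFun X R) (s : Multiset X) : (f - g) s = f s - g s := rfl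
theorem zero_apply (s : Multiset X) : (0 : MultisetFun X R) s = 0 := rfl

instance : AddCommGroup (MultisetFun X R) where
  add_assoc a b c := ext_apply fun s => add_assoc _ _ _
  zero_add a := ext_apply fun s => zero_add _
  add_zero a := ext_apply fun s => add_zero _
  add_comm a b := ext_apply fun s => add_comm _ _
  neg_add_cancel a := ext_apply fun s => neg_add_cancel _
  sub_eq_add_neg a b := ext_apply fun s => sub_eq_add_neg _ _
  zsmul := zsmulRec
  nsmul := nsmulRec

/-- Insertion of the point `x`. -/
def ins (x : X) : MultisetFun X R →+ MultisetFun X R where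
  toFun f := ⟨fun s => f (x ::ₘ s)⟩
  map_zero' := rfl
  map_add' _ _ := rfl

theorem ins_apply (x : X) (f : MultisetFun X R) (s : Multiset X) : ins x f s = f (x ::ₘ s) := rfl

theorem apply_cons (f : MultisetFun X R) (x : X) (s : Multiset X) : f (x ::ₘ s) = ins x f s := rfl

/-- `ins x` plays the role of the functional derivative at `x`: a functional is determined by its
value without sources and its derivatives. -/
theorem ext_ins {f g : MultisetFun X R} (h0 : f 0 = g 0) (h : ∀ x, ins x f = ins x g) : f = g := by
  refine ext_apply fun s => ?_
  induction s using Multiset.induction_on with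
  | empty => exact h0
  | cons x s _ => rw [apply_cons, h, apply_cons]

instance : Mul (MultisetFun X R) :=
  ⟨fun f g => ⟨fun s => (s.antidiagonal.map fun p => f p.1 * g p.2).sum⟩⟩

instance : One (MultisetFun X R) := ⟨⟨fun s => if s.card = 0 then 1 else 0⟩⟩

theorem mul_apply (f g : MultisetFun X R) (s : Multiset X) :
    (f * g) s = (s.antidiagonal.map fun p => f p.1 * g p.2).sum := rfl

theorem mul_apply_zero (f g : MultisetFun X R) : (f * g) 0 = f 0 * g 0 := by simp [mul_apply]

theorem one_apply_zero : (1 : MultisetFun X R) 0 = 1 := rfl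

theorem one_apply_of_ne {s : Multiset X} (hs : s ≠ 0) : (1 : MultisetFun X R) s = 0 :=
  if_neg (by simpa using hs)

theorem ins_one (x : X) : ins x (1 : MultisetFun X R) = 0 := by
  refine ext_apply fun s => ?_; exact one_apply_of_ne (by simp)

/-- The inserted point goes to one of the two factors, so insertion is a derivation. Together with
induction on the multiset this yields the ring axioms without handling multiple splittings directly.
-/
theorem ins_mul (x : X) (f g : MultisetFun X R) : ins x (f * g) = ins x f * g + f * ins x g := by
  refine ext_apply fun s => ?_
  simp [ins_apply, add_apply, mul_apply, Multiset.map_add, add_comm]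

protected theorem mul_comm' (f g : MultisetFun X R) : f * g = g * f := by
  refine ext_apply fun s => ?_
  induction s using Multiset.induction_on generalizing f g with
  | empty => simp [mul_apply_zero, mul_comm]
  | cons x s ih =>
    rw [apply_cons, apply_cons, ins_mul, ins_mul, add_apply, add_apply, ih, ih f, add_comm]

protected theorem add_mul' (f g h : MultisetFun X R) : (f + g) * h = f * h + g * h := by
  refine ext_apply fun s => ?_; simp [mul_apply, add_apply, add_mul]

protected theorem mul_assoc' (f g h : MultisetFun X R) : f * g * h = f * (g * h) := by
  refine ext_apply fun s => ?_
  induction s using Multiset.induction_on generalizing f g h with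
  | empty => simp [mul_apply_zero, mul_assoc]
  | cons x s ih =>
    have mul_add' : ∀ a b c : MultisetFun X R, a * (b + c) = a * b + a * c := fun a b c => by
      rw [MultisetFun.mul_comm', MultisetFun.add_mul', MultisetFun.mul_comm' a,
        MultisetFun.mul_comm' a]
    rw [apply_cons, apply_cons, ins_mul, ins_mul, ins_mul, ins_mul, MultisetFun.add_mul', mul_add']
    simp only [add_apply, ih, add_assoc]

protected theorem one_mul' (f : MultisetFun X R) : 1 * f = f := by
  refine ext_apply fun s => ?_
  induction s using Multiset.induction_on generalizing f with
  | empty => simp [mul_apply_zero, one_apply_zero]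
  | cons x s ih =>
    have z : ∀ h : MultisetFun X R, (0 : MultisetFun X R) * h = 0 := fun h => by
      refine ext_apply fun s => ?_; simp [mul_apply, zero_apply]
    rw [apply_cons, apply_cons, ins_mul, add_apply, ih, ins_one, z, zero_apply, zero_add]

instance : CommRing (MultisetFun X R) :=
  { (inferInstance : AddCommGroup (MultisetFun X R)) with
    mul_assoc := MultisetFun.mul_assoc'
    mul_comm := MultisetFun.mul_comm'
    one_mul := MultisetFun.one_mul'
    mul_one := fun f => by rw [MultisetFun.mul_comm', MultisetFun.one_mul']
    left_distrib := fun a b c => by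
      rw [MultisetFun.mul_comm', MultisetFun.add_mul', MultisetFun.mul_comm' a,
        MultisetFun.mul_comm' a]
    right_distrib := MultisetFun.add_mul'
    zero_mul := fun h => by refine ext_apply fun s => ?_; simp [mul_apply, zero_apply]
    mul_zero := fun h => by refine ext_apply fun s => ?_; simp [mul_apply, zero_apply] }

/-- The constant function, supported at the empty multiset. -/
def const (c : R) : MultisetFun X R := ⟨fun s => if s.card = 0 then c else 0⟩

theorem const_apply_zero (c : R) : (const c : MultisetFun X R) 0 = c := rfl

theorem ins_const (x : X) (c : R) : ins x (const c : MultisetFun X R) = 0 := by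
  refine ext_apply fun s => ?_; exact if_neg (by simp)

theorem const_mul_apply (c : R) (f : MultisetFun X R) (s : Multiset X) :
    (const c * f : MultisetFun X R) s = c * f s := by
  induction s using Multiset.induction_on generalizing f with
  | empty => rw [mul_apply_zero, const_apply_zero]
  | cons x s ih =>
    rw [apply_cons, apply_cons, ins_mul, ins_const, zero_mul, zero_add, ih]

/-- Every factor must receive at least one point. -/
theorem pow_apply_eq_zero {N : MultisetFun X R} (hN : N 0 = 0) :
    ∀ (k : ℕ) (s : Multiset X), s.card < k → (N ^ k) s = 0 := by
  intro k
  induction k with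
  | zero => intro s hs; omega
  | succ k ih =>
    intro s hs
    rw [pow_succ, mul_apply]
    refine Multiset.sum_eq_zero fun y hy => ?_
    obtain ⟨p, hp, rfl⟩ := Multiset.mem_map.1 hy
    rw [Multiset.mem_antidiagonal] at hp
    rcases eq_or_ne p.2 0 with h | h
    · rw [h, hN, mul_zero]
    · rw [ih p.1, zero_mul]
      have := congrArg Multiset.card hp
      rw [Multiset.card_add] at this
      have := Multiset.card_pos.2 h
      omega

/-- The geometric series in `1 - M` is finite at each multiset, since powers beyond the cardinality
vanish. -/
theorem exists_mul_eq_one {M : MultisetFun X R} (hM : M 0 = 1) : ∃ N, M * N = 1 := by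
  set Z : MultisetFun X R := 1 - M with hZ
  have hZ0 : Z 0 = 0 := by rw [hZ, sub_apply, hM, one_apply_zero, sub_self]
  let P : ℕ → MultisetFun X R := fun n => ∑ k ∈ Finset.range (n + 1), Z ^ k
  have hP : ∀ n, M * P n = 1 - Z ^ (n + 1) := fun n => by
    rw [show M = 1 - Z by rw [hZ]; ring]; exact mul_neg_geom_sum Z (n + 1)
  have stable : ∀ (s : Multiset X) n, s.card ≤ n → P n s = P s.card s := by
    intro s n hn
    induction n, hn using Nat.le_induction with
    | base => rfl
    | succ n h ih =>
      have : P (n + 1) = P n + Z ^ (n + 1) := Finset.sum_range_succ (fun k => Z ^ k) (n + 1)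
      rw [this, add_apply, ih, pow_apply_eq_zero hZ0 _ _ (by omega), add_zero]
  -- At a multiset `s` the series is cut after the power `s.card`; by `stable` any later cut gives
  -- the same value.
  refine ⟨⟨fun s => P s.card s⟩, ?_⟩
  refine ext_apply fun s => ?_
  have h1 : (M * ⟨fun s => P s.card s⟩ : MultisetFun X R) s = (M * P s.card) s := by
    rw [mul_apply, mul_apply]
    refine congrArg _ (Multiset.map_congr rfl fun p hp => ?_)
    rw [Multiset.mem_antidiagonal] at hp
    have : p.2.card ≤ s.card := by rw [← hp, Multiset.card_add]; omega
    exact congrArg _ (stable _ _ this).symm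
  rw [h1, hP, sub_apply, pow_apply_eq_zero hZ0 _ _ (by omega), sub_zero]

section Source

variable [DecidableEq X]

/-- The sum over the points `y` of `s` of the value of `h y` at the remaining points. -/
def source : (X → MultisetFun X R) →+ MultisetFun X R where
  toFun h := ⟨fun s => (s.map fun y => h y (s.erase y)).sum⟩
  map_zero' := by refine ext_apply fun s => ?_; simp [zero_apply]
  map_add' a b := by refine ext_apply fun s => ?_; simp [add_apply]

theorem source_apply (h : X → MultisetFun X R) (s : Multiset X) :
    source h s = (s.map fun y => h y (s.erase y)).sum := rfl

theorem source_apply_zero (h : X → MultisetFun X R) : source h 0 = 0 := by simp [source_apply]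

/-- The new point is either the distinguished one or belongs to the remaining ones. The case
distinction `y = x` in the proof deals with repeated points. -/
theorem ins_source (x : X) (h : X → MultisetFun X R) :
    ins x (source h) = h x + source fun y => ins x (h y) := by
  refine ext_apply fun s => ?_
  simp only [ins_apply, add_apply, source_apply, Multiset.map_cons, Multiset.sum_cons,
    Multiset.erase_cons_head]
  congr 2
  refine Multiset.map_congr rfl fun y hy => ?_
  congr 1
  rcases eq_or_ne y x with rfl | hne
  · rw [Multiset.erase_cons_head, Multiset.cons_erase hy]
  · rw [Multiset.erase_cons_tail _ hne.symm]

theorem source_mul (h : X → MultisetFun X R) (M : MultisetFun X R) :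
    (source fun y => h y * M) = source h * M := by
  refine ext_apply fun s => ?_
  induction s using Multiset.induction_on generalizing h M with
  | empty => simp [mul_apply_zero, source_apply_zero]
  | cons x s ih =>
    have add' : ∀ a b : X → MultisetFun X R, (source fun y => a y + b y) = source a + source b :=
      fun a b => map_add source a b
    rw [apply_cons, apply_cons, ins_source, ins_mul, ins_source]
    simp only [ins_mul, add', add_apply, ih, add_mul]
    ring

end Source

end MultisetFun

end QuantumTR

end

/-! ### Moments, cumulants and the Schwinger–Dyson equation with sources -/

noncomputable section

namespace QuantumTR

open MultisetFun

variable {ι A X : Type*} [DecidableEq ι] [Fintype ι] [CommRing A] [Algebra ℂ A]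
  (L : A →ₗ[ℂ] PowerSeries ℂ) (κ : PowerSeries ℂ) (om : X → A)

/-- The generating function of the moments `⟨a om(y₁) ⋯ om(yₙ)⟩`, weighted by `κ ^ n`. -/
def momentFun : A →+ MultisetFun X (PowerSeries ℂ) where
  toFun a := ⟨fun s => κ ^ s.card * L (a * (s.map om).prod)⟩
  map_zero' := by refine ext_apply fun s => ?_; simp [MultisetFun.zero_apply]
  map_add' a b := by refine ext_apply fun s => ?_; simp [MultisetFun.add_apply, add_mul, mul_add]

theorem momentFun_apply (a : A) (s : Multiset X) :
    momentFun L κ om a s = κ ^ s.card * L (a * (s.map om).prod) := rfl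

theorem momentFun_apply_zero (a : A) : momentFun L κ om a 0 = L a := by simp [momentFun_apply]

theorem ins_momentFun (x : X) (a : A) :
    ins x (momentFun L κ om a) = const κ * momentFun L κ om (om x * a) := by
  refine ext_apply fun s => ?_
  rw [const_mul_apply, ins_apply, momentFun_apply, momentFun_apply, Multiset.card_cons,
    Multiset.map_cons, Multiset.prod_cons, pow_succ', mul_assoc, mul_left_comm a, ← mul_assoc (om x)]

variable {L} in
theorem exists_momentFun_one_mul (hL : L 1 = 1) : ∃ N, momentFun L κ om 1 * N = 1 :=
  exists_mul_eq_one (by rw [momentFun_apply_zero, hL])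

/-- The expectation of `a` in the presence of sources at the points of a multiset, that is,
the generating function of the cumulants `⟨a ; om(y₁) ; ⋯ ; om(yₙ)⟩`. -/
def cumulant (hL : L 1 = 1) : A →+ MultisetFun X (PowerSeries ℂ) :=
  (AddMonoidHom.mulRight (exists_momentFun_one_mul κ om hL).choose).comp (momentFun L κ om)

variable {L} (hL : L 1 = 1)

theorem cumulant_eq (a : A) : cumulant L κ om hL a =
    momentFun L κ om a * (exists_momentFun_one_mul κ om hL).choose := rfl

theorem momentFun_one_mul_choose :
    momentFun L κ om 1 * (exists_momentFun_one_mul κ om hL).choose = 1 :=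
  (exists_momentFun_one_mul κ om hL).choose_spec

theorem cumulant_mul_momentFun_one (a : A) :
    cumulant L κ om hL a * momentFun L κ om 1 = momentFun L κ om a := by
  rw [cumulant_eq, mul_assoc, mul_comm _ (momentFun L κ om 1), momentFun_one_mul_choose κ om hL, mul_one]

theorem cumulant_one : cumulant L κ om hL 1 = 1 := by
  rw [cumulant_eq, momentFun_one_mul_choose κ om hL]

theorem cumulant_apply_zero (a : A) : cumulant L κ om hL a 0 = L a := by
  have := congrArg (fun f : MultisetFun X (PowerSeries ℂ) => f 0)
    (cumulant_mul_momentFun_one κ om hL a)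
  simpa [mul_apply_zero, momentFun_apply_zero, hL] using this

theorem cumulant_smul_apply (c : ℂ) (a : A) (s : Multiset X) :
    cumulant L κ om hL (c • a) s = c • cumulant L κ om hL a s := by
  rw [cumulant_eq, cumulant_eq, mul_apply, mul_apply, Multiset.smul_sum, Multiset.map_map]
  refine congrArg _ (Multiset.map_congr rfl fun p _ => ?_)
  simp [momentFun_apply]

/-- The cumulant of `a` with sources at `s`, as a linear function of `a`. -/
def cumulantL (s : Multiset X) : A →ₗ[ℂ] PowerSeries ℂ where
  toFun a := cumulant L κ om hL a s
  map_add' a b := by rw [map_add]; rfl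
  map_smul' c a := cumulant_smul_apply κ om hL c a s

theorem cumulantL_apply (s : Multiset X) (a : A) :
    cumulantL κ om hL s a = cumulant L κ om hL a s := rfl

/-- The quotient rule for `momentFun a / momentFun 1`. -/
theorem ins_cumulant (x : X) (a : A) : ins x (cumulant L κ om hL a) =
    const κ * cumulant L κ om hL (om x * a)
      - cumulant L κ om hL a * (const κ * cumulant L κ om hL (om x)) := by
  have h1 := congrArg (ins x) (cumulant_mul_momentFun_one κ om hL a)
  rw [ins_mul, ins_momentFun, ins_momentFun, mul_one] at h1
  have h2 := momentFun_one_mul_choose κ om hL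
  set N := (exists_momentFun_one_mul κ om hL).choose
  have h3 : ∀ b, cumulant L κ om hL b = momentFun L κ om b * N := fun b => rfl
  rw [h3 (om x * a), h3 (om x)]
  linear_combination N * h1 - ins x (cumulant L κ om hL a) * h2

/-- The connected correlator with first argument `x`, as a function of the other arguments. -/
def corrFun (x : X) : MultisetFun X (PowerSeries ℂ) := const κ * cumulant L κ om hL (om x)

theorem ins_corrFun (x y : X) : ins y (corrFun κ om hL x) =
    const κ * const κ * cumulant L κ om hL (om y * om x)
      - corrFun κ om hL x * corrFun κ om hL y := by
  rw [corrFun, ins_mul, ins_const, zero_mul, zero_add, ins_cumulant]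
  simp only [corrFun]
  ring

/-- The origin of the symmetry in the theorem: the second cumulant is the expectation of a
commutative product minus a product of expectations. -/
theorem ins_corrFun_comm (x y : X) :
    ins y (corrFun κ om hL x) = ins x (corrFun κ om hL y) := by
  rw [ins_corrFun, ins_corrFun, mul_comm (om y), mul_comm (corrFun κ om hL x)]

variable [DecidableEq X] {S : FormalDisc ι A} {T : PowerSeries ℂ} {E θ : ι → A}

/-- Integration by parts lets `S.D i` act on the inserted observables too; each source point
contributes such a term, collected by `source`. -/
theorem momentFun_mul_grad (hSD : ∀ i a, L (a * E i) = T * L (S.D i a + a * θ i)) (i : ι) (a : A) :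
    momentFun L κ om (a * E i) = const T * (momentFun L κ om (S.D i a + a * θ i)
      + const κ * source fun y => momentFun L κ om (a * S.D i (om y))) := by
  refine ext_apply fun s => ?_
  induction s using Multiset.induction_on generalizing a with
  | empty =>
    rw [const_mul_apply, MultisetFun.add_apply, const_mul_apply, source_apply_zero, momentFun_apply_zero, hSD,
      momentFun_apply_zero, mul_zero, add_zero]
  | cons x s ih =>
    have h : ins x (source fun y => momentFun L κ om (a * S.D i (om y)))
        = momentFun L κ om (a * S.D i (om x))
          + const κ * source fun y => momentFun L κ om (om x * a * S.D i (om y)) := by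
      rw [ins_source, mul_comm (const κ), ← source_mul]
      simp only [ins_momentFun, mul_comm (const κ), mul_assoc]
    rw [apply_cons, apply_cons, ins_momentFun, ins_mul, ins_const, zero_mul, zero_add, map_add,
      ins_mul, ins_const, zero_mul, zero_add, h, ins_momentFun, ← mul_assoc, const_mul_apply, ih]
    have e : S.D i (om x * a) + om x * a * θ i = om x * (S.D i a + a * θ i) + a * S.D i (om x) := by
      rw [Derivation.leibniz, smul_eq_mul, smul_eq_mul]; ring
    rw [e, map_add, ← const_mul_apply]
    congr 1
    ring

theorem cumulant_mul_grad (hSD : ∀ i a, L (a * E i) = T * L (S.D i a + a * θ i)) (i : ι) (a : A) :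
    cumulant L κ om hL (a * E i) = const T * (cumulant L κ om hL (S.D i a + a * θ i)
      + const κ * source fun y => cumulant L κ om hL (a * S.D i (om y))) := by
  simp only [cumulant_eq, momentFun_mul_grad κ om hSD, source_mul]
  ring

end QuantumTR

end

/-! ### Orders of the connected correlators -/

noncomputable section

namespace QuantumTR

open MultisetFun

variable {ι A X : Type*} [DecidableEq ι] [Fintype ι] [CommRing A] [Algebra ℂ A]
  {S : FormalDisc ι A}

namespace FormalDisc

theorem vanishes_of_mem_pow {n : ℕ} {a : A} (ha : a ∈ RingHom.ker S.ev ^ n) : S.Vanishes n a := by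
  induction n generalizing a with
  | zero => trivial
  | succ n ih =>
    rw [pow_succ] at ha
    induction ha using Submodule.mul_induction_on' with
    | mem_mul_mem b hb c hc => exact (ih hb).mul (vanishes_one hc)
    | add _ _ _ _ h1 h2 => exact h1.add h2

theorem X_mem_ker (i : ι) : S.X i ∈ RingHom.ker S.ev := S.ev_X i

-- First-order Taylor expansion with remainder in the square of the maximal ideal. The remainder has
-- to lie in the ideal power, not just vanish to second order, because the estimate below replaces
-- its factors one by one.
variable (S) in
theorem sub_linearPart_mem {e : A} (he : S.ev e = 0) :
    e - ∑ j, S.ev (S.D j e) • S.X j ∈ RingHom.ker S.ev ^ 2 := by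
  obtain ⟨c, hc⟩ := S.exists_sum_of_ev_eq_zero e he
  have h : ∀ j, S.ev (S.D j e) = S.ev (c j) := by
    intro j
    simp [hc, S.D_X, S.ev_X, apply_ite S.ev]
  have h2 : e - ∑ j, S.ev (S.D j e) • S.X j
      = ∑ j, (c j - algebraMap ℂ A (S.ev (c j))) * S.X j := by
    simp only [h, sub_mul, Finset.sum_sub_distrib, ← hc, Algebra.smul_def]
  rw [h2, pow_two]
  refine Ideal.sum_mem _ fun j _ => Ideal.mul_mem_mul ?_ (X_mem_ker j)
  simp [RingHom.mem_ker]

end FormalDisc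

open FormalDisc

variable {L : A →ₗ[ℂ] PowerSeries ℂ} (κ : PowerSeries ℂ) (om : X → A) (hL : L 1 = 1)

/-- The crude estimate, uniform in the sources: inserting observables does not lower the order of
vanishing. -/
theorem dvd_cumulant_of_vanishes
    (hv : ∀ k a, S.Vanishes (2 * k + 1) a → PowerSeries.X ^ (k + 1) ∣ L a) {k : ℕ} {a : A}
    (ha : S.Vanishes (2 * k + 1) a) (s : Multiset X) :
    PowerSeries.X ^ (k + 1) ∣ cumulant L κ om hL a s := by
  rw [cumulant_eq, mul_apply]
  refine Multiset.dvd_sum fun y hy => ?_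
  obtain ⟨p, _, rfl⟩ := Multiset.mem_map.1 hy
  exact ((hv k _ (ha.mul_right _)).mul_left _).mul_right _

variable [DecidableEq X] {T : PowerSeries ℂ} {E θ : ι → A} {C : Matrix ι ι ℂ}

/-- The connected correlators of `n + 1` observables are of order `n` in the expansion parameter. -/
theorem X_pow_card_dvd_cumulant
    (hSD : ∀ i a, L (a * E i) = T * L (S.D i a + a * θ i))
    (hv : ∀ k a, S.Vanishes (2 * k + 1) a → PowerSeries.X ^ (k + 1) ∣ L a)
    (hT : PowerSeries.X ∣ T) (hE : ∀ i, S.ev (E i) = 0)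
    (hC : C * (Matrix.of fun i j => S.ev (S.D j (E i))) = 1) (s : Multiset X) (a : A) :
    PowerSeries.X ^ s.card ∣ cumulant L κ om hL a s := by
  obtain ⟨n, hn⟩ : ∃ n, n = s.card := ⟨_, rfl⟩
  -- Outer induction on the number of sources; the inner induction on `j` gains one power of `X` at
  -- a time.
  induction n using Nat.strong_induction_on generalizing s a with
  | _ n ih =>
  subst hn
  suffices H : ∀ j ≤ s.card, ∀ a, PowerSeries.X ^ j ∣ cumulant L κ om hL a s from H _ le_rfl a
  intro j
  induction j with
  | zero => intro _ a; simp
  | succ j ihj =>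
  intro hj a
  -- Integration by parts gives a factor `T`. What remains either has all the sources, where
  -- divisibility by `X ^ j` is known, or has lost one source, where the outer induction applies.
  have grad : ∀ i b, PowerSeries.X ^ (j + 1) ∣ cumulant L κ om hL (b * E i) s := by
    intro i b
    rw [cumulant_mul_grad κ om hL hSD, const_mul_apply, MultisetFun.add_apply, const_mul_apply,
      source_apply, pow_succ']
    refine mul_dvd_mul hT (dvd_add (ihj (by omega) _) (Dvd.dvd.mul_left ?_ _))
    refine Multiset.dvd_sum fun y hy => ?_
    obtain ⟨z, hz, rfl⟩ := Multiset.mem_map.1 hy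
    have hc := Multiset.card_erase_of_mem hz
    rw [Nat.pred_eq_sub_one] at hc
    have := Multiset.card_pos_iff_exists_mem.2 ⟨z, hz⟩
    exact (pow_dvd_pow _ (by omega)).trans (ih _ (by omega) _ _ rfl)
  -- Since the Hessian is invertible, each coordinate is a combination of the gradient components up
  -- to a quadratic error.
  have hX : ∀ i, S.X i = ∑ l, C i l • (E l - (E l - ∑ j, S.ev (S.D j (E l)) • S.X j)) := by
    intro i
    have e : ∀ k, ∑ l, C i l * S.ev (S.D k (E l)) = if i = k then 1 else 0 := by
      intro k
      rw [← Matrix.one_apply, ← hC, Matrix.mul_apply]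
      rfl
    simp only [sub_sub_cancel, Finset.smul_sum, smul_smul]
    rw [Finset.sum_comm]
    simp only [← Finset.sum_smul, e]
    simp
  -- Descending induction on the ideal power `N`. At `N = 2 j + 2` the crude estimate suffices;
  -- below, one coordinate is traded for gradient components, covered by `grad`, plus an error in
  -- the next ideal power.
  have down : ∀ d N, N + d = 2 * j + 2 → ∀ a ∈ RingHom.ker S.ev ^ N, 1 ≤ N →
      PowerSeries.X ^ (j + 1) ∣ cumulant L κ om hL a s := by
    intro d
    induction d with
    | zero =>
      intro N hN a ha _
      exact dvd_cumulant_of_vanishes κ om hL hv ((vanishes_of_mem_pow ha).mono (by omega)) s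
    | succ d ihd =>
      intro N hN a ha h1
      obtain ⟨N, rfl⟩ : ∃ k, N = k + 1 := ⟨N - 1, by omega⟩
      rw [pow_succ] at ha
      induction ha using Submodule.mul_induction_on' with
      | add x _ y _ h1 h2 => rw [map_add]; exact dvd_add h1 h2
      | mem_mul_mem b hb c hc =>
        obtain ⟨c, rfl⟩ := S.exists_sum_of_ev_eq_zero c hc
        rw [← cumulantL_apply, Finset.mul_sum, map_sum]
        refine Finset.dvd_sum fun i _ => ?_
        rw [hX, Finset.mul_sum, Finset.mul_sum, map_sum]
        refine Finset.dvd_sum fun l _ => ?_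
        rw [mul_smul_comm, mul_smul_comm, map_smul, PowerSeries.smul_eq_C_mul, mul_sub, mul_sub,
          map_sub, cumulantL_apply, cumulantL_apply, ← mul_assoc b]
        refine Dvd.dvd.mul_left (dvd_sub (grad _ _) (ihd (N + 2) (by omega) _ ?_ (by omega))) _
        rw [← mul_assoc, pow_add]
        exact Ideal.mul_mem_mul (Ideal.mul_mem_right _ _ hb) (sub_linearPart_mem S (hE l))
  -- A constant is uncorrelated with any source, so only the part in the maximal ideal matters.
  have ha : a = S.ev a • (1 : A) + (a - algebraMap ℂ A (S.ev a)) := by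
    rw [Algebra.smul_def]; ring
  rw [ha, ← cumulantL_apply, map_add, map_smul]
  refine dvd_add ?_ (down (2 * j + 1) 1 (by omega) _ (by simp [RingHom.mem_ker]) le_rfl)
  have hs : s ≠ 0 := by rintro rfl; simp at hj
  rw [cumulantL_apply, cumulant_one, one_apply_of_ne hs, smul_zero]
  exact dvd_zero _

end QuantumTR

end

/-! ### Formal power series as a formal disc, and the Poincaré lemma -/

noncomputable section

namespace QuantumTR

section Disc

variable {m : ℕ}

open MvPowerSeries

/-- The formal power series with given coefficients. -/
def seriesOf (c : (Fin m →₀ ℕ) → ℂ) : MvPowerSeries (Fin m) ℂ := c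

theorem coeff_seriesOf (c : (Fin m →₀ ℕ) → ℂ) (α : Fin m →₀ ℕ) : coeff α (seriesOf c) = c α := rfl

theorem coeff_mul_X_eq (i : Fin m) (f : MvPowerSeries (Fin m) ℂ) (α : Fin m →₀ ℕ) :
    coeff α (f * MvPowerSeries.X i) =
      if 1 ≤ α i then coeff (α - Finsupp.single i 1) f else 0 := by
  rw [MvPowerSeries.X, coeff_mul_monomial, mul_one]
  simp [Finsupp.single_le_iff]

theorem sub_single_add_single {α : Fin m →₀ ℕ} {i : Fin m} (h : 1 ≤ α i) :
    α - Finsupp.single i 1 + Finsupp.single i 1 = α :=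
  tsub_add_cancel_of_le (by simpa [Finsupp.single_le_iff] using h)

/-- The formal power series in `m` variables as a formal disc. -/
def formalDisc (m : ℕ) : FormalDisc (Fin m) (MvPowerSeries (Fin m) ℂ) where
  D := pderiv ℂ
  X := MvPowerSeries.X
  ev := { constantCoeff with commutes' := fun r => constantCoeff_C r }
  D_comm i j a := by
    ext n
    simp only [coeff_pderiv, Finsupp.add_apply]
    rw [add_right_comm]
    rcases eq_or_ne i j with rfl | h
    · ring
    · simp [h, h.symm]; ring
  D_X i j := by rw [pderiv_X, Pi.single_apply]; simp [eq_comm]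
  ev_X i := constantCoeff_X i
  exists_sum_of_ev_eq_zero a ha := by
    have ha : coeff 0 a = 0 := ha
    -- Euler's identity: the coefficient at `α` is shared among the variables in the proportions `α
    -- i / α.degree`.
    refine ⟨fun i => seriesOf fun β =>
      coeff (β + Finsupp.single i 1) a * (β i + 1) / (β.degree + 1), ?_⟩
    ext α
    rw [map_sum]
    simp only [coeff_mul_X_eq]
    have h1 : ∀ i, (if 1 ≤ α i then coeff (α - Finsupp.single i 1)
        (seriesOf fun β => coeff (β + Finsupp.single i 1) a * (β i + 1) / (β.degree + 1))
          else 0) = coeff α a * (α i) / α.degree := by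
      intro i
      split_ifs with h
      · have h2 := sub_single_add_single h
        have h3 : (α - Finsupp.single i 1).degree + 1 = α.degree := by
          conv_rhs => rw [← h2, map_add, Finsupp.degree_single]
        rw [← h3, coeff_seriesOf, h2]
        have h4 : (((α - Finsupp.single i 1 : Fin m →₀ ℕ) i : ℕ) : ℂ) + 1 = α i := by
          simp only [Finsupp.tsub_apply, Finsupp.single_eq_same]
          exact_mod_cast Nat.sub_add_cancel h
        rw [h4]
        push_cast
        rfl
      · have : α i = 0 := by omega
        simp [this]
    simp only [h1]
    rw [← Finset.sum_div, ← Finset.mul_sum, ← Nat.cast_sum, ← Finsupp.degree_eq_sum]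
    rcases eq_or_ne α 0 with rfl | h
    · simp [ha]
    · have : (α.degree : ℂ) ≠ 0 := Nat.cast_ne_zero.2 ((Finsupp.degree_eq_zero_iff α).not.2 h)
      field_simp

/-- A formal power series with prescribed, compatible, partial derivatives. -/
def potential (E : Fin m → MvPowerSeries (Fin m) ℂ) : MvPowerSeries (Fin m) ℂ :=
  seriesOf fun α => coeff α (∑ i, E i * MvPowerSeries.X i) / α.degree

/-- The formal Poincaré lemma. In each degree a closed form has the primitive `∑ i, E i * X i`
divided by the degree; closedness moves the derivative from one index to the other. -/
theorem pderiv_potential {E : Fin m → MvPowerSeries (Fin m) ℂ}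
    (hE : ∀ i j, pderiv ℂ i (E j) = pderiv ℂ j (E i)) (k : Fin m) :
    pderiv ℂ k (potential E) = E k := by
  ext β
  rw [coeff_pderiv, potential, coeff_seriesOf, map_sum, map_add, Finsupp.degree_single]
  have h : ∀ i, coeff (β + Finsupp.single k 1) (E i * MvPowerSeries.X i) * (β k + 1)
      = coeff β (E k) * ((β + Finsupp.single k 1 : Fin m →₀ ℕ) i : ℕ) := by
    intro i
    rw [coeff_mul_X_eq]
    rcases eq_or_ne i k with rfl | hik
    · simp
    · have e1 : (β + Finsupp.single k 1 : Fin m →₀ ℕ) i = β i := by simp [hik]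
      rw [e1]
      split_ifs with h1
      · have h2 := sub_single_add_single h1
        set γ := β - Finsupp.single i 1 with hγ
        have h3 : β + Finsupp.single k 1 - Finsupp.single i 1 = γ + Finsupp.single k 1 := by
          conv_lhs => rw [← h2, add_right_comm, add_tsub_cancel_right]
        have h4 := congrArg (coeff γ) (hE k i)
        rw [coeff_pderiv, coeff_pderiv, h2] at h4
        have h5 : γ k = β k := by simp [hγ, hik]
        have h6 : (γ i : ℂ) + 1 = β i := by
          conv_rhs => rw [← h2]
          simp
        rw [h3, ← h5, h4, h6]
      · have : β i = 0 := by omega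
        simp [this]
  rw [div_mul_eq_mul_div, Finset.sum_mul]
  simp only [h]
  rw [← Finset.mul_sum, ← Nat.cast_sum, ← Finsupp.degree_eq_sum, map_add, Finsupp.degree_single]
  have : ((β.degree + 1 : ℕ) : ℂ) ≠ 0 := Nat.cast_ne_zero.2 (Nat.succ_ne_zero _)
  field_simp

end Disc

end QuantumTR

end

/-! ### The Vandermonde density, the action and the resolvents -/

noncomputable section

namespace QuantumTR

open MvPowerSeries

theorem derivation_prod {A κ : Type*} [CommRing A] [Algebra ℂ A] (D : Derivation ℂ A A)
    (t : Finset κ) {f u : κ → A} (h : ∀ i ∈ t, D (f i) = f i * u i) :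
    D (∏ i ∈ t, f i) = (∏ i ∈ t, f i) * ∑ i ∈ t, u i := by
  classical
  induction t using Finset.induction_on with
  | empty => simp
  | insert a t ha ih =>
    rw [Finset.prod_insert ha, Finset.sum_insert ha, Derivation.leibniz,
      ih fun i hi => h i (by simp [hi]), h a (by simp), smul_eq_mul, smul_eq_mul]
    ring

variable {m : ℕ} (s : Fin m → ℂ)

/-- The difference of two eigenvalues. -/
def eigDiff (i j : Fin m) : MvPowerSeries (Fin m) ℂ :=
  C (s i - s j) + (MvPowerSeries.X i - MvPowerSeries.X j)

/-- The inverse of the difference of two eigenvalues, and `0` on the diagonal. -/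
def eigDiffInv (i j : Fin m) : MvPowerSeries (Fin m) ℂ := (eigDiff s i j)⁻¹

theorem constantCoeff_eigDiff (i j : Fin m) : constantCoeff (eigDiff s i j) = s i - s j := by
  simp [eigDiff]

theorem constantCoeff_eigDiffInv (i j : Fin m) :
    constantCoeff (eigDiffInv s i j) = (s i - s j)⁻¹ := by
  rw [eigDiffInv, constantCoeff_inv, constantCoeff_eigDiff]

theorem eigDiffInv_self (i : Fin m) : eigDiffInv s i i = 0 := by simp [eigDiffInv, eigDiff]

variable {s} in
theorem eigDiff_mul_inv (hs : Function.Injective s) {i j : Fin m} (h : i ≠ j) :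
    eigDiff s i j * eigDiffInv s i j = 1 :=
  MvPowerSeries.mul_inv_cancel _ (by rw [constantCoeff_eigDiff, sub_ne_zero]; exact hs.ne h)

theorem eigDiff_swap (i j : Fin m) : eigDiff s j i = -eigDiff s i j := by
  simp only [eigDiff, map_sub]; ring

variable {s} in
theorem eigDiffInv_swap (hs : Function.Injective s) (i j : Fin m) :
    eigDiffInv s j i = -eigDiffInv s i j := by
  rcases eq_or_ne i j with rfl | h
  · simp [eigDiffInv_self]
  · have h1 := eigDiff_mul_inv hs h
    have h2 := eigDiff_mul_inv hs h.symm
    rw [eigDiff_swap] at h2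
    linear_combination (-eigDiffInv s j i) * h1 - eigDiffInv s i j * h2

theorem pderiv_eigDiff (k i j : Fin m) :
    pderiv ℂ k (eigDiff s i j) = (if i = k then 1 else 0) - if j = k then 1 else 0 := by
  simp [eigDiff, pderiv_X, Pi.single_apply]

theorem pderiv_eigDiffInv (k i j : Fin m) : pderiv ℂ k (eigDiffInv s i j)
    = -eigDiffInv s i j ^ 2 * ((if i = k then 1 else 0) - if j = k then 1 else 0) := by
  rw [eigDiffInv, pderiv_inv', pderiv_eigDiff]

/-- The logarithmic derivative of the squared Vandermonde determinant. -/
def repulsion (i : Fin m) : MvPowerSeries (Fin m) ℂ := ∑ j, (2 : ℂ) • eigDiffInv s i j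

/-- The square of the Vandermonde determinant, up to sign. -/
def vdmSq : MvPowerSeries (Fin m) ℂ := ∏ i, ∏ j ∈ Finset.univ.erase i, eigDiff s i j

-- The ordered pairs `(k, j)` and `(j, k)` contribute equally to the logarithmic derivative, whence
-- the factor `2` in `repulsion`.
variable {s} in
theorem pderiv_vdmSq (hs : Function.Injective s) (k : Fin m) :
    pderiv ℂ k (vdmSq s) = vdmSq s * repulsion s k := by
  have h1 : ∀ i, ∀ j ∈ Finset.univ.erase i, pderiv ℂ k (eigDiff s i j) = eigDiff s i j *
      (eigDiffInv s i j * ((if i = k then 1 else 0) - if j = k then 1 else 0)) := by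
    intro i j hj
    rw [← mul_assoc, eigDiff_mul_inv hs (by simpa using (Finset.ne_of_mem_erase hj).symm), one_mul,
      pderiv_eigDiff]
  rw [vdmSq, derivation_prod _ _ fun i _ => derivation_prod _ _ (h1 i)]
  congr 1
  have h2 : ∀ i, ∑ j ∈ Finset.univ.erase i,
      (eigDiffInv s i j * ((if i = k then 1 else 0) - if j = k then 1 else 0)) =
      ∑ j, (eigDiffInv s i j * ((if i = k then 1 else 0) - if j = k then 1 else 0)) := by
    intro i
    refine Finset.sum_erase _ ?_
    simp
  rw [Finset.sum_congr rfl fun i _ => h2 i]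
  simp only [mul_sub, mul_ite, mul_one, mul_zero, Finset.sum_sub_distrib]
  rw [Finset.sum_comm]
  simp only [Finset.sum_ite_eq', Finset.mem_univ, if_true]
  rw [repulsion, ← Finset.sum_sub_distrib]
  refine Finset.sum_congr rfl fun j _ => ?_
  rw [eigDiffInv_swap hs k j, two_smul]
  ring

variable {s} in
theorem constantCoeff_vdmSq_ne_zero (hs : Function.Injective s) :
    constantCoeff (vdmSq s) ≠ 0 := by
  simp only [vdmSq, map_prod, constantCoeff_eigDiff]
  refine Finset.prod_ne_zero_iff.2 fun i _ => Finset.prod_ne_zero_iff.2 fun j hj => ?_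
  rw [sub_ne_zero]
  exact hs.ne (Finset.ne_of_mem_erase hj).symm

theorem constantCoeff_repulsion (i : Fin m) :
    constantCoeff (repulsion s i) = ∑ j, 2 * (s i - s j)⁻¹ := by
  simp [repulsion, constantCoeff_eigDiffInv]

theorem pderiv_repulsion_self (i : Fin m) :
    pderiv ℂ i (repulsion s i) = ∑ j, (-2 : ℂ) • eigDiffInv s i j ^ 2 := by
  simp only [repulsion, map_sum, Derivation.map_smul, pderiv_eigDiffInv]
  refine Finset.sum_congr rfl fun j _ => ?_
  rcases eq_or_ne j i with rfl | h
  · simp [eigDiffInv_self]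
  · simp [h]

theorem pderiv_repulsion_of_ne {i k : Fin m} (h : i ≠ k) :
    pderiv ℂ k (repulsion s i) = (2 : ℂ) • eigDiffInv s i k ^ 2 := by
  simp only [repulsion, map_sum, Derivation.map_smul, pderiv_eigDiffInv, h, if_false, zero_sub,
    mul_neg, mul_ite, mul_one, mul_zero]
  simp

variable (hbar : ℂ) (v : Fin m → PowerSeries ℂ)

/-- The value of a power series at the `i`-th eigenvalue. -/
def atEig (i : Fin m) : PowerSeries ℂ →ₐ[ℂ] MvPowerSeries (Fin m) ℂ :=
  PowerSeries.substAlgHom (PowerSeries.HasSubst.X i)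

theorem atEig_X (i : Fin m) : atEig i PowerSeries.X = MvPowerSeries.X i :=
  PowerSeries.substAlgHom_X _

theorem coeff_atEig (i : Fin m) (f : PowerSeries ℂ) (e : Fin m →₀ ℕ) :
    coeff e (atEig i f) = if e = Finsupp.single i (e i) then PowerSeries.coeff (e i) f else 0 := by
  rw [atEig, PowerSeries.coe_substAlgHom, PowerSeries.coeff_subst_single]

theorem constantCoeff_atEig (i : Fin m) (f : PowerSeries ℂ) :
    constantCoeff (atEig i f) = PowerSeries.constantCoeff f := by
  rw [← coeff_zero_eq_constantCoeff_apply, coeff_atEig]; simp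

theorem pderiv_atEig_of_ne {i k : Fin m} (h : i ≠ k) (f : PowerSeries ℂ) :
    pderiv ℂ k (atEig i f) = 0 := by
  ext n
  rw [coeff_pderiv, coeff_atEig, if_neg, zero_mul, coeff_zero]
  intro h1
  have h2 := DFunLike.congr_fun h1 k
  simp [h] at h2

theorem constantCoeff_pderiv_atEig (i : Fin m) (f : PowerSeries ℂ) :
    constantCoeff (pderiv ℂ i (atEig i f)) = PowerSeries.coeff 1 f := by
  rw [← coeff_zero_eq_constantCoeff_apply, coeff_pderiv, coeff_atEig]; simp

/-- The gradient of the action whose critical point is the configuration `s`. -/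
def actionGrad (i : Fin m) : MvPowerSeries (Fin m) ℂ := atEig i (v i) - hbar • repulsion s i

theorem constantCoeff_actionGrad (i : Fin m) : constantCoeff (actionGrad s hbar v i) =
    PowerSeries.constantCoeff (v i) - hbar * ∑ j, 2 * (s i - s j)⁻¹ := by
  simp [actionGrad, constantCoeff_atEig, constantCoeff_repulsion]

theorem hessian_self (i : Fin m) : constantCoeff (pderiv ℂ i (actionGrad s hbar v i)) =
    PowerSeries.coeff 1 (v i) + 2 * hbar * ∑ j, (s i - s j)⁻¹ ^ 2 := by
  simp only [actionGrad, map_sub, Derivation.map_smul, constantCoeff_pderiv_atEig,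
    pderiv_repulsion_self]
  rw [smul_eq_C_mul, map_mul, constantCoeff_C, map_sum]
  simp only [smul_eq_C_mul, map_mul, map_pow, constantCoeff_C, constantCoeff_eigDiffInv]
  rw [← Finset.mul_sum]
  ring

theorem hessian_of_ne {i k : Fin m} (h : i ≠ k) :
    constantCoeff (pderiv ℂ k (actionGrad s hbar v i)) = -(2 * hbar * (s i - s k)⁻¹ ^ 2) := by
  simp only [actionGrad, map_sub, Derivation.map_smul, pderiv_atEig_of_ne h,
    pderiv_repulsion_of_ne s h]
  simp only [smul_eq_C_mul, map_mul, map_pow, constantCoeff_C, constantCoeff_eigDiffInv, map_zero]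
  ring

variable {s} in
theorem pderiv_actionGrad_comm (hs : Function.Injective s) (i j : Fin m) :
    pderiv ℂ i (actionGrad s hbar v j) = pderiv ℂ j (actionGrad s hbar v i) := by
  rcases eq_or_ne i j with rfl | h
  · rfl
  · simp only [actionGrad, map_sub, Derivation.map_smul, pderiv_atEig_of_ne h,
      pderiv_atEig_of_ne h.symm, pderiv_repulsion_of_ne s h, pderiv_repulsion_of_ne s h.symm,
      eigDiffInv_swap hs i j, neg_sq]

/-- `1 / (x - λᵢ)`. -/
def resolvent (x : ℂ) (i : Fin m) : MvPowerSeries (Fin m) ℂ := (C (x - s i) - MvPowerSeries.X i)⁻¹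

/-- `∑ᵢ 1 / (x - λᵢ)`. -/
def traceResolvent (x : ℂ) : MvPowerSeries (Fin m) ℂ := ∑ i, resolvent s x i

variable {s}

theorem sub_ne_zero_of_notMem {x : ℂ} (hx : x ∉ Set.range s) (i : Fin m) : x - s i ≠ 0 := by
  rw [sub_ne_zero]; rintro rfl; exact hx ⟨i, rfl⟩

theorem mul_resolvent {x : ℂ} {i : Fin m} (hx : x - s i ≠ 0) :
    (C (x - s i) - MvPowerSeries.X i) * resolvent s x i = 1 :=
  MvPowerSeries.mul_inv_cancel _ (by simpa using hx)

theorem pderiv_resolvent_self (x : ℂ) (i : Fin m) :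
    pderiv ℂ i (resolvent s x i) = resolvent s x i ^ 2 := by
  simp [resolvent, pderiv_inv']

theorem pderiv_resolvent_of_ne (x : ℂ) {i k : Fin m} (h : i ≠ k) :
    pderiv ℂ k (resolvent s x i) = 0 := by
  simp [resolvent, pderiv_inv', pderiv_X_of_ne h]

theorem pderiv_traceResolvent (x : ℂ) (i : Fin m) :
    pderiv ℂ i (traceResolvent s x) = resolvent s x i ^ 2 := by
  rw [traceResolvent, map_sum, Finset.sum_eq_single i]
  · exact pderiv_resolvent_self x i
  · exact fun j _ h => pderiv_resolvent_of_ne x h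
  · simp

theorem resolvent_mul_resolvent (hs : Function.Injective s) {x : ℂ} (hx : x ∉ Set.range s)
    {i j : Fin m} (h : i ≠ j) : resolvent s x i * resolvent s x j
      = (resolvent s x i - resolvent s x j) * eigDiffInv s i j := by
  have h1 := mul_resolvent (sub_ne_zero_of_notMem hx i)
  have h2 := mul_resolvent (sub_ne_zero_of_notMem hx j)
  have h3 := eigDiff_mul_inv hs h
  have h4 : eigDiff s i j = (C (x - s j) - MvPowerSeries.X j) - (C (x - s i) - MvPowerSeries.X i) := by
    simp only [eigDiff, map_sub]; ring
  rw [h4] at h3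
  set a := C (x - s j) - MvPowerSeries.X j
  set b := C (x - s i) - MvPowerSeries.X i
  linear_combination (-resolvent s x i * resolvent s x j) * h3 + (eigDiffInv s i j * resolvent s x i) * h2
    - eigDiffInv s i j * resolvent s x j * h1

/-- Symmetrising the double sum turns the repulsion into products of two resolvents. The diagonal is
absent, which is why the sum of squares is subtracted. -/
theorem sum_resolvent_mul_repulsion (hs : Function.Injective s) {x : ℂ} (hx : x ∉ Set.range s) :
    ∑ i, resolvent s x i * repulsion s i
      = traceResolvent s x ^ 2 - ∑ i, resolvent s x i ^ 2 := by
  have h1 : ∑ i, resolvent s x i * repulsion s i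
      = ∑ i, ∑ j, (resolvent s x i - resolvent s x j) * eigDiffInv s i j := by
    have e1 : ∀ i, resolvent s x i * repulsion s i
        = ∑ j, resolvent s x i * eigDiffInv s i j + ∑ j, resolvent s x i * eigDiffInv s i j := by
      intro i
      rw [repulsion, Finset.mul_sum, ← Finset.sum_add_distrib]
      exact Finset.sum_congr rfl fun j _ => by rw [two_smul]; ring
    simp only [e1, Finset.sum_add_distrib, sub_mul, Finset.sum_sub_distrib]
    rw [sub_eq_add_neg]
    congr 1
    rw [Finset.sum_comm, ← Finset.sum_neg_distrib]
    refine Finset.sum_congr rfl fun i _ => ?_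
    rw [← Finset.sum_neg_distrib]
    exact Finset.sum_congr rfl fun j _ => by rw [eigDiffInv_swap hs i j]; ring
  rw [h1, traceResolvent, pow_two, Finset.sum_mul_sum, ← Finset.sum_sub_distrib]
  refine Finset.sum_congr rfl fun i _ => ?_
  rw [← Finset.sum_erase_add _ _ (Finset.mem_univ i), ← Finset.sum_erase_add _ _ (Finset.mem_univ i),
    sub_self, zero_mul, add_zero, pow_two, add_sub_cancel_right]
  exact Finset.sum_congr rfl fun j hj =>
    (resolvent_mul_resolvent hs hx (Finset.ne_of_mem_erase hj).symm).symm

/-- Partial fractions in the eigenvalue: only the last term depends on the resolvent at `x`, so only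
it is singular as `x` tends to a point `sᵢ`. -/
theorem resolvent_mul_resolvent_sq {x y : ℂ} (hxy : x - y ≠ 0) {i : Fin m} (hx : x - s i ≠ 0)
    (hy : y - s i ≠ 0) : resolvent s x i * resolvent s y i ^ 2 =
      (x - y)⁻¹ • resolvent s y i ^ 2 - ((x - y)⁻¹ ^ 2) • resolvent s y i
        + ((x - y)⁻¹ ^ 2) • resolvent s x i := by
  have h1 := mul_resolvent hx
  have h2 := mul_resolvent hy
  have h3 : (C (x - y) : MvPowerSeries (Fin m) ℂ) * C ((x - y)⁻¹) = 1 := by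
    rw [← map_mul, mul_inv_cancel₀ hxy, map_one]
  have h4 : C (x - s i) - MvPowerSeries.X i = C (y - s i) - MvPowerSeries.X i + C (x - y) := by
    simp only [map_sub]; ring
  rw [h4] at h1
  simp only [smul_eq_C_mul, map_pow]
  set a := C (y - s i) - MvPowerSeries.X i
  set d : MvPowerSeries (Fin m) ℂ := C (x - y)
  set e : MvPowerSeries (Fin m) ℂ := C ((x - y)⁻¹)
  set p := resolvent s x i
  set q := resolvent s y i
  have key : p * q = e * (q - p) := by
    linear_combination (-p * q) * h3 + e * q * h1 - e * p * h2
  linear_combination (q - e) * key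

end QuantumTR

end

/-! ### The genus parameter, and functionals of the resolvent as functions of `x` -/

noncomputable section

namespace QuantumTR

/-- `T` is the compositional inverse of `X (X + ħ)`, whose linear coefficient `ħ` is nonzero. It
makes `κ - T = ħ` and `κ T = X` in the loop equation. -/
theorem exists_quadratic_root {hbar : ℂ} (h : hbar ≠ 0) :
    ∃ T : PowerSeries ℂ, PowerSeries.constantCoeff T = 0 ∧
      T * (T + PowerSeries.C hbar) = PowerSeries.X := by
  let P : PowerSeries ℂ := PowerSeries.X * (PowerSeries.X + PowerSeries.C hbar)
  have h1 : PowerSeries.coeff 1 P = hbar := by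
    rw [show (1 : ℕ) = 0 + 1 from rfl, PowerSeries.coeff_succ_X_mul]; simp
  have h0 : PowerSeries.constantCoeff P = 0 := by simp [P]
  let _ : Invertible (PowerSeries.coeff 1 P) := invertibleOfNonzero (by rwa [h1])
  have hs : PowerSeries.HasSubst P.substInv := PowerSeries.HasSubst.substInv P
  refine ⟨P.substInv, P.constantCoeff_substInv, ?_⟩
  have := PowerSeries.subst_substInv_right P h0
  rw [← PowerSeries.coe_substAlgHom hs, map_mul, map_add, PowerSeries.substAlgHom_X] at this
  rw [← this]
  congr 2
  rw [PowerSeries.coe_substAlgHom hs, PowerSeries.subst_C]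
  rfl

open MvPowerSeries

variable {m : ℕ} (s : Fin m → ℂ)

/-- `φ` depends on finitely many coefficients only. -/
def FiniteOrder (φ : MvPowerSeries (Fin m) ℂ →ₗ[ℂ] ℂ) : Prop :=
  ∃ N, ∀ a, (formalDisc m).Vanishes N a → φ a = 0

theorem vanishes_X_pow_mul (i : Fin m) (N : ℕ) (a : MvPowerSeries (Fin m) ℂ) :
    (formalDisc m).Vanishes N (MvPowerSeries.X i ^ N * a) := by
  have := (FormalDisc.vanishes_X (S := formalDisc m) i).pow N
  rw [one_mul] at this
  exact this.mul_right a

/-- The quotient by `a ^ (d + 1)` of the remainder of a Taylor expansion of order `d`. -/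
def taylorQuot (u : ℕ → ℂ) (y a : ℂ) (d : ℕ) : ℂ :=
  (a ^ (d + 1))⁻¹ * (y - ∑ j ∈ Finset.range (d + 1), u j * a ^ j)

/-- Truncated long division of `y - u(X)` by `a - X`: the coefficients of the quotient are the
divided Taylor remainders of `u` at `a`. -/
theorem telescope_taylorQuot {A : Type*} [CommRing A] [Algebra ℂ A] (u : ℕ → ℂ) (y : ℂ) {a : ℂ}
    (ha : a ≠ 0) (X : A) (N : ℕ) :
    (algebraMap ℂ A a - X) * ∑ d ∈ Finset.range N, algebraMap ℂ A (taylorQuot u y a d) * X ^ d =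
      algebraMap ℂ A y - ∑ d ∈ Finset.range N, algebraMap ℂ A (u d) * X ^ d
        - algebraMap ℂ A (a ^ N)⁻¹ * X ^ N
          * algebraMap ℂ A (y - ∑ j ∈ Finset.range N, u j * a ^ j) := by
  induction N with
  | zero => simp
  | succ N ih =>
    have h1 : a * taylorQuot u y a N
        = (a ^ N)⁻¹ * (y - ∑ j ∈ Finset.range N, u j * a ^ j) - u N := by
      rw [taylorQuot, Finset.sum_range_succ]
      field_simp
      ring
    have h2 := congrArg (algebraMap ℂ A) h1
    simp only [map_sub, map_mul] at h2 ih
    rw [Finset.sum_range_succ, mul_add, ih, Finset.sum_range_succ _ N]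
    have h3 : (a ^ (N + 1))⁻¹ * (y - ∑ j ∈ Finset.range (N + 1), u j * a ^ j)
      = taylorQuot u y a N := rfl
    have h4 := congrArg (algebraMap ℂ A) h3
    simp only [map_sub, map_mul] at h4
    simp only [map_sub]
    linear_combination X ^ N * h2 + X ^ (N + 1) * h4

variable {s}

theorem apply_taylorQuot {φ : MvPowerSeries (Fin m) ℂ →ₗ[ℂ] ℂ} {N : ℕ}
    (hN : ∀ a, (formalDisc m).Vanishes N a → φ a = 0) (v : PowerSeries ℂ) (i : Fin m) (y : ℂ)
    {x : ℂ} (hx : x - s i ≠ 0) :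
      φ ((C y - atEig i v) * resolvent s x i) = ∑ d ∈ Finset.range N,
        taylorQuot (fun j => PowerSeries.coeff j v) y (x - s i) d * φ (MvPowerSeries.X i ^ d) := by
  have hv : atEig i v = MvPowerSeries.X i ^ N
        * atEig i (PowerSeries.mk fun j => PowerSeries.coeff (j + N) v)
      + ∑ d ∈ Finset.range N, algebraMap ℂ _ (PowerSeries.coeff d v) * MvPowerSeries.X i ^ d := by
    conv_lhs => rw [PowerSeries.eq_X_pow_mul_shift_add_trunc N v]
    rw [map_add, map_mul, map_pow, atEig_X]
    congr 1
    have : ((v.trunc N : Polynomial ℂ) : PowerSeries ℂ) = ∑ d ∈ Finset.range N,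
        PowerSeries.coeff d v • (PowerSeries.X : PowerSeries ℂ) ^ d := by
      ext j
      simp [PowerSeries.coeff_trunc, PowerSeries.coeff_X_pow]
    rw [this, map_sum]
    refine Finset.sum_congr rfl fun d _ => ?_
    rw [map_smul, map_pow, atEig_X, Algebra.smul_def]
  have h1 := mul_resolvent hx
  have h2 := telescope_taylorQuot (fun j => PowerSeries.coeff j v) y hx
    (MvPowerSeries.X i : MvPowerSeries (Fin m) ℂ) N
  have hC : ∀ c : ℂ, algebraMap ℂ (MvPowerSeries (Fin m) ℂ) c = C c := fun c => rfl
  rw [hC (x - s i), hC y] at h2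
  set Y := ∑ d ∈ Finset.range N, algebraMap ℂ (MvPowerSeries (Fin m) ℂ)
    (taylorQuot (fun j => PowerSeries.coeff j v) y (x - s i) d) * MvPowerSeries.X i ^ d with hY
  -- The division is exact modulo `X i ^ N`, and `φ` does not see multiples of `X i ^ N`.
  have key : ∃ r, (C y - atEig i v) * resolvent s x i = Y + MvPowerSeries.X i ^ N * r := by
    rw [hv]
    refine ⟨(algebraMap ℂ _ ((x - s i) ^ N)⁻¹ * algebraMap ℂ _
      (y - ∑ j ∈ Finset.range N, PowerSeries.coeff j v * (x - s i) ^ j)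
      - atEig i (PowerSeries.mk fun j => PowerSeries.coeff (j + N) v)) * resolvent s x i, ?_⟩
    linear_combination Y * h1 - resolvent s x i * h2
  obtain ⟨r, hr⟩ := key
  rw [hr, map_add, hN _ (vanishes_X_pow_mul i N r), add_zero, hY, map_sum]
  refine Finset.sum_congr rfl fun d _ => ?_
  rw [← Algebra.smul_def, map_smul, smul_eq_mul]

theorem apply_resolvent {φ : MvPowerSeries (Fin m) ℂ →ₗ[ℂ] ℂ} {N : ℕ}
    (hN : ∀ a, (formalDisc m).Vanishes N a → φ a = 0) (s : Fin m → ℂ) (i : Fin m) (x : ℂ) :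
    φ (resolvent s x i) =
      ∑ d ∈ Finset.range N, ((x - s i) ^ (d + 1))⁻¹ * φ (MvPowerSeries.X i ^ d) := by
  -- At `x = s i` both sides are `0`: a power series without constant term has inverse `0`, and `0⁻¹
  -- = 0` in `ℂ`. Thus the formula holds for every `x`.
  rcases eq_or_ne (x - s i) 0 with h | h
  · have : resolvent s x i = 0 := by rw [resolvent, MvPowerSeries.inv_eq_zero]; simp [h]
    rw [this, h]
    simp
  · have := apply_taylorQuot hN 0 i 1 h
    simpa [taylorQuot] using this

variable (s) in
/-- The functions `x ↦ (x - sᵢ)⁻ᵏ⁻¹` span the rational functions with poles at the `sᵢ` that vanish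
at infinity. -/
def polarSpace : Submodule ℂ (ℂ → ℂ) :=
  Submodule.span ℂ (Set.range fun p : Fin m × ℕ => fun x => ((x - s p.1) ^ (p.2 + 1))⁻¹)

theorem FiniteOrder.mem_polarSpace {φ : MvPowerSeries (Fin m) ℂ →ₗ[ℂ] ℂ} (hφ : FiniteOrder φ) :
    (fun x => φ (traceResolvent s x)) ∈ polarSpace s := by
  obtain ⟨N, hN⟩ := hφ
  have : (fun x => φ (traceResolvent s x)) = ∑ i, ∑ d ∈ Finset.range N,
      φ (MvPowerSeries.X i ^ d) • fun x : ℂ => ((x - s i) ^ (d + 1))⁻¹ := by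
    funext x
    simp only [traceResolvent, map_sum, apply_resolvent hN, Finset.sum_apply, Pi.smul_apply, smul_eq_mul]
    exact Finset.sum_congr rfl fun i _ => Finset.sum_congr rfl fun d _ => mul_comm _ _
  rw [this]
  exact Submodule.sum_mem _ fun i _ => Submodule.sum_mem _ fun d _ =>
    Submodule.smul_mem _ _ (Submodule.subset_span ⟨(i, d), rfl⟩)

theorem hasDerivAt_inv_sub_pow {x c : ℂ} (h : x - c ≠ 0) (d : ℕ) :
    HasDerivAt (fun x => ((x - c) ^ (d + 1))⁻¹) (-((d + 1 : ℕ) * ((x - c) ^ (d + 2))⁻¹)) x := by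
  have h1 : HasDerivAt (fun x => ((x - c) ^ (d + 1))⁻¹)
      (-((d + 1 : ℕ) * (x - c) ^ d * 1) / ((x - c) ^ (d + 1)) ^ 2) x := by
    simpa using! (((hasDerivAt_id x).sub_const c).fun_pow (d + 1)).fun_inv (pow_ne_zero (d + 1) h)
  have h2 : -((d + 1 : ℕ) * (x - c) ^ d * 1) / ((x - c) ^ (d + 1)) ^ 2
      = -((d + 1 : ℕ) * ((x - c) ^ (d + 2))⁻¹) := by
    field_simp
    ring
  rwa [h2] at h1

theorem FiniteOrder.hasDerivAt {φ : MvPowerSeries (Fin m) ℂ →ₗ[ℂ] ℂ} (hφ : FiniteOrder φ) {x : ℂ}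
    (hx : x ∉ Set.range s) : HasDerivAt (fun x => φ (traceResolvent s x))
      (-φ (∑ i, resolvent s x i ^ 2)) x := by
  obtain ⟨N, hN⟩ := hφ
  have h2 : ∀ i, φ (resolvent s x i ^ 2) = ∑ d ∈ Finset.range N,
      ((d + 1 : ℕ) * ((x - s i) ^ (d + 2))⁻¹) * φ (MvPowerSeries.X i ^ d) := by
    intro i
    -- The square of a resolvent is its derivative in the eigenvalue, and `φ ∘ ∂ᵢ` again has finite
    -- order, one higher.
    have h3 := apply_resolvent (φ := φ ∘ₗ (pderiv ℂ i : MvPowerSeries (Fin m) ℂ →ₗ[ℂ] _))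
      (N := N + 1) (fun a ha => hN _ (ha.2 i)) s i x
    simp only [LinearMap.comp_apply, Derivation.coeFn_coe, pderiv_resolvent_self] at h3
    rw [h3, Finset.sum_range_succ']
    simp only [pow_zero, Derivation.map_one_eq_zero, map_zero, mul_zero, add_zero]
    refine Finset.sum_congr rfl fun d _ => ?_
    rw [pderiv_pow, pderiv_X_self, mul_one, add_tsub_cancel_right, ← nsmul_eq_mul, map_nsmul,
      nsmul_eq_mul]
    ring
  have h4 : (fun x => φ (traceResolvent s x)) = fun x => ∑ i, ∑ d ∈ Finset.range N,
      ((x - s i) ^ (d + 1))⁻¹ * φ (MvPowerSeries.X i ^ d) := by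
    funext x
    simp only [traceResolvent, map_sum, apply_resolvent hN]
  rw [h4, map_sum, ← Finset.sum_neg_distrib]
  refine HasDerivAt.fun_sum fun i _ => ?_
  rw [h2, ← Finset.sum_neg_distrib]
  refine HasDerivAt.fun_sum fun d _ => ?_
  rw [← neg_mul]
  exact (hasDerivAt_inv_sub_pow (sub_ne_zero_of_notMem hx i) d).mul_const _

/-- `v` is the Taylor series of `f` at `c`. -/
def IsTaylorAt (f : ℂ → ℂ) (c : ℂ) (v : PowerSeries ℂ) : Prop :=
  ∀ N, ∃ h : ℂ → ℂ, AnalyticAt ℂ h c ∧ ∀ x,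
    f x = ∑ j ∈ Finset.range N, PowerSeries.coeff j v * (x - c) ^ j + (x - c) ^ N * h x

/-- The remainders are the iterated `dslope`s, which give the expansion at every point and stay
analytic at `c`. -/
theorem AnalyticAt.exists_isTaylorAt {f : ℂ → ℂ} {c : ℂ} (hf : AnalyticAt ℂ f c) :
    ∃ v, IsTaylorAt f c v := by
  let F : ℕ → ℂ → ℂ := fun n => (Function.swap dslope c)^[n] f
  have hF : ∀ n, F (n + 1) = dslope (F n) c := fun n => Function.iterate_succ_apply' _ _ _
  have hA : ∀ n, AnalyticAt ℂ (F n) c := by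
    intro n
    obtain ⟨p, hp⟩ := hf
    exact ⟨_, hp.has_fpower_series_iterate_dslope_fslope n⟩
  refine ⟨PowerSeries.mk fun n => F n c, fun N => ⟨F N, hA N, fun x => ?_⟩⟩
  induction N with
  | zero => simp [F]
  | succ N ih =>
    have h1 := sub_smul_dslope (F N) c x
    rw [smul_eq_mul, ← hF] at h1
    rw [ih, Finset.sum_range_succ, PowerSeries.coeff_mk]
    linear_combination (-(x - c) ^ N) * h1

/-- The divided difference `(f x - f λᵢ) / (x - λᵢ)` has no pole at `x = λᵢ`. After expansion in `X
i` its coefficients are divided Taylor remainders: at `sᵢ` they are the analytic remainder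
functions, at the other points the denominators do not vanish. -/
theorem FiniteOrder.exists_analyticAt {φ : MvPowerSeries (Fin m) ℂ →ₗ[ℂ] ℂ} (hφ : FiniteOrder φ)
    (hs : Function.Injective s) {f : ℂ → ℂ} {v : Fin m → PowerSeries ℂ}
    (hv : ∀ i, IsTaylorAt f (s i) (v i)) (l : Fin m) :
    ∃ h, AnalyticAt ℂ h (s l) ∧ ∀ᶠ x in 𝓝[≠] (s l),
      φ (∑ i, (C (f x) - atEig i (v i)) * resolvent s x i) = h x := by
  obtain ⟨N, hN⟩ := hφ
  have h1 : ∀ i, ∀ d, ∃ h, AnalyticAt ℂ h (s l) ∧ ∀ᶠ x in 𝓝[≠] (s l),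
      taylorQuot (fun j => PowerSeries.coeff j (v i)) (f x) (x - s i) d = h x := by
    intro i d
    rcases eq_or_ne i l with rfl | hil
    · obtain ⟨h, ha, he⟩ := hv i (d + 1)
      refine ⟨h, ha, ?_⟩
      filter_upwards [self_mem_nhdsWithin] with x hx
      have hx' : x - s i ≠ 0 := sub_ne_zero.2 hx
      rw [taylorQuot, he x, add_sub_cancel_left, inv_mul_cancel_left₀ (pow_ne_zero _ hx')]
    · have hne : s l - s i ≠ 0 := sub_ne_zero.2 (hs.ne hil.symm)
      obtain ⟨g, hg, he⟩ := hv l 0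
      have hf : AnalyticAt ℂ f (s l) := by
        have : f = g := by funext x; simpa using he x
        rwa [this]
      refine ⟨_, ?_, Eventually.of_forall fun x => rfl⟩
      have h2 : AnalyticAt ℂ (fun x : ℂ => x - s i) (s l) := analyticAt_id.sub analyticAt_const
      refine ((h2.pow (d + 1)).inv (pow_ne_zero _ hne)).mul (hf.sub ?_)
      exact Finset.analyticAt_fun_sum _ fun j _ => analyticAt_const.mul (h2.pow j)
  choose h hA he using h1
  refine ⟨fun x => ∑ i, ∑ d ∈ Finset.range N, h i d x * φ (MvPowerSeries.X i ^ d),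
    Finset.analyticAt_fun_sum _ fun i _ => Finset.analyticAt_fun_sum _ fun d _ =>
      (hA i d).mul analyticAt_const, ?_⟩
  have h3 : ∀ᶠ x in 𝓝[≠] (s l), ∀ i, x - s i ≠ 0 := by
    rw [eventually_all]
    intro i
    rcases eq_or_ne i l with rfl | hil
    · filter_upwards [self_mem_nhdsWithin] with x hx using sub_ne_zero.2 hx
    · exact (((continuous_id.sub continuous_const).continuousAt.eventually_ne
        (sub_ne_zero.2 (hs.ne hil.symm))).filter_mono nhdsWithin_le_nhds)
  have h4 : ∀ᶠ x in 𝓝[≠] (s l), ∀ i, ∀ d ∈ Finset.range N,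
      taylorQuot (fun j => PowerSeries.coeff j (v i)) (f x) (x - s i) d = h i d x :=
    eventually_all.2 fun i => (Filter.eventually_all_finset _).2 fun d _ => he i d
  filter_upwards [h3, h4] with x hx hx4
  rw [map_sum]
  refine Finset.sum_congr rfl fun i _ => ?_
  rw [apply_taylorQuot hN _ _ _ (hx i)]
  exact Finset.sum_congr rfl fun d hd => by rw [hx4 i d hd]

end QuantumTR

end

/-! ### The loop equations and their solution -/

noncomputable section

namespace QuantumTR

open MvPowerSeries MultisetFun

variable {m : ℕ} {s : Fin m → ℂ}

section LoopEquation

variable {L : MvPowerSeries (Fin m) ℂ →ₗ[ℂ] PowerSeries ℂ} (hL : L 1 = 1)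
  {hbar : ℂ} {v : Fin m → PowerSeries ℂ} {T : PowerSeries ℂ}

theorem smul_eq_const_mul_apply (c : ℂ) (f : MultisetFun ℂ (PowerSeries ℂ)) (t : Multiset ℂ) :
    c • f t = (const (PowerSeries.C c) * f : MultisetFun ℂ (PowerSeries ℂ)) t := by
  rw [const_mul_apply, PowerSeries.smul_eq_C_mul]

theorem cumulant_smul (κ : PowerSeries ℂ) (om : ℂ → MvPowerSeries (Fin m) ℂ) (c : ℂ)
    (a : MvPowerSeries (Fin m) ℂ) :
    cumulant L κ om hL (c • a) = const (PowerSeries.C c) * cumulant L κ om hL a :=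
  ext_apply fun t => by rw [cumulant_smul_apply, smul_eq_const_mul_apply]

theorem const_mul_const {R X : Type*} [CommRing R] (a b : R) :
    (const a * const b : MultisetFun X R) = const (a * b) :=
  ext_apply fun t => by
    rw [const_mul_apply]
    induction t using Multiset.induction_on with
    | empty => rfl
    | cons x t _ => rw [apply_cons, apply_cons, ins_const, ins_const]; exact mul_zero a

theorem const_add {R X : Type*} [CommRing R] (a b : R) :
    (const (a + b) : MultisetFun X R) = const a + const b := by
  refine ext_ins rfl fun x => ?_
  rw [map_add, ins_const, ins_const, ins_const, add_zero]

/-- The loop equation for the connected correlators. -/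
theorem loop_equation (hs : Function.Injective s)
    (hSD : ∀ i a, L (a * actionGrad s hbar v i)
      = T * L ((formalDisc m).D i a + a * repulsion s i))
    {κ τ : PowerSeries ℂ} (hκ : κ = T + PowerSeries.C hbar) (hτ : T * κ = τ)
    {x : ℂ} (hx : x ∉ Set.range s) (y : ℂ) :
    ins x (corrFun κ (traceResolvent s) hL x)
      + corrFun κ (traceResolvent s) hL x * corrFun κ (traceResolvent s) hL x
      - const (PowerSeries.C hbar)
          * (const κ * cumulant L κ (traceResolvent s) hL (∑ i, resolvent s x i ^ 2))
      - const (PowerSeries.C y) * corrFun κ (traceResolvent s) hL x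
      + const κ * cumulant L κ (traceResolvent s) hL
          (∑ i, (C y - atEig i (v i)) * resolvent s x i)
      + const τ * (const κ * source fun z => cumulant L κ (traceResolvent s) hL
          (∑ i, resolvent s x i * resolvent s z i ^ 2)) = 0 := by
  set P := cumulant L κ (traceResolvent s) hL with hP
  -- Integration by parts along the vector field with components `1 / (x - λᵢ)`.
  have h1 : ∀ i, P (resolvent s x i * actionGrad s hbar v i) =
      const T * (P (resolvent s x i ^ 2 + resolvent s x i * repulsion s i)
        + const κ * source fun z => P (resolvent s x i * resolvent s z i ^ 2)) := by
    intro i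
    have := cumulant_mul_grad κ (traceResolvent s) hL hSD i (resolvent s x i)
    have e1 : ∀ a, (formalDisc m).D i a = pderiv ℂ i a := fun _ => rfl
    simpa only [e1, pderiv_traceResolvent, pderiv_resolvent_self] using this
  have h2 : P (∑ i, resolvent s x i * actionGrad s hbar v i) =
      const T * (P (∑ i, resolvent s x i ^ 2 + ∑ i, resolvent s x i * repulsion s i)
        + const κ * source fun z => P (∑ i, resolvent s x i * resolvent s z i ^ 2)) := by
    have e2 : (fun z => P (∑ i, resolvent s x i * resolvent s z i ^ 2))
        = ∑ i, fun z => P (resolvent s x i * resolvent s z i ^ 2) := by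
      funext z; rw [Finset.sum_apply, map_sum]
    rw [map_sum, Finset.sum_congr rfl fun i _ => h1 i, e2, map_sum, ← Finset.sum_add_distrib,
      map_sum, Finset.mul_sum, ← Finset.sum_add_distrib, ← Finset.mul_sum]
  have h3 : ∑ i, resolvent s x i * actionGrad s hbar v i =
      y • traceResolvent s x - ∑ i, (C y - atEig i (v i)) * resolvent s x i
        - hbar • (traceResolvent s x ^ 2 - ∑ i, resolvent s x i ^ 2) := by
    rw [← sum_resolvent_mul_repulsion hs hx, traceResolvent]
    simp only [Finset.smul_sum, smul_eq_C_mul]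
    rw [← Finset.sum_sub_distrib, ← Finset.sum_sub_distrib]
    refine Finset.sum_congr rfl fun i _ => ?_
    rw [actionGrad, smul_eq_C_mul]
    ring
  rw [h3, sum_resolvent_mul_repulsion hs hx, add_sub_cancel] at h2
  rw [map_sub, map_sub, cumulant_smul, cumulant_smul, ← hP, map_sub] at h2
  have h4 := ins_corrFun κ (traceResolvent s) hL x x
  rw [← pow_two (traceResolvent s x)] at h4
  have h5 : (const κ : MultisetFun ℂ (PowerSeries ℂ)) = const T + const (PowerSeries.C hbar) := by
    rw [hκ, const_add]
  rw [h4, ← hτ, ← const_mul_const]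
  simp only [corrFun, ← hP]
  rw [h5] at h2 ⊢
  -- Multiplication by `κ` turns `(T + ħ) ⟨tr²⟩` into `κ² ⟨tr²⟩`, which is the inserted correlator
  -- plus the square of the one-point function.
  linear_combination (-(const T + const (PowerSeries.C hbar))) * h2

end LoopEquation

/-- A family of functions `w x t` of a point `x` and a multiset `t` of points, with values in the
power series in the genus expansion parameter, that is symmetric and solves the loop equations with
poles at the points `s i` and with the potential whose derivative is `f`. -/
structure IsLoopSolution (hbar : ℂ) (s : Fin m → ℂ) (f : ℂ → ℂ)
    (w : ℂ → Multiset ℂ → PowerSeries ℂ) : Prop where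
  dvd : ∀ x t, PowerSeries.X ^ t.card ∣ w x t
  symm : ∀ x y t, w x (y ::ₘ t) = w y (x ::ₘ t)
  mem_polarSpace : ∀ t k, (fun x => PowerSeries.coeff k (w x t)) ∈ polarSpace s
  zero : ∀ x, PowerSeries.coeff 0 (w x 0) = hbar * ∑ i, 1 / (x - s i)
  loop : ∀ t : Multiset ℂ, (∀ y ∈ t, y ∉ Set.range s) → ∀ k l, ∃ h, AnalyticAt ℂ h (s l) ∧
    ∀ᶠ x in 𝓝[≠] (s l),
      PowerSeries.coeff k (w x (x ::ₘ t) + (t.antidiagonal.map fun p => w x p.1 * w x p.2).sum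
        + PowerSeries.X * (t.map fun y => ((x - y)⁻¹ ^ 2) • w x (t.erase y)).sum)
      + hbar * deriv (fun x => PowerSeries.coeff k (w x t)) x
      - f x * PowerSeries.coeff k (w x t) = h x

theorem eventually_notMem_range (hs : Function.Injective s) (l : Fin m) :
    ∀ᶠ x in 𝓝[≠] (s l), x ∉ Set.range s := by
  have h3 : ∀ᶠ x in 𝓝[≠] (s l), ∀ i, x ≠ s i := by
    rw [eventually_all]
    intro i
    rcases eq_or_ne i l with rfl | hil
    · exact self_mem_nhdsWithin
    · exact (continuousAt_id.eventually_ne (hs.ne hil.symm)).filter_mono nhdsWithin_le_nhds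
  filter_upwards [h3] with x hx
  rintro ⟨i, rfl⟩
  exact hx i rfl

theorem analyticAt_multiset_sum {t : Multiset ℂ} {g : ℂ → ℂ → ℂ} {c : ℂ}
    (h : ∀ y ∈ t, AnalyticAt ℂ (g y) c) : AnalyticAt ℂ (fun x => (t.map fun y => g y x).sum) c := by
  induction t using Multiset.induction_on with
  | empty => simpa using analyticAt_const
  | cons a t ih =>
    simp only [Multiset.map_cons, Multiset.sum_cons]
    exact (h a (by simp)).add (ih fun y hy => h y (by simp [hy]))

theorem exists_isLoopSolution {hbar : ℂ} (hbar_ne : hbar ≠ 0) (hs : Function.Injective s)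
    {f : ℂ → ℂ} {v : Fin m → PowerSeries ℂ} (hv : ∀ i, IsTaylorAt f (s i) (v i))
    (hcrit : ∀ i, constantCoeff (actionGrad s hbar v i) = 0) {Cov : Matrix (Fin m) (Fin m) ℂ}
    (hCov : (Matrix.of fun i j => constantCoeff (pderiv ℂ j (actionGrad s hbar v i))) * Cov = 1) :
    ∃ w, IsLoopSolution hbar s f w := by
  obtain ⟨T, hT0, hT⟩ := exists_quadratic_root hbar_ne
  set H : Matrix (Fin m) (Fin m) ℂ :=
    Matrix.of fun i j => constantCoeff (pderiv ℂ j (actionGrad s hbar v i)) with hH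
  have hHsymm : H.transpose = H := by
    ext i j
    simp only [hH, Matrix.transpose_apply, Matrix.of_apply, pderiv_actionGrad_comm hbar v hs i j]
  have hCov' : Cov * H = 1 := mul_eq_one_comm.1 hCov
  have hCsymm : Cov.transpose = Cov := by
    have h1 : Cov.transpose * H = 1 := by
      have := congrArg Matrix.transpose hCov
      rwa [Matrix.transpose_mul, hHsymm, Matrix.transpose_one] at this
    calc Cov.transpose = Cov.transpose * (H * Cov) := by rw [hCov, mul_one]
      _ = Cov := by rw [← mul_assoc, h1, one_mul]
  let U := potential (actionGrad s hbar v)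
  have hU : ∀ i, (formalDisc m).D i U = actionGrad s hbar v i :=
    pderiv_potential fun i j => pderiv_actionGrad_comm hbar v hs i j
  have hUcrit : ∀ i, (formalDisc m).ev ((formalDisc m).D i U) = 0 := fun i => by
    rw [hU]; exact hcrit i
  obtain ⟨L, hL, hSD, hdiv⟩ := FormalDisc.exists_functional (S := formalDisc m) (U := U)
    (Δ := vdmSq s) (θ := repulsion s) (C := Cov) (T := T) (pderiv_vdmSq hs)
    (constantCoeff_vdmSq_ne_zero hs) hUcrit
    (fun i j => by conv_lhs => rw [← hCsymm, Matrix.transpose_apply])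
    (by simp only [hU]; exact hCov) hT0
  simp only [hU] at hSD
  set κ := T + PowerSeries.C hbar with hκ
  set P := cumulant L κ (traceResolvent s) hL with hP
  -- The solution consists of the `κ`-weighted cumulants of the resolvent traces; `φ t k` extracts
  -- one coefficient as a finite-order functional of the observable.
  let w : ℂ → Multiset ℂ → PowerSeries ℂ := fun x t => corrFun κ (traceResolvent s) hL x t
  let φ : Multiset ℂ → ℕ → MvPowerSeries (Fin m) ℂ →ₗ[ℂ] ℂ := fun t k =>
    (PowerSeries.coeff k : PowerSeries ℂ →ₗ[ℂ] ℂ) ∘ₗ LinearMap.mulLeft ℂ κ ∘ₗ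
      cumulantL κ (traceResolvent s) hL t
  have hφ : ∀ t k a, φ t k a = PowerSeries.coeff k (κ * P a t) := fun _ _ _ => rfl
  have hwφ : ∀ x t k, PowerSeries.coeff k (w x t) = φ t k (traceResolvent s x) := by
    intro x t k
    rw [hφ, ← const_mul_apply]
    rfl
  have hord : ∀ t k, FiniteOrder (φ t k) := by
    intro t k
    refine ⟨2 * k + 1, fun a ha => ?_⟩
    have h1 := dvd_cumulant_of_vanishes κ (traceResolvent s) hL hdiv ha t
    rw [hφ]
    exact PowerSeries.X_pow_dvd_iff.1 (h1.mul_left κ) k (by omega)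
  refine ⟨w, fun x t => ?_, fun x y t => ?_, fun t k => ?_, fun x => ?_, fun t ht k l => ?_⟩
  · have h1 := X_pow_card_dvd_cumulant κ (traceResolvent s) hL hSD hdiv
      (PowerSeries.X_dvd_iff.2 hT0) hcrit hCov' t (traceResolvent s x)
    change _ ∣ (const κ * _ : MultisetFun ℂ (PowerSeries ℂ)) t
    rw [const_mul_apply]
    exact h1.mul_left κ
  · exact congrArg (fun g : MultisetFun ℂ (PowerSeries ℂ) => g t)
      (ins_corrFun_comm κ (traceResolvent s) hL x y)
  · simp only [hwφ]
    exact (hord t k).mem_polarSpace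
  · rw [hwφ, hφ, hP, cumulant_apply_zero]
    -- To leading order the expectation is evaluation at the critical point, and `κ` reduces to `ħ`.
    have h1 : (PowerSeries.X : PowerSeries ℂ) ∣
        L (traceResolvent s x - (constantCoeff (traceResolvent s x)) • 1) := by
      have := hdiv 0 (traceResolvent s x - (constantCoeff (traceResolvent s x)) • 1)
        ⟨?_, fun i => trivial⟩
      · simpa using this
      · change constantCoeff _ = 0
        rw [map_sub, smul_eq_C_mul, map_mul, constantCoeff_C, map_one, mul_one, sub_self]
    rw [PowerSeries.X_dvd_iff, map_sub, map_sub, sub_eq_zero, map_smul, hL,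
      PowerSeries.smul_eq_C_mul, mul_one, PowerSeries.constantCoeff_C] at h1
    rw [PowerSeries.coeff_zero_eq_constantCoeff_apply, map_mul, h1, hκ, map_add, hT0, zero_add,
      PowerSeries.constantCoeff_C]
    simp [traceResolvent, resolvent, constantCoeff_inv]
  · obtain ⟨g, hg, hge⟩ := (hord t k).exists_analyticAt hs hv l
    -- `a` and `b` collect the parts of the contact terms whose coefficients in `x` are powers of
    -- `(x - y)⁻¹`; they are regular at `s l` because `y` is none of the `sᵢ`.
    set a : ℂ → PowerSeries ℂ := fun y => κ * P (∑ i, resolvent s y i ^ 2) (t.erase y) with ha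
    set b : ℂ → PowerSeries ℂ := fun y => κ * P (traceResolvent s y) (t.erase y) with hb
    let R : ℂ → ℂ := fun x => (t.map fun y => (x - y)⁻¹ * PowerSeries.coeff k (PowerSeries.X * a y)
      - (x - y)⁻¹ ^ 2 * PowerSeries.coeff k (PowerSeries.X * b y)).sum
    have hR : AnalyticAt ℂ R (s l) := by
      refine analyticAt_multiset_sum fun y hy => ?_
      have h1 : AnalyticAt ℂ (fun x : ℂ => (x - y)⁻¹) (s l) :=
        (analyticAt_id.sub analyticAt_const).inv
          (sub_ne_zero.2 fun h => ht y hy ⟨l, h⟩)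
      exact (h1.mul analyticAt_const).sub ((h1.pow 2).mul analyticAt_const)
    refine ⟨fun x => -g x - R x, hg.neg.sub hR, ?_⟩
    have hty : ∀ᶠ x in 𝓝[≠] (s l), ∀ y ∈ t.toFinset, x ≠ y := by
      refine (Filter.eventually_all_finset _).2 fun y hy => ?_
      refine (continuousAt_id.eventually_ne fun h => ht y ?_ ⟨l, h⟩).filter_mono nhdsWithin_le_nhds
      simpa using hy
    filter_upwards [hge, hty, eventually_notMem_range hs l] with x hgx hxt hx
    have hloop := congrArg (fun g : MultisetFun ℂ (PowerSeries ℂ) => PowerSeries.coeff k (g t))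
      (loop_equation hL hs hSD hκ hT hx (f x))
    simp only [MultisetFun.add_apply, MultisetFun.sub_apply, const_mul_apply, map_add, map_sub,
      MultisetFun.zero_apply, map_zero, ← hP] at hloop
    have e1 : PowerSeries.coeff k (PowerSeries.C hbar * (κ * P (∑ i, resolvent s x i ^ 2) t))
        = -(hbar * deriv (fun x => PowerSeries.coeff k (w x t)) x) := by
      simp only [hwφ]
      rw [((hord t k).hasDerivAt hx).deriv, hφ, PowerSeries.coeff_C_mul]
      ring
    have e2 : PowerSeries.coeff k (κ * P (∑ i, (C (f x) - atEig i (v i)) * resolvent s x i) t)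
        = g x := by rw [← hgx, hφ]
    have e3 : PowerSeries.coeff k (PowerSeries.X * (κ * source (fun z => P (∑ i,
        resolvent s x i * resolvent s z i ^ 2)) t)) = R x + PowerSeries.coeff k (PowerSeries.X
          * (t.map fun y => ((x - y)⁻¹ ^ 2) • w x (t.erase y)).sum) := by
      have e4 : ∀ y ∈ t, κ * P (∑ i, resolvent s x i * resolvent s y i ^ 2) (t.erase y) =
          (x - y)⁻¹ • a y - ((x - y)⁻¹ ^ 2) • b y + ((x - y)⁻¹ ^ 2) • w x (t.erase y) := by
        intro y hy
        have hy' := ht y hy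
        have e5 : ∑ i, resolvent s x i * resolvent s y i ^ 2 =
            (x - y)⁻¹ • ∑ i, resolvent s y i ^ 2 - ((x - y)⁻¹ ^ 2) • traceResolvent s y
              + ((x - y)⁻¹ ^ 2) • traceResolvent s x := by
          rw [traceResolvent, traceResolvent, Finset.smul_sum, Finset.smul_sum, Finset.smul_sum,
            ← Finset.sum_sub_distrib, ← Finset.sum_add_distrib]
          exact Finset.sum_congr rfl fun i _ => resolvent_mul_resolvent_sq
            (sub_ne_zero.2 (hxt y (by simpa using hy))) (sub_ne_zero_of_notMem hx i)
            (sub_ne_zero_of_notMem hy' i)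
        have e6 : w x (t.erase y) = κ * P (traceResolvent s x) (t.erase y) :=
          const_mul_apply _ _ _
        rw [e5, e6, ha, hb, map_add, map_sub, MultisetFun.add_apply, MultisetFun.sub_apply, hP]
        simp only [cumulant_smul_apply, PowerSeries.smul_eq_C_mul]
        ring
      rw [source_apply, ← Multiset.sum_map_mul_left, Multiset.map_congr rfl e4,
        Multiset.sum_map_add, mul_add, map_add]
      congr 1
      rw [← Multiset.sum_map_mul_left, map_multiset_sum, Multiset.map_map]
      refine congrArg _ (Multiset.map_congr rfl fun y _ => ?_)
      simp only [Function.comp_apply, mul_sub, mul_smul_comm, map_sub, map_smul, smul_eq_mul]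
    have e7 : (t.antidiagonal.map fun p => w x p.1 * w x p.2).sum
        = (corrFun κ (traceResolvent s) hL x * corrFun κ (traceResolvent s) hL x :
            MultisetFun ℂ (PowerSeries ℂ)) t := rfl
    have e8 : ins x (corrFun κ (traceResolvent s) hL x) t = w x (x ::ₘ t) := rfl
    have e9 : PowerSeries.coeff k (PowerSeries.C (f x) * corrFun κ (traceResolvent s) hL x t)
        = f x * PowerSeries.coeff k (w x t) := PowerSeries.coeff_C_mul _ _ _
    rw [e1, e2, e3, e8, e9] at hloop
    rw [map_add, map_add, e7]
    linear_combination hloop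

end QuantumTR

end

/-! ### Residues, and inversion of the loop operator by the kernel -/

noncomputable section

namespace QuantumTR

/-- The integral of `f` over every small circle around `a` is `2 π i c`. -/
def HasRes (f : ℂ → ℂ) (a c : ℂ) : Prop :=
  ∀ᶠ r in 𝓝[>] (0 : ℝ), CircleIntegrable f a r ∧
    (2 * (Real.pi : ℂ) * Complex.I)⁻¹ * (∮ z in C(a, r), f z) = c

theorem HasRes.residue_eq {f : ℂ → ℂ} {a c : ℂ} (h : HasRes f a c) : residue f a = c :=
  Tendsto.limUnder_eq (tendsto_const_nhds.congr' (h.mono fun _ hr => hr.2.symm))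

theorem eventually_sphere {p : ℂ → Prop} {a : ℂ} (h : ∀ᶠ z in 𝓝[≠] a, p z) :
    ∀ᶠ r in 𝓝[>] (0 : ℝ), 0 < r ∧ ∀ z ∈ Metric.sphere a r, p z := by
  rw [eventually_nhdsWithin_iff, Metric.eventually_nhds_iff] at h
  obtain ⟨ε, hε, h⟩ := h
  filter_upwards [Ioo_mem_nhdsGT hε] with r hr
  refine ⟨hr.1, fun z hz => h ?_ ?_⟩
  · rw [Metric.mem_sphere.1 hz]; exact hr.2
  · rintro rfl
    rw [Metric.mem_sphere, dist_self] at hz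
    exact hr.1.ne hz

theorem HasRes.congr {f g : ℂ → ℂ} {a c : ℂ} (h : HasRes f a c) (hfg : ∀ᶠ z in 𝓝[≠] a, f z = g z) :
    HasRes g a c := by
  filter_upwards [h, eventually_sphere hfg] with r hr hs
  have e : Set.EqOn f g (Metric.sphere a |r|) := fun z hz =>
    hs.2 z (by rwa [abs_of_pos hs.1] at hz)
  refine ⟨(circleIntegrable_congr e).1 hr.1, ?_⟩
  rw [← hr.2, circleIntegral.integral_congr hs.1.le (fun z hz => (hs.2 z hz).symm)]

theorem HasRes.add {f g : ℂ → ℂ} {a c d : ℂ} (hf : HasRes f a c) (hg : HasRes g a d) :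
    HasRes (fun z => f z + g z) a (c + d) := by
  filter_upwards [hf, hg] with r h1 h2
  refine ⟨h1.1.add h2.1, ?_⟩
  rw [circleIntegral.integral_add h1.1 h2.1, mul_add, h1.2, h2.2]

theorem HasRes.const_mul {f : ℂ → ℂ} {a c : ℂ} (hf : HasRes f a c) (b : ℂ) :
    HasRes (fun z => b * f z) a (b * c) := by
  filter_upwards [hf] with r h1
  refine ⟨h1.1.const_smul, ?_⟩
  rw [circleIntegral.integral_const_mul, mul_left_comm, h1.2]

theorem HasRes.neg {f : ℂ → ℂ} {a c : ℂ} (hf : HasRes f a c) :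
    HasRes (fun z => -f z) a (-c) := by
  simpa using hf.const_mul (-1)

theorem HasRes.sub {f g : ℂ → ℂ} {a c d : ℂ} (hf : HasRes f a c) (hg : HasRes g a d) :
    HasRes (fun z => f z - g z) a (c - d) := by
  simpa [sub_eq_add_neg] using hf.add hg.neg

theorem hasRes_zero (a : ℂ) : HasRes (fun _ => 0) a 0 :=
  Eventually.of_forall fun r => ⟨circleIntegrable_const 0 a r, by simp [circleIntegral]⟩

theorem HasRes.sum {κ : Type*} (t : Finset κ) {f : κ → ℂ → ℂ} {a : ℂ} {c : κ → ℂ}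
    (h : ∀ i ∈ t, HasRes (f i) a (c i)) : HasRes (fun z => ∑ i ∈ t, f i z) a (∑ i ∈ t, c i) := by
  classical
  induction t using Finset.induction_on with
  | empty => simpa using hasRes_zero a
  | insert i t hi ih =>
    simp only [Finset.sum_insert hi]
    exact (h i (by simp)).add (ih fun j hj => h j (by simp [hj]))

theorem AnalyticAt.hasRes {f : ℂ → ℂ} {a : ℂ} (hf : AnalyticAt ℂ f a) : HasRes f a 0 := by
  obtain ⟨ε, hε, h⟩ := Metric.eventually_nhds_iff.1 hf.eventually_analyticAt
  filter_upwards [Ioo_mem_nhdsGT hε] with r hr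
  have hd : DifferentiableOn ℂ f (Metric.closedBall a r) := fun z hz =>
    (h (lt_of_le_of_lt (Metric.mem_closedBall.1 hz) hr.2)).differentiableAt.differentiableWithinAt
  refine ⟨(hd.continuousOn.mono Metric.sphere_subset_closedBall).circleIntegrable hr.1.le, ?_⟩
  rw [Complex.circleIntegral_eq_zero_of_differentiable_on_off_countable hr.1.le
    Set.countable_empty hd.continuousOn, mul_zero]
  intro z hz
  exact (h (lt_trans (Metric.mem_ball.1 hz.1) hr.2)).differentiableAt

theorem hasRes_deriv {F : ℂ → ℂ} {a : ℂ} (hF : ∀ᶠ z in 𝓝[≠] a, AnalyticAt ℂ F z) :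
    HasRes (deriv F) a 0 := by
  filter_upwards [eventually_sphere hF] with r hr
  refine ⟨ContinuousOn.circleIntegrable hr.1.le fun z hz =>
    (hr.2 z hz).deriv.continuousAt.continuousWithinAt, ?_⟩
  rw [circleIntegral.integral_eq_zero_of_hasDerivWithinAt hr.1.le
    (fun z hz => (hr.2 z hz).differentiableAt.hasDerivAt.hasDerivWithinAt), mul_zero]

theorem hasRes_inv_sub (a : ℂ) : HasRes (fun z => (z - a)⁻¹) a 1 := by
  filter_upwards [self_mem_nhdsWithin] with r (hr : 0 < r)
  refine ⟨circleIntegrable_sub_inv_iff.2 (Or.inr ?_), ?_⟩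
  · simp [hr.ne, abs_of_pos hr]
  · rw [circleIntegral.integral_sub_center_inv a hr.ne', inv_mul_cancel₀]
    simp [Real.pi_ne_zero]

theorem hasRes_inv_sub_pow (a : ℂ) (k : ℕ) : HasRes (fun z => ((z - a) ^ (k + 2))⁻¹) a 0 := by
  have h1 : HasRes (deriv fun z => ((z - a) ^ (k + 1))⁻¹) a 0 := by
    refine hasRes_deriv ?_
    filter_upwards [self_mem_nhdsWithin] with z hz
    exact ((analyticAt_id.sub analyticAt_const).pow _).inv (pow_ne_zero _ (sub_ne_zero.2 hz))
  have h2 : ((k + 1 : ℕ) : ℂ) ≠ 0 := Nat.cast_ne_zero.2 k.succ_ne_zero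
  have h3 := h1.const_mul (-((k + 1 : ℕ) : ℂ)⁻¹)
  rw [mul_zero] at h3
  refine h3.congr ?_
  filter_upwards [self_mem_nhdsWithin] with z hz
  rw [(hasDerivAt_inv_sub_pow (sub_ne_zero.2 hz) k).deriv]
  field_simp

theorem AnalyticAt.hasRes_inv_sub_mul {h : ℂ → ℂ} {a : ℂ} (hh : AnalyticAt ℂ h a) :
    HasRes (fun z => (z - a)⁻¹ * h z) a (h a) := by
  have h1 : AnalyticAt ℂ (dslope h a) a := by
    obtain ⟨p, hp⟩ := hh
    exact ⟨_, hp.has_fpower_series_dslope_fslope⟩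
  have h2 := ((hasRes_inv_sub a).const_mul (h a)).add (AnalyticAt.hasRes h1)
  rw [mul_one, add_zero] at h2
  refine h2.congr ?_
  filter_upwards [self_mem_nhdsWithin] with z hz
  have h3 : z - a ≠ 0 := sub_ne_zero.2 hz
  have h4 := sub_smul_dslope h a z
  rw [smul_eq_mul] at h4
  field_simp
  linear_combination h4

/-- Induction through `((z-p)(z-c))⁻¹ = (p-c)⁻¹ ((z-p)⁻¹ - (z-c)⁻¹)`; the higher powers of `(z-c)⁻¹`
carry no residue. -/
theorem hasRes_inv_sub_mul_pow {p c : ℂ} (hpc : p ≠ c) (k : ℕ) :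
    HasRes (fun z => (z - p)⁻¹ * ((z - c) ^ (k + 1))⁻¹) c (-((p - c) ^ (k + 1))⁻¹) := by
  have hne : p - c ≠ 0 := sub_ne_zero.2 hpc
  have hp : ∀ᶠ z in 𝓝[≠] c, z - p ≠ 0 :=
    ((continuousAt_id.sub continuousAt_const).eventually_ne
      (sub_ne_zero.2 hpc.symm)).filter_mono nhdsWithin_le_nhds
  induction k with
  | zero =>
    have h0 : AnalyticAt ℂ (fun z : ℂ => (z - p)⁻¹) c :=
      (analyticAt_id.sub analyticAt_const).inv (sub_ne_zero.2 hpc.symm)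
    have h1 := AnalyticAt.hasRes_inv_sub_mul h0
    have e : (c - p)⁻¹ = -((p - c) ^ (0 + 1))⁻¹ := by
      rw [← neg_sub, inv_neg, zero_add, pow_one]
    rw [e] at h1
    refine h1.congr (Eventually.of_forall fun z => ?_)
    simp [mul_comm]
  | succ k ih =>
    have h1 := (ih.sub (hasRes_inv_sub_pow c k)).const_mul (p - c)⁻¹
    have e : (p - c)⁻¹ * (-((p - c) ^ (k + 1))⁻¹ - 0) = -((p - c) ^ (k + 1 + 1))⁻¹ := by
      rw [sub_zero, mul_neg, ← mul_inv, ← pow_succ']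
    rw [e] at h1
    refine h1.congr ?_
    filter_upwards [self_mem_nhdsWithin, hp] with z hz hzp
    have h2 : z - c ≠ 0 := sub_ne_zero.2 hz
    field_simp
    ring

variable {m : ℕ} {s : Fin m → ℂ}

theorem analyticAt_of_mem_polarSpace {w : ℂ → ℂ} (hw : w ∈ polarSpace s) {x : ℂ}
    (hx : x ∉ Set.range s) : AnalyticAt ℂ w x := by
  induction hw using Submodule.span_induction with
  | mem w hw =>
    obtain ⟨p, rfl⟩ := hw
    exact ((analyticAt_id.sub analyticAt_const).pow _).inv
      (pow_ne_zero _ (sub_ne_zero_of_notMem hx _))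
  | zero => exact analyticAt_const
  | add _ _ _ _ h1 h2 => exact h1.add h2
  | smul c _ _ h => exact analyticAt_const.smul h

theorem meromorphicAt_of_mem_polarSpace {w : ℂ → ℂ} (hw : w ∈ polarSpace s) (x : ℂ) :
    MeromorphicAt w x := by
  induction hw using Submodule.span_induction with
  | mem w hw =>
    obtain ⟨p, rfl⟩ := hw
    exact (((MeromorphicAt.id x).sub (MeromorphicAt.const _ x)).pow _).inv
  | zero => exact MeromorphicAt.const 0 x
  | add _ _ _ _ h1 h2 => exact h1.add h2
  | smul c _ _ h => exact (MeromorphicAt.const c x).smul h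

/-- The sum of the residues at the `sᵢ` of the product of a Cauchy kernel with a function in
`polarSpace s`. -/
theorem exists_hasRes_cauchy_mul (hs : Function.Injective s) {x₀ : ℂ} (hx₀ : x₀ ∉ Set.range s)
    (A : Fin m → ℂ) {w : ℂ → ℂ} (hw : w ∈ polarSpace s) :
    ∃ ρ : Fin m → ℂ, (∀ i, HasRes (fun x => ((x - x₀)⁻¹ + ∑ j, A j * (x - s j)⁻¹) * w x) (s i) (ρ i))
      ∧ ∑ i, ρ i = -w x₀ := by
  induction hw using Submodule.span_induction with
  | zero =>
    refine ⟨0, fun i => ?_, by simp⟩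
    simpa using hasRes_zero (s i)
  | add w w' _ _ h1 h2 =>
    obtain ⟨ρ, h1, h1'⟩ := h1
    obtain ⟨ρ', h2, h2'⟩ := h2
    refine ⟨ρ + ρ', fun i => ?_, ?_⟩
    · simpa [mul_add] using (h1 i).add (h2 i)
    · simp [Finset.sum_add_distrib, h1', h2']; ring
  | smul c w _ h1 =>
    obtain ⟨ρ, h1, h1'⟩ := h1
    refine ⟨c • ρ, fun i => ?_, ?_⟩
    · simpa [mul_left_comm] using (h1 i).const_mul c
    · simp [← Finset.mul_sum, h1']
  | mem w hw =>
    obtain ⟨⟨c, k⟩, rfl⟩ := hw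
    -- On a basis element with pole at `s c`, the pole at `x₀` leaves the residue `-w x₀` at `s c`.
    -- A pole at `s j` with `j ≠ c` gives opposite residues at `s j` and `s c`, and `j = c` gives a
    -- higher-order pole without residue.
    have off : ∀ i p : ℂ, i ≠ p → i ≠ s c →
        HasRes (fun x => (x - p)⁻¹ * ((x - s c) ^ (k + 1))⁻¹) i 0 := fun i p h1 h2 => by
      refine AnalyticAt.hasRes ?_
      exact ((analyticAt_id.sub analyticAt_const).inv (sub_ne_zero.2 h1)).mul
        (((analyticAt_id.sub analyticAt_const).pow _).inv (pow_ne_zero _ (sub_ne_zero.2 h2)))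
    have hx : ∀ i, s i ≠ x₀ := fun i h => hx₀ ⟨i, h⟩
    have first : ∀ i, HasRes (fun x => (x - x₀)⁻¹ * ((x - s c) ^ (k + 1))⁻¹) (s i)
        (if i = c then -((x₀ - s c) ^ (k + 1))⁻¹ else 0) := by
      intro i
      split_ifs with h
      · subst h
        exact hasRes_inv_sub_mul_pow (hx i).symm k
      · exact off _ _ (hx i) (hs.ne h)
    have second : ∀ j i, HasRes (fun x => (x - s j)⁻¹ * ((x - s c) ^ (k + 1))⁻¹) (s i)
        (if j = c then 0 else (if i = j then ((s j - s c) ^ (k + 1))⁻¹ else 0)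
          + if i = c then -((s j - s c) ^ (k + 1))⁻¹ else 0) := by
      intro j i
      by_cases hjc : j = c
      · subst hjc
        rw [if_pos rfl]
        have e : (fun x => (x - s j)⁻¹ * ((x - s j) ^ (k + 1))⁻¹)
            = fun x => ((x - s j) ^ (k + 2))⁻¹ := by
          funext x; rw [← mul_inv, ← pow_succ']
        rcases eq_or_ne i j with rfl | h
        · rw [e]; exact hasRes_inv_sub_pow _ k
        · exact off _ _ (hs.ne h) (hs.ne h)
      · rw [if_neg hjc]
        rcases eq_or_ne i j with rfl | hij
        · rw [if_pos rfl, if_neg hjc, add_zero]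
          have h0 : AnalyticAt ℂ (fun x => ((x - s c) ^ (k + 1))⁻¹) (s i) :=
            ((analyticAt_id.sub analyticAt_const).pow _).inv
              (pow_ne_zero _ (sub_ne_zero.2 (hs.ne hjc)))
          exact AnalyticAt.hasRes_inv_sub_mul h0
        · rw [if_neg hij, zero_add]
          split_ifs with h
          · subst h
            exact hasRes_inv_sub_mul_pow (hs.ne hjc) k
          · exact off _ _ (hs.ne hij) (hs.ne h)
    refine ⟨_, fun i => ((first i).add (HasRes.sum Finset.univ fun j _ =>
      (second j i).const_mul (A j))).congr (Eventually.of_forall fun x => ?_), ?_⟩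
    · simp only [add_mul, Finset.sum_mul, mul_assoc]
    · rw [Finset.sum_add_distrib, Finset.sum_comm]
      have : ∀ j, ∑ i, A j * (if j = c then 0 else (if i = j then ((s j - s c) ^ (k + 1))⁻¹ else 0)
          + if i = c then -((s j - s c) ^ (k + 1))⁻¹ else 0) = 0 := by
        intro j
        rw [← Finset.mul_sum]
        split_ifs
        · simp
        · simp [Finset.sum_add_distrib]
      rw [Finset.sum_congr rfl fun j _ => this j]
      simp

/-- The kernel inverts the operator `c + ħ ∂` modulo functions regular at the `sᵢ`. -/
theorem sum_residue_eq (hs : Function.Injective s) {x₀ : ℂ} (hx₀ : x₀ ∉ Set.range s) {hbar : ℂ}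
    {c k : ℂ → ℂ} {A : Fin m → ℂ} (hk : ∀ i, AnalyticAt ℂ k (s i))
    (hode : ∀ i, ∀ᶠ x in 𝓝[≠] (s i),
      c x * k x - hbar * deriv k x = (x - x₀)⁻¹ + ∑ j, A j * (x - s j)⁻¹)
    {w : ℂ → ℂ} (hw : w ∈ polarSpace s) {f : ℂ → ℂ}
    (hf : ∀ i, ∃ h, AnalyticAt ℂ h (s i) ∧
      ∀ᶠ x in 𝓝[≠] (s i), f x + (c x * w x + hbar * deriv w x) = h x) :
    ∑ i, residue (fun x => k x * f x) (s i) = w x₀ := by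
  obtain ⟨ρ, hρ, hsum⟩ := exists_hasRes_cauchy_mul hs hx₀ A hw
  have key : ∀ i, HasRes (fun x => k x * f x) (s i) (-ρ i) := by
    intro i
    obtain ⟨h, hh, hfe⟩ := hf i
    have hkA : ∀ᶠ x in 𝓝[≠] (s i), AnalyticAt ℂ k x :=
      (hk i).eventually_analyticAt.filter_mono nhdsWithin_le_nhds
    have hwA : ∀ᶠ x in 𝓝[≠] (s i), AnalyticAt ℂ w x :=
      (eventually_notMem_range hs i).mono fun x hx => analyticAt_of_mem_polarSpace hw hx
    -- By the two equations `k f = k h - (Cauchy kernel) w - ħ (k w)'`: the first term is regular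
    -- and the last is a total derivative, so only the middle one has a residue.
    have h1 : HasRes (deriv fun x => k x * w x) (s i) 0 :=
      hasRes_deriv (by filter_upwards [hkA, hwA] with x h1 h2 using h1.mul h2)
    have h2 := (AnalyticAt.hasRes ((hk i).mul hh)).sub ((hρ i).add (h1.const_mul hbar))
    rw [mul_zero, add_zero, zero_sub] at h2
    refine h2.congr ?_
    filter_upwards [hfe, hode i, hkA, hwA] with x e1 e2 e3 e4
    have e5 : deriv (fun x => k x * w x) x = deriv k x * w x + k x * deriv w x :=
      deriv_fun_mul e3.differentiableAt e4.differentiableAt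
    rw [e5, ← e2]
    change k x * h x - _ = _
    rw [← e1]
    ring
  rw [Finset.sum_congr rfl fun i _ => (key i).residue_eq, Finset.sum_neg_distrib, hsum, neg_neg]

end QuantumTR

end

/-! ### Partial fractions -/

noncomputable section

namespace QuantumTR

theorem analyticAt_ratFunc_eval (r : RatFunc ℂ) {x : ℂ} (h : r.denom.eval x ≠ 0) :
    AnalyticAt ℂ (fun x => r.eval (RingHom.id ℂ) x) x := by
  have hp : ∀ p : Polynomial ℂ, AnalyticAt ℂ (fun x => p.eval x) x := fun p =>
    AnalyticOnNhd.eval_polynomial p x (Set.mem_univ x)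
  exact (hp r.num).div (hp r.denom) h

theorem IsRationalOff.analyticAt {S : Set ℂ} (hS : S.Finite) {f : ℂ → ℂ} (hf : IsRationalOff S f)
    {x : ℂ} (hx : x ∉ S) : AnalyticAt ℂ f x := by
  obtain ⟨r, hr, he⟩ := hf
  refine (analyticAt_ratFunc_eval r fun h => hx (hr x h)).congr ?_
  filter_upwards [hS.isClosed.isOpen_compl.mem_nhds hx] with y hy using (he y hy).symm

/-- The partial fraction decomposition of a function with finitely many simple poles that vanishes
at infinity. -/
theorem eq_sum_of_simple_poles {S : Finset ℂ} {f c : ℂ → ℂ} (hf : ∀ x ∉ S, AnalyticAt ℂ f x)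
    (hlim : ∀ p ∈ S, Tendsto (fun x => (x - p) * f x) (𝓝[≠] p) (𝓝 (c p)))
    (hinf : Tendsto f (Bornology.cobounded ℂ) (𝓝 0)) {x : ℂ} (hx : x ∉ S) :
    f x = ∑ p ∈ S, c p * (x - p)⁻¹ := by
  set g : ℂ → ℂ := fun x => f x - ∑ p ∈ S, c p * (x - p)⁻¹ with hg
  have hpole : ∀ p x : ℂ, x ≠ p → AnalyticAt ℂ (fun x => c p * (x - p)⁻¹) x := fun p x h =>
    analyticAt_const.mul ((analyticAt_id.sub analyticAt_const).inv (sub_ne_zero.2 h))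
  have hgA : ∀ x ∉ S, AnalyticAt ℂ g x := fun x hx => (hf x hx).sub
    (Finset.analyticAt_fun_sum _ fun p hp => hpole p x (ne_of_mem_of_not_mem hp hx).symm)
  have hginf : Tendsto g (Bornology.cobounded ℂ) (𝓝 0) := by
    have h1 : ∀ p : ℂ, Tendsto (fun x : ℂ => c p * (x - p)⁻¹) (Bornology.cobounded ℂ) (𝓝 0) := by
      intro p
      have := (tendsto_inv₀_cobounded (α := ℂ)).comp (tendsto_sub_const_cobounded p)
      simpa using this.const_mul (c p)
    simpa using hinf.sub (tendsto_finsetSum S fun p _ => h1 p)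
  have hg0 : ∀ p ∈ S, Tendsto (fun x => (x - p) * g x) (𝓝[≠] p) (𝓝 0) := by
    intro p hp
    have h1 : ContinuousAt (fun x => ∑ q ∈ S.erase p, c q * (x - q)⁻¹) p :=
      (Finset.analyticAt_fun_sum _ fun q hq =>
        hpole q p (Finset.ne_of_mem_erase hq).symm).continuousAt
    have h2 : ContinuousAt (fun x => (x - p) * ∑ q ∈ S.erase p, c q * (x - q)⁻¹) p :=
      (continuousAt_id.sub continuousAt_const).mul h1
    have h3 := ((hlim p hp).sub (tendsto_const_nhds (x := c p))).sub
      (h2.tendsto.mono_left nhdsWithin_le_nhds)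
    simp only [sub_self, zero_mul] at h3
    refine h3.congr' ?_
    filter_upwards [self_mem_nhdsWithin] with x hx
    have h4 : x - p ≠ 0 := sub_ne_zero.2 hx
    simp only [hg]
    rw [← Finset.add_sum_erase S _ hp]
    field_simp
    ring
  -- Taking punctured limits fills the removable singularities; the extension is entire and tends to
  -- `0`, so Liouville's theorem applies.
  let h : ℂ → ℂ := fun x => limUnder (𝓝[≠] x) g
  have hoff : ∀ x ∉ S, h x = g x := fun x hx =>
    Tendsto.limUnder_eq ((hgA x hx).continuousAt.tendsto.mono_left nhdsWithin_le_nhds)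
  have hSo : ∀ x ∉ S, ∀ᶠ y in 𝓝 x, y ∉ S := fun x hx =>
    S.finite_toSet.isClosed.isOpen_compl.mem_nhds hx
  have hd : Differentiable ℂ h := by
    intro x
    by_cases hx : x ∈ S
    · have hU : ((S.erase x : Set ℂ))ᶜ ∈ 𝓝 x :=
        (S.erase x).finite_toSet.isClosed.isOpen_compl.mem_nhds (by simp)
      have hd1 : DifferentiableOn ℂ g (((S.erase x : Set ℂ))ᶜ \ {x}) := fun y hy =>
        (hgA y fun hyS => hy.1 (Finset.mem_coe.2 (Finset.mem_erase.2
          ⟨hy.2, hyS⟩))).differentiableAt.differentiableWithinAt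
      have ho : (fun z => g z - g x) =o[𝓝[≠] x] fun z => (z - x)⁻¹ := by
        refine (Asymptotics.isLittleO_iff_tendsto' ?_).2 ?_
        · filter_upwards [self_mem_nhdsWithin] with z hz h0
          exact absurd h0 (inv_ne_zero (sub_ne_zero.2 hz))
        · have hc : Tendsto (fun z => (z - x) * g x) (𝓝[≠] x) (𝓝 0) := by
            have : ContinuousAt (fun z => (z - x) * g x) x := by fun_prop
            simpa using this.tendsto.mono_left nhdsWithin_le_nhds
          refine (((hg0 x hx).sub hc).congr fun z => ?_).trans (by simp)
          rw [div_inv_eq_mul]; ring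
      have hd2 := (Complex.differentiableOn_update_limUnder_of_isLittleO hU hd1 ho).differentiableAt
        hU
      refine hd2.congr_of_eventuallyEq ?_
      filter_upwards [hU] with y hy
      rcases eq_or_ne y x with rfl | hyx
      · simp [h]
      · rw [Function.update_of_ne hyx]
        exact hoff y fun hyS => hy (Finset.mem_coe.2 (Finset.mem_erase.2 ⟨hyx, hyS⟩))
    · refine (hgA x hx).differentiableAt.congr_of_eventuallyEq ?_
      filter_upwards [hSo x hx] with y hy using hoff y hy
  have hinf' : Tendsto h (cocompact ℂ) (𝓝 0) := by
    rw [← Metric.cobounded_eq_cocompact]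
    refine hginf.congr' ?_
    have : ∀ᶠ y in Bornology.cobounded ℂ, y ∉ S :=
      Bornology.isBounded_def.1 S.finite_toSet.isBounded
    filter_upwards [this] with y hy using (hoff y hy).symm
  have h0 : h x = 0 := hd.apply_eq_of_tendsto_cocompact x hinf'
  rw [hoff x hx] at h0
  exact sub_eq_zero.1 h0

variable {m : ℕ} {s : Fin m → ℂ}

/-- The functions `(x - sₖ)⁻²` and one of the functions `(x - sᵢ)⁻¹` are linearly independent. -/
theorem eq_zero_of_sum_inv_sq (hs : Function.Injective s) {α : Fin m → ℂ} {β : ℂ} (i : Fin m)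
    (h : ∀ x ∉ Set.range s, ∑ k, α k * ((x - s k) ^ 2)⁻¹ + β * (x - s i)⁻¹ = 0) :
    (∀ k, α k = 0) ∧ β = 0 := by
  have key : ∀ k, α k = 0 := by
    intro k
    have h1 : ∀ j ≠ k, ContinuousAt (fun x => (x - s k) ^ 2 * (α j * ((x - s j) ^ 2)⁻¹)) (s k) := by
      intro j hj
      have : (s k - s j) ^ 2 ≠ 0 := pow_ne_zero _ (sub_ne_zero.2 (hs.ne hj.symm))
      exact ((continuousAt_id.sub continuousAt_const).pow 2).mul (continuousAt_const.mul
        (((continuousAt_id.sub continuousAt_const).pow 2).inv₀ this))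
    have h2 : Tendsto (fun x => α k + (∑ j ∈ Finset.univ.erase k,
        (x - s k) ^ 2 * (α j * ((x - s j) ^ 2)⁻¹) + β * ((x - s k) ^ 2 * (x - s i)⁻¹)))
        (𝓝[≠] (s k)) (𝓝 (α k + (∑ j ∈ Finset.univ.erase k, 0 + β * 0))) := by
      refine tendsto_const_nhds.add ((tendsto_finsetSum _ fun j hj => ?_).add (.const_mul β ?_))
      · have := (h1 j (Finset.ne_of_mem_erase hj)).tendsto.mono_left
          (nhdsWithin_le_nhds (s := {s k}ᶜ))
        simpa using this
      · rcases eq_or_ne i k with rfl | hik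
        · have h3 : ContinuousAt (fun x => x - s i) (s i) := by fun_prop
          have h4 := h3.tendsto.mono_left (nhdsWithin_le_nhds (s := {s i}ᶜ))
          rw [sub_self] at h4
          refine h4.congr' ?_
          filter_upwards [self_mem_nhdsWithin] with x hx
          have : x - s i ≠ 0 := sub_ne_zero.2 hx
          field_simp
        · have h3 : ContinuousAt (fun x => (x - s k) ^ 2 * (x - s i)⁻¹) (s k) :=
            ((continuousAt_id.sub continuousAt_const).pow 2).mul
              ((continuousAt_id.sub continuousAt_const).inv₀ (sub_ne_zero.2 (hs.ne hik.symm)))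
          simpa using h3.tendsto.mono_left (nhdsWithin_le_nhds (s := {s k}ᶜ))
    have h5 : ∀ᶠ x in 𝓝[≠] (s k), α k + (∑ j ∈ Finset.univ.erase k,
        (x - s k) ^ 2 * (α j * ((x - s j) ^ 2)⁻¹) + β * ((x - s k) ^ 2 * (x - s i)⁻¹)) = 0 := by
      filter_upwards [eventually_notMem_range hs k] with x hx
      have h6 := h x hx
      have h7 := sub_ne_zero_of_notMem hx k
      rw [← Finset.add_sum_erase _ _ (Finset.mem_univ k)] at h6
      rw [← Finset.mul_sum]
      have h8 : (x - s k) ^ 2 * ((x - s k) ^ 2)⁻¹ = 1 := mul_inv_cancel₀ (pow_ne_zero _ h7)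
      linear_combination (x - s k) ^ 2 * h6 - α k * h8
    have h9 := tendsto_nhds_unique (h2.congr' h5) tendsto_const_nhds
    simpa using h9
  refine ⟨key, ?_⟩
  obtain ⟨x, hx⟩ := (eventually_notMem_range hs i).exists
  have := h x hx
  simp only [key, zero_mul, Finset.sum_const_zero, zero_add] at this
  exact (mul_eq_zero.1 this).resolve_right (inv_ne_zero (sub_ne_zero_of_notMem hx i))

/-- A linear form vanishing on all these vectors would be a linear relation between the functions
`(x - sᵢ)⁻²`. -/
theorem span_inv_sq_eq_top (hs : Function.Injective s) :
    Submodule.span ℂ ((fun x i => ((x - s i) ^ 2)⁻¹ : ℂ → Fin m → ℂ) '' (Set.range s)ᶜ) = ⊤ := by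
  rcases Nat.eq_zero_or_pos m with rfl | hm
  · exact Subsingleton.elim _ _
  by_contra h
  obtain ⟨φ, hφ, hle⟩ := Submodule.exists_le_ker_of_lt_top _ (lt_top_iff_ne_top.2 h)
  refine hφ (LinearMap.pi_ext' fun i => LinearMap.ext_ring ?_)
  refine (eq_zero_of_sum_inv_sq hs (α := fun k => φ (Pi.single k 1)) (β := 0) ⟨0, hm⟩
    fun x hx => ?_).1 i
  have h1 : φ (fun i => ((x - s i) ^ 2)⁻¹) = 0 := hle (Submodule.subset_span ⟨x, hx, rfl⟩)
  rw [LinearMap.pi_apply_eq_sum_univ] at h1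
  rw [zero_mul, add_zero, ← h1]
  refine Finset.sum_congr rfl fun k _ => ?_
  rw [smul_eq_mul, mul_comm, Pi.single]
  congr 2
  funext j; simp [Function.update_apply, eq_comm]

end QuantumTR

end

/-! ### What the conditions on `G` and `K` force: criticality and the inverse Hessian -/

noncomputable section

namespace QuantumTR

variable {m : ℕ} {s : Fin m → ℂ} {hbar : ℂ}

/-- The regular part at `sᵢ` of the potential `2 ħ ∑ⱼ (x - sⱼ)⁻¹ - f x`. -/
def regularPart (hbar : ℂ) (s : Fin m → ℂ) (f : ℂ → ℂ) (i : Fin m) (x : ℂ) : ℂ :=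
  2 * hbar * ∑ j ∈ Finset.univ.erase i, (x - s j)⁻¹ - f x

theorem analyticAt_inv_sub_of_ne (hs : Function.Injective s) {i j : Fin m} (h : j ≠ i) :
    AnalyticAt ℂ (fun x => (x - s j)⁻¹) (s i) :=
  (analyticAt_id.sub analyticAt_const).inv (sub_ne_zero.2 (hs.ne h.symm))

theorem analyticAt_regularPart (hs : Function.Injective s) {f : ℂ → ℂ} {i : Fin m}
    (hf : AnalyticAt ℂ f (s i)) : AnalyticAt ℂ (regularPart hbar s f i) (s i) :=
  (analyticAt_const.mul (Finset.analyticAt_fun_sum _ fun _ hj =>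
    analyticAt_inv_sub_of_ne hs (Finset.ne_of_mem_erase hj))).sub hf

theorem two_hbar_mul_sum_inv (f : ℂ → ℂ) (i : Fin m) (x : ℂ) :
    2 * hbar * ∑ j, 1 / (x - s j) - f x = 2 * hbar * (x - s i)⁻¹ + regularPart hbar s f i x := by
  simp only [one_div, regularPart]
  rw [← Finset.add_sum_erase _ _ (Finset.mem_univ i)]
  ring

/-- The first three coefficients of the Taylor expansion of a solution of the kernel equation. -/
theorem ode_expansion {k ρ g : ℂ → ℂ} {c a : ℂ} (hk : AnalyticAt ℂ k c) (hρ : AnalyticAt ℂ ρ c)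
    (hg : AnalyticAt ℂ g c) (h : ∀ᶠ x in 𝓝[≠] c,
      (2 * hbar * (x - c)⁻¹ + ρ x) * k x - hbar * deriv k x = g x + a * (x - c)⁻¹) :
    2 * hbar * k c = a ∧ hbar * deriv k c + ρ c * k c = g c ∧
      deriv ρ c * k c + ρ c * deriv k c = deriv g c := by
  set b : ℂ → ℂ := fun x => ρ x * k x - hbar * deriv k x - g x with hb
  have hbA : AnalyticAt ℂ b c := ((hρ.mul hk).sub (analyticAt_const.mul hk.deriv)).sub hg
  -- Multiplied by `x - c`, the equation is analytic and extends over `c`; its value and first two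
  -- derivatives there give the three relations.
  have hE : ∀ᶠ x in 𝓝 c, 2 * hbar * k x + (x - c) * b x - a = 0 := by
    have hA : AnalyticAt ℂ (fun x => 2 * hbar * k x + (x - c) * b x - a) c :=
      ((analyticAt_const.mul hk).add ((analyticAt_id.sub analyticAt_const).mul hbA)).sub
        analyticAt_const
    refine hA.frequently_zero_iff_eventually_zero.1 (Eventually.frequently ?_)
    filter_upwards [h, self_mem_nhdsWithin] with x hx hxc
    have h1 : (x - c)⁻¹ * (x - c) = 1 := inv_mul_cancel₀ (sub_ne_zero.2 hxc)
    simp only [hb]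
    linear_combination (x - c) * hx + (a - 2 * hbar * k x) * h1
  have hE1 : ∀ᶠ x in 𝓝 c, 2 * hbar * deriv k x + (b x + (x - c) * deriv b x) = 0 := by
    filter_upwards [hE.eventually_nhds, hk.eventually_analyticAt, hbA.eventually_analyticAt]
      with x hx hkx hbx
    have h1 : HasDerivAt (fun x => 2 * hbar * k x + (x - c) * b x - a)
        (2 * hbar * deriv k x + (1 * b x + (x - c) * deriv b x)) x :=
      (((hkx.differentiableAt.hasDerivAt).const_mul _).add
        (((hasDerivAt_id x).sub_const c).mul hbx.differentiableAt.hasDerivAt)).sub_const a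
    have h2 := h1.congr_of_eventuallyEq (hx.mono fun y hy => hy.symm)
    rw [← one_mul (b x)]
    exact h2.unique (hasDerivAt_const x 0)
  have hE2 : 2 * hbar * deriv (deriv k) c + (deriv b c + (1 * deriv b c +
      (c - c) * deriv (deriv b) c)) = 0 := by
    have h1 : HasDerivAt (fun x => 2 * hbar * deriv k x + (b x + (x - c) * deriv b x))
        (2 * hbar * deriv (deriv k) c + (deriv b c + (1 * deriv b c +
          (c - c) * deriv (deriv b) c))) c :=
      (hk.deriv.differentiableAt.hasDerivAt.const_mul _).add
        (hbA.differentiableAt.hasDerivAt.add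
          (((hasDerivAt_id c).sub_const c).mul hbA.deriv.differentiableAt.hasDerivAt))
    exact (h1.congr_of_eventuallyEq (hE1.mono fun y hy => hy.symm)).unique (hasDerivAt_const c 0)
  have hb' : deriv b c = deriv ρ c * k c + ρ c * deriv k c - hbar * deriv (deriv k) c
      - deriv g c :=
    (((hρ.differentiableAt.hasDerivAt.mul hk.differentiableAt.hasDerivAt).sub
      (hk.deriv.differentiableAt.hasDerivAt.const_mul _)).sub
        hg.differentiableAt.hasDerivAt).deriv
  have e0 := hE.self_of_nhds
  have e1 := hE1.self_of_nhds
  have e2 : b c = ρ c * k c - hbar * deriv k c - g c := rfl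
  refine ⟨by linear_combination e0, by linear_combination e1 - e2, ?_⟩
  -- The resonance: the contributions of the second derivative of `k` cancel, leaving a solvability
  -- condition on the data.
  linear_combination (1 / 2) * hE2 - hb'

section Kernel

variable {dV : RatFunc ℂ} {G K : ℂ → ℂ → ℂ}

theorem IsKernelPair.ode_regularPart (h : IsKernelPair hbar dV s G K) {x₀ : ℂ}
    (hx₀ : x₀ ∉ Set.range s) (i : Fin m) : ∀ᶠ x in 𝓝[≠] (s i),
      (2 * hbar * (x - s i)⁻¹ + regularPart hbar s (fun x => dV.eval (RingHom.id ℂ) x) i x)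
        * K x₀ x - hbar * deriv (K x₀) x = G x₀ x :=
  (h.ode x₀ hx₀ i).mono fun x hx => by
    rwa [two_hbar_mul_sum_inv (fun x => dV.eval (RingHom.id ℂ) x) i x] at hx

/-- Because `K` is analytic at `s i`, the only pole of the left side of the differential equation
there is that of `2ħ/(x - s i)`. This determines the residue of `G`, and decay at infinity excludes
a polynomial part. -/
theorem IsKernelPair.eq_sum (h : IsKernelPair hbar dV s G K) (hs : Function.Injective s)
    (hdV : ∀ i, dV.denom.eval (s i) ≠ 0) {x₀ x : ℂ} (hx₀ : x₀ ∉ Set.range s)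
    (hx : x ∉ Set.range s) (hne : x ≠ x₀) :
    G x₀ x = (x - x₀)⁻¹ + ∑ i, 2 * hbar * K x₀ (s i) * (x - s i)⁻¹ := by
  classical
  have hxs : x₀ ∉ Finset.univ.image s := by simpa using hx₀
  have hS : ∀ y, y ∈ insert x₀ (Finset.univ.image s) ↔ y ∈ insert x₀ (Set.range s) := by simp
  have key := eq_sum_of_simple_poles (S := insert x₀ (Finset.univ.image s)) (f := G x₀)
    (c := Function.update (fun p => 2 * hbar * K x₀ p) x₀ 1) (x := x) ?_ ?_ ?_ ?_
  · rw [key, Finset.sum_insert hxs, Finset.sum_image hs.injOn, Function.update_self, one_mul]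
    congr 1
    refine Finset.sum_congr rfl fun i _ => ?_
    rw [Function.update_of_ne fun e => hx₀ ⟨i, e⟩]
  · intro y hy
    exact (h.rational_right x₀ hx₀).analyticAt ((Set.finite_range s).insert x₀)
      fun e => hy ((hS y).2 e)
  · intro p hp
    rw [Finset.mem_insert] at hp
    rcases hp with rfl | hp
    · rw [Function.update_self]
      exact h.pole_right p hx₀
    · obtain ⟨i, -, rfl⟩ := Finset.mem_image.1 hp
      rw [Function.update_of_ne fun e => hx₀ ⟨i, e⟩]
      have hK := h.analytic x₀ hx₀ i
      have hρ := analyticAt_regularPart (hbar := hbar) hs (analyticAt_ratFunc_eval dV (hdV i))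
      have hc : ContinuousAt (fun x => 2 * hbar * K x₀ x + (x - s i) *
          (regularPart hbar s (fun x => dV.eval (RingHom.id ℂ) x) i x * K x₀ x
            - hbar * deriv (K x₀) x)) (s i) :=
        ((analyticAt_const.mul hK).add ((analyticAt_id.sub analyticAt_const).mul
          ((hρ.mul hK).sub (analyticAt_const.mul hK.deriv)))).continuousAt
      have hc' := hc.tendsto.mono_left (nhdsWithin_le_nhds (s := {s i}ᶜ))
      rw [sub_self, zero_mul, add_zero] at hc'
      refine hc'.congr' ?_
      filter_upwards [h.ode_regularPart hx₀ i, self_mem_nhdsWithin] with y hy hyc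
      have h1 : (y - s i)⁻¹ * (y - s i) = 1 := inv_mul_cancel₀ (sub_ne_zero.2 hyc)
      rw [← hy]
      linear_combination (-2 * hbar * K x₀ y) * h1
  · exact (h.infty_right x₀ hx₀).trans_tendsto tendsto_inv₀_cobounded
  · rw [hS]
    rintro (e | e)
    exacts [hne e, hx e]

theorem hasDerivAt_inv_sub {x c : ℂ} (h : x - c ≠ 0) :
    HasDerivAt (fun x => (x - c)⁻¹) (-((x - c) ^ 2)⁻¹) x := by
  simpa using hasDerivAt_inv_sub_pow h 0

theorem IsKernelPair.bergman_eq (h : IsKernelPair hbar dV s G K) (hs : Function.Injective s)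
    (hdV : ∀ i, dV.denom.eval (s i) ≠ 0) {x₀ x : ℂ} (hx₀ : x₀ ∉ Set.range s)
    (hx : x ∉ Set.range s) (hne : x ≠ x₀) :
    bergman G x₀ x
      = 1 / 2 * (((x - x₀) ^ 2)⁻¹ + ∑ i, 2 * hbar * K x₀ (s i) * ((x - s i) ^ 2)⁻¹) := by
  have h1 : G x₀ =ᶠ[𝓝 x] fun x => (x - x₀)⁻¹ + ∑ i, 2 * hbar * K x₀ (s i) * (x - s i)⁻¹ := by
    filter_upwards [(Set.finite_range s).isClosed.isOpen_compl.mem_nhds hx,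
      isOpen_ne.mem_nhds hne] with y h1 h2
    exact h.eq_sum hs hdV hx₀ h1 h2
  have h2 : HasDerivAt (fun x => (x - x₀)⁻¹ + ∑ i, 2 * hbar * K x₀ (s i) * (x - s i)⁻¹)
      (-((x - x₀) ^ 2)⁻¹ + ∑ i, 2 * hbar * K x₀ (s i) * -((x - s i) ^ 2)⁻¹) x :=
    (hasDerivAt_inv_sub (sub_ne_zero.2 hne)).add (HasDerivAt.fun_sum fun i _ =>
      (hasDerivAt_inv_sub (sub_ne_zero_of_notMem hx i)).const_mul _)
  rw [bergman, h1.deriv_eq, h2.deriv]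
  simp only [mul_neg, Finset.sum_neg_distrib]
  ring

/-- The double pole of `B` on the diagonal is itself symmetric and drops out of the symmetry
condition. -/
theorem IsKernelPair.sum_symm (h : IsKernelPair hbar dV s G K) (hs : Function.Injective s)
    (hdV : ∀ i, dV.denom.eval (s i) ≠ 0) {x₀ x : ℂ} (hx₀ : x₀ ∉ Set.range s)
    (hx : x ∉ Set.range s) :
    ∑ i, 2 * hbar * K x₀ (s i) * ((x - s i) ^ 2)⁻¹
      = ∑ i, 2 * hbar * K x (s i) * ((x₀ - s i) ^ 2)⁻¹ := by
  rcases eq_or_ne x x₀ with rfl | hne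
  · rfl
  · have h1 := h.bergman_symm x₀ x hx₀ hx hne.symm
    rw [h.bergman_eq hs hdV hx₀ hx hne, h.bergman_eq hs hdV hx hx₀ hne.symm, ← neg_sub x x₀,
      neg_sq] at h1
    linear_combination 2 * h1

/-- For `u = ((x - sᵢ)⁻²)ᵢ` the symmetry relation expresses the pairing of `2ħK(x₀, sᵢ)` with `u`
through the functions `(x₀ - sⱼ)⁻²`. Such vectors span, so the same holds for the coordinate
vectors. -/
theorem IsKernelPair.exists_matrix (h : IsKernelPair hbar dV s G K) (hs : Function.Injective s)
    (hdV : ∀ i, dV.denom.eval (s i) ≠ 0) : ∃ C : Matrix (Fin m) (Fin m) ℂ, ∀ x₀ ∉ Set.range s,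
      ∀ i, 2 * hbar * K x₀ (s i) = ∑ j, C i j * ((x₀ - s j) ^ 2)⁻¹ := by
  have key : ∀ u : Fin m → ℂ, ∃ b : Fin m → ℂ, ∀ x₀ ∉ Set.range s,
      ∑ i, 2 * hbar * K x₀ (s i) * u i = ∑ j, b j * ((x₀ - s j) ^ 2)⁻¹ := by
    intro u
    have hu : u ∈ Submodule.span ℂ
        ((fun x i => ((x - s i) ^ 2)⁻¹ : ℂ → Fin m → ℂ) '' (Set.range s)ᶜ) := by
      rw [span_inv_sq_eq_top hs]; trivial
    induction hu using Submodule.span_induction with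
    | mem u hu =>
      obtain ⟨x, hx, rfl⟩ := hu
      exact ⟨fun i => 2 * hbar * K x (s i), fun x₀ hx₀ => h.sum_symm hs hdV hx₀ hx⟩
    | zero => exact ⟨0, fun x₀ _ => by simp⟩
    | add u v _ _ h1 h2 =>
      obtain ⟨b, hb⟩ := h1
      obtain ⟨c, hc⟩ := h2
      refine ⟨b + c, fun x₀ hx₀ => ?_⟩
      simp only [Pi.add_apply, mul_add, add_mul, Finset.sum_add_distrib, hb x₀ hx₀, hc x₀ hx₀]
    | smul c u _ h1 =>
      obtain ⟨b, hb⟩ := h1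
      refine ⟨c • b, fun x₀ hx₀ => ?_⟩
      simp only [Pi.smul_apply, smul_eq_mul, mul_left_comm _ c, mul_assoc c, ← Finset.mul_sum,
        hb x₀ hx₀]
  choose C hC using fun i => key (Pi.single i 1)
  refine ⟨Matrix.of C, fun x₀ hx₀ i => ?_⟩
  simpa [Pi.single_apply] using hC i x₀ hx₀

/-- The expansion of the kernel equation at `sᵢ` to second order. -/
theorem IsKernelPair.expansion (h : IsKernelPair hbar dV s G K) (hs : Function.Injective s)
    (hdV : ∀ i, dV.denom.eval (s i) ≠ 0) {x₀ : ℂ} (hx₀ : x₀ ∉ Set.range s) (i : Fin m) {ρ : ℂ → ℂ}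
    (hρ : ρ = regularPart hbar s (fun x => dV.eval (RingHom.id ℂ) x) i) :
    hbar * deriv (K x₀) (s i) + ρ (s i) * K x₀ (s i) = (s i - x₀)⁻¹
        + ∑ j ∈ Finset.univ.erase i, 2 * hbar * K x₀ (s j) * (s i - s j)⁻¹ ∧
      deriv ρ (s i) * K x₀ (s i) + ρ (s i) * deriv (K x₀) (s i) = -((s i - x₀) ^ 2)⁻¹
        - ∑ j ∈ Finset.univ.erase i, 2 * hbar * K x₀ (s j) * ((s i - s j) ^ 2)⁻¹ := by
  have hne : s i - x₀ ≠ 0 := sub_ne_zero.2 fun e => hx₀ ⟨i, e⟩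
  have hg : AnalyticAt ℂ (fun x => (x - x₀)⁻¹
      + ∑ j ∈ Finset.univ.erase i, 2 * hbar * K x₀ (s j) * (x - s j)⁻¹) (s i) :=
    ((analyticAt_id.sub analyticAt_const).inv hne).add (Finset.analyticAt_fun_sum _ fun j hj =>
      analyticAt_const.mul (analyticAt_inv_sub_of_ne hs (Finset.ne_of_mem_erase hj)))
  have hd : HasDerivAt (fun x => (x - x₀)⁻¹
      + ∑ j ∈ Finset.univ.erase i, 2 * hbar * K x₀ (s j) * (x - s j)⁻¹)
      (-((s i - x₀) ^ 2)⁻¹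
        + ∑ j ∈ Finset.univ.erase i, 2 * hbar * K x₀ (s j) * -((s i - s j) ^ 2)⁻¹) (s i) :=
    (hasDerivAt_inv_sub hne).add (HasDerivAt.fun_sum fun j hj => (hasDerivAt_inv_sub
      (sub_ne_zero.2 (hs.ne (Finset.ne_of_mem_erase hj).symm))).const_mul _)
  have h1 := ode_expansion (hbar := hbar) (a := 2 * hbar * K x₀ (s i)) (h.analytic x₀ hx₀ i)
    (analyticAt_regularPart (hbar := hbar) hs (analyticAt_ratFunc_eval dV (hdV i))) hg ?_
  · rw [hd.deriv, ← hρ] at h1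
    refine ⟨h1.2.1, h1.2.2.trans ?_⟩
    simp only [mul_neg, Finset.sum_neg_distrib]
    ring
  · have hx : ∀ᶠ x in 𝓝[≠] (s i), x ≠ x₀ :=
      (continuousAt_id.eventually_ne (sub_ne_zero.1 hne)).filter_mono nhdsWithin_le_nhds
    filter_upwards [h.ode_regularPart hx₀ i, eventually_notMem_range hs i, hx] with x h1 h2 h3
    rw [h1, h.eq_sum hs hdV hx₀ h2 h3, ← Finset.add_sum_erase _ _ (Finset.mem_univ i)]
    ring

/-- The potential is critical at the points `sᵢ`, and its Hessian is inverse to the polar part of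
the kernel. -/
theorem IsKernelPair.exists_covariance (h : IsKernelPair hbar dV s G K) (hbar_ne : hbar ≠ 0)
    (hs : Function.Injective s) (hdV : ∀ i, dV.denom.eval (s i) ≠ 0) :
    (∀ i, regularPart hbar s (fun x => dV.eval (RingHom.id ℂ) x) i (s i) = 0) ∧
    ∃ C : Matrix (Fin m) (Fin m) ℂ, ∀ i k,
      deriv (regularPart hbar s (fun x => dV.eval (RingHom.id ℂ) x) i) (s i) * C i k
        + ∑ j ∈ Finset.univ.erase i, 2 * hbar * ((s i - s j) ^ 2)⁻¹ * C j k
        = if i = k then -(2 * hbar) else 0 := by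
  obtain ⟨C, hC⟩ := h.exists_matrix hs hdV
  have key : ∀ i, _ := fun i => by
    set ρ := regularPart hbar s (fun x => dV.eval (RingHom.id ℂ) x) i with hρ
    -- Eliminating the derivative of `K` between the two relations of `expansion`, and substituting
    -- `C` for `K`, gives a relation in `x₀` between the `(x₀ - sₖ)⁻²` and `(x₀ - sᵢ)⁻¹`. These `α`
    -- and `β` are its coefficients: `β = 0` gives criticality, and then `α = 0` gives the matrix
    -- identity.
    exact eq_zero_of_sum_inv_sq hs
      (α := fun k => (if i = k then 2 * hbar else 0)
        + ∑ j ∈ Finset.univ.erase i, 2 * hbar * ((s i - s j) ^ 2)⁻¹ * C j k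
        + deriv ρ (s i) * C i k + 2 * ρ (s i) * ∑ j ∈ Finset.univ.erase i, (s i - s j)⁻¹ * C j k
        - ρ (s i) ^ 2 * hbar⁻¹ * C i k)
      (β := -2 * ρ (s i)) i fun x hx => by
        obtain ⟨h1, h2⟩ := h.expansion hs hdV hx i hρ
        have h3 : ∀ a : Fin m → ℂ, ∑ k, (∑ j ∈ Finset.univ.erase i, a j * C j k)
            * ((x - s k) ^ 2)⁻¹ = ∑ j ∈ Finset.univ.erase i, 2 * hbar * K x (s j) * a j := by
          intro a
          simp only [Finset.sum_mul]
          rw [Finset.sum_comm]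
          refine Finset.sum_congr rfl fun j _ => ?_
          rw [hC x hx j, Finset.sum_mul]
          exact Finset.sum_congr rfl fun k _ => by ring
        have h4 := h3 fun j => 2 * hbar * ((s i - s j) ^ 2)⁻¹
        have h5 := h3 fun j => (s i - s j)⁻¹
        have h6 : ∑ k, (if i = k then 2 * hbar else 0) * ((x - s k) ^ 2)⁻¹
            = 2 * hbar * ((s i - x) ^ 2)⁻¹ := by
          rw [← neg_sub x, neg_sq]; simp
        have h7 : (x - s i)⁻¹ = -(s i - x)⁻¹ := by rw [← neg_sub, inv_neg]
        have h8 : ∑ j ∈ Finset.univ.erase i, 2 * hbar * K x (s j) *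
            (2 * hbar * ((s i - s j) ^ 2)⁻¹) = 2 * hbar * ∑ j ∈ Finset.univ.erase i,
              2 * hbar * K x (s j) * ((s i - s j) ^ 2)⁻¹ := by
          rw [Finset.mul_sum]; exact Finset.sum_congr rfl fun j _ => by ring
        have h9 := hC x hx i
        simp only [add_mul, sub_mul, Finset.sum_add_distrib, Finset.sum_sub_distrib]
        rw [h6, h4, h8]
        simp only [mul_assoc _ (C i _), mul_assoc _ (∑ j ∈ Finset.univ.erase i, _) (_ ^ 2)⁻¹,
          ← Finset.mul_sum]
        rw [← h9, h5, h7]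
        have hb : hbar⁻¹ * hbar = 1 := inv_mul_cancel₀ hbar_ne
        linear_combination 2 * hbar * h2 - 2 * ρ (s i) * h1 - 2 * ρ (s i) ^ 2 * K x (s i) * hb
  have hρ0 : ∀ i, regularPart hbar s (fun x => dV.eval (RingHom.id ℂ) x) i (s i) = 0 := fun i => by
    simpa using (key i).2
  refine ⟨hρ0, C, fun i k => ?_⟩
  have h1 := (key i).1 k
  simp only [hρ0 i] at h1
  split_ifs at h1 ⊢ <;> linear_combination h1

end Kernel

end QuantumTR

end

/-! ### From a kernel pair to a solution of the loop equations -/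

noncomputable section

namespace QuantumTR

open MvPowerSeries

theorem IsTaylorAt.hasDerivAt {f : ℂ → ℂ} {c : ℂ} {v : PowerSeries ℂ} (h : IsTaylorAt f c v) :
    f c = PowerSeries.constantCoeff v ∧ HasDerivAt f (PowerSeries.coeff 1 v) c := by
  obtain ⟨g, hg, he⟩ := h 2
  refine ⟨by simpa [Finset.sum_range_succ] using he c, ?_⟩
  have h1 : f = fun x => ∑ j ∈ Finset.range 2, PowerSeries.coeff j v * (x - c) ^ j
      + (x - c) ^ 2 * g x := funext he
  rw [h1]
  have h2 : HasDerivAt (fun x => x - c) 1 c := (hasDerivAt_id c).sub_const c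
  have h3 := (HasDerivAt.fun_sum fun j (_ : j ∈ Finset.range 2) =>
    (h2.fun_pow j).const_mul (PowerSeries.coeff j v)).add
      ((h2.fun_pow 2).mul hg.differentiableAt.hasDerivAt)
  refine h3.congr_deriv ?_
  simp [Finset.sum_range_succ]

variable {m : ℕ} {s : Fin m → ℂ} {hbar : ℂ} {dV : RatFunc ℂ} {G K : ℂ → ℂ → ℂ}

theorem deriv_regularPart (hs : Function.Injective s) {f : ℂ → ℂ} {i : Fin m}
    (hf : DifferentiableAt ℂ f (s i)) : deriv (regularPart hbar s f i) (s i)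
      = -(2 * hbar * ∑ j ∈ Finset.univ.erase i, ((s i - s j) ^ 2)⁻¹) - deriv f (s i) := by
  have : HasDerivAt (regularPart hbar s f i)
      (2 * hbar * ∑ j ∈ Finset.univ.erase i, -((s i - s j) ^ 2)⁻¹ - deriv f (s i)) (s i) :=
    ((HasDerivAt.fun_sum fun j hj => hasDerivAt_inv_sub (sub_ne_zero.2
      (hs.ne (Finset.ne_of_mem_erase hj).symm))).const_mul _).sub hf.hasDerivAt
  rw [this.deriv, Finset.sum_neg_distrib, mul_neg]

/-- Vanishing of the regular part at `sᵢ` is criticality of the action, and up to sign its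
derivative and the off-diagonal terms form the Hessian, so the covariance is `C / (2ħ)`. -/
theorem IsKernelPair.exists_isLoopSolution (h : IsKernelPair hbar dV s G K) (hbar_ne : hbar ≠ 0)
    (hs : Function.Injective s) (hdV : ∀ i, dV.denom.eval (s i) ≠ 0) :
    ∃ w, IsLoopSolution hbar s (fun x => dV.eval (RingHom.id ℂ) x) w := by
  set f : ℂ → ℂ := fun x => dV.eval (RingHom.id ℂ) x with hf
  choose v hv using fun i => AnalyticAt.exists_isTaylorAt (analyticAt_ratFunc_eval dV (hdV i))
  obtain ⟨h0, C, hC⟩ := h.exists_covariance hbar_ne hs hdV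
  rw [← hf] at h0 hC
  have hdiff : ∀ i, DifferentiableAt ℂ f (s i) := fun i =>
    (analyticAt_ratFunc_eval dV (hdV i)).differentiableAt
  -- The action sums over all `j`, the regular part over `j ≠ i`; the convention `0⁻¹ = 0`
  -- reconciles the two.
  have hsum : ∀ i, ∀ a : ℂ → ℂ, a 0 = 0 →
      ∑ j ∈ Finset.univ.erase i, a (s i - s j) = ∑ j, a (s i - s j) := fun i a ha => by
    rw [← Finset.add_sum_erase _ _ (Finset.mem_univ i), sub_self, ha, zero_add]
  refine QuantumTR.exists_isLoopSolution hbar_ne hs hv (fun i => ?_)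
    (Cov := (2 * hbar)⁻¹ • C) ?_
  · rw [constantCoeff_actionGrad, ← (hv i).hasDerivAt.1]
    have h1 := h0 i
    rw [regularPart, hsum i (fun z => z⁻¹) inv_zero] at h1
    rw [← Finset.mul_sum]
    linear_combination -h1
  · rw [mul_smul_comm, inv_smul_eq_iff₀ (mul_ne_zero two_ne_zero hbar_ne)]
    ext i k
    rw [Matrix.mul_apply, ← Finset.add_sum_erase _ _ (Finset.mem_univ i)]
    have h1 := hC i k
    rw [deriv_regularPart hs (hdiff i), hsum i (fun z => (z ^ 2)⁻¹) (by simp),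
      (hv i).hasDerivAt.2.deriv] at h1
    have h2 : ∑ j ∈ Finset.univ.erase i, (Matrix.of fun i j =>
        constantCoeff (pderiv ℂ j (actionGrad s hbar v i))) i j * C j k
        = -∑ j ∈ Finset.univ.erase i, 2 * hbar * ((s i - s j) ^ 2)⁻¹ * C j k := by
      rw [← Finset.sum_neg_distrib]
      refine Finset.sum_congr rfl fun j hj => ?_
      rw [Matrix.of_apply, hessian_of_ne s hbar v (Finset.ne_of_mem_erase hj).symm, inv_pow]
      ring
    rw [h2, Matrix.of_apply, hessian_self]
    simp only [inv_pow, Matrix.smul_apply, Matrix.one_apply, smul_eq_mul, mul_ite, mul_one,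
      mul_zero]
    split_ifs at h1 ⊢ <;> linear_combination -h1

end QuantumTR

end

/-! ### Combinatorics of the bracket, and the two-point function -/

noncomputable section

namespace QuantumTR

section Combinatorics

/-- Multiset splittings are counted with multiplicity, so they correspond to subsets of indices even
when points coincide. -/
theorem sum_antidiagonal_map {κ X R : Type*} [DecidableEq κ] [AddCommMonoid R] (J : κ → X)
    (S : Finset κ) (F : Multiset X × Multiset X → R) :
    ((S.val.map J).antidiagonal.map F).sum
      = ∑ I ∈ S.powerset, F (I.val.map J, (S \ I).val.map J) := by
  induction S using Finset.induction_on generalizing F with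
  | empty => simp
  | insert k S hk ih =>
    rw [Finset.insert_val_of_notMem hk, Multiset.map_cons, Multiset.antidiagonal_cons,
      Multiset.map_add, Multiset.sum_add, Multiset.map_map, Multiset.map_map, ih, ih,
      Finset.sum_powerset_insert hk]
    congr 1
    · refine Finset.sum_congr rfl fun I hI => ?_
      have hkI : k ∉ I := fun h => hk (Finset.mem_powerset.1 hI h)
      rw [Finset.insert_sdiff_of_notMem _ hkI,
        Finset.insert_val_of_notMem fun h => hk (Finset.mem_sdiff.1 h).1]
      simp
    · refine Finset.sum_congr rfl fun I hI => ?_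
      have hkI : k ∉ I := fun h => hk (Finset.mem_powerset.1 hI h)
      have : insert k S \ insert k I = S \ I := by
        rw [Finset.insert_sdiff_insert, Finset.sdiff_insert_of_notMem hk]
      rw [this, Finset.insert_val_of_notMem hkI]
      simp

/-- Divisibility removes the low-order terms, so the coefficients of a product become a convolution
in the genus. -/
theorem coeff_mul_of_dvd {R : Type*} [CommRing R] {p q : PowerSeries R} {a b : ℕ}
    (hp : PowerSeries.X ^ a ∣ p) (hq : PowerSeries.X ^ b ∣ q) (g : ℕ) :
    PowerSeries.coeff (g + (a + b)) (p * q) = ∑ h ∈ Finset.range (g + 1),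
      PowerSeries.coeff (h + a) p * PowerSeries.coeff (g - h + b) q := by
  obtain ⟨p, rfl⟩ := hp
  obtain ⟨q, rfl⟩ := hq
  rw [mul_mul_mul_comm, ← pow_add, PowerSeries.coeff_X_pow_mul, PowerSeries.coeff_mul,
    Finset.Nat.sum_antidiagonal_eq_sum_range_succ fun i j =>
      PowerSeries.coeff i p * PowerSeries.coeff j q]
  simp only [PowerSeries.coeff_X_pow_mul]

theorem sum_range_sum_compl {κ R : Type*} [Fintype κ] [DecidableEq κ] [AddCommMonoid R] (g : ℕ)
    (F : ℕ → Finset κ → R) : ∑ h ∈ Finset.range (g + 1), ∑ I, F (g - h) Iᶜ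
      = ∑ h ∈ Finset.range (g + 1), ∑ I, F h I := by
  rw [Finset.sum_flip fun h => ∑ I, F h Iᶜ]
  exact Finset.sum_congr rfl fun h _ =>
    Equiv.sum_comp (Function.Involutive.toPerm compl compl_involutive) (F h)

/-- Here `q` is the double pole by which `W₂⁽⁰⁾` differs from the cumulant. The omitted pairs give
the term with the one-point function, and the two cross terms coincide under `(h, I) ↦ (g - h, Iᶜ)`.
-/
theorem sum_filter_mul_eq {g n : ℕ} (hgn : 2 ≤ 2 * g + n) (a q : ℕ → Finset (Fin n) → ℂ)
    (b : Fin n → ℂ) (hq : ∀ h I, q h I = ∑ k, if h = 0 then if I = {k} then b k else 0 else 0) :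
    ∑ h ∈ Finset.range (g + 1),
      ∑ I : Finset (Fin n) with (h, I) ≠ (0, ∅) ∧ (h, I) ≠ (g, Finset.univ),
        (a h I + q h I) * (a (g - h) Iᶜ + q (g - h) Iᶜ)
    = ∑ h ∈ Finset.range (g + 1), ∑ I, a h I * a (g - h) Iᶜ + ∑ k, 2 * b k * a g {k}ᶜ
      + ∑ h ∈ Finset.range (g + 1), ∑ I, q h I * q (g - h) Iᶜ
      - 2 * a 0 ∅ * a g Finset.univ := by
  have q0 : q 0 ∅ = 0 := by
    rw [hq]
    exact Finset.sum_eq_zero fun k _ => by rw [if_pos rfl, if_neg (by simp)]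
  have qg : q g Finset.univ = 0 := by
    rw [hq]
    refine Finset.sum_eq_zero fun k _ => ?_
    split_ifs with h1 h2
    · have := congrArg Finset.card h2
      simp only [Finset.card_univ, Fintype.card_fin, Finset.card_singleton] at this
      omega
    · rfl
    · rfl
  have hne : ((0 : ℕ), (∅ : Finset (Fin n))) ≠ (g, Finset.univ) := by
    intro h
    rw [Prod.mk.injEq] at h
    have := congrArg Finset.card h.2
    simp only [Finset.card_univ, Fintype.card_fin, Finset.card_empty] at this
    omega
  have single : ∀ (T : ℕ → Finset (Fin n) → ℂ) (h₀ : ℕ) (I₀ : Finset (Fin n)), h₀ ≤ g →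
      ∑ h ∈ Finset.range (g + 1), ∑ I, (if (h, I) = (h₀, I₀) then T h I else 0) = T h₀ I₀ := by
    intro T h₀ I₀ hh
    rw [Finset.sum_eq_single_of_mem h₀ (Finset.mem_range.2 (by omega)),
      Finset.sum_eq_single_of_mem I₀ (Finset.mem_univ _), if_pos rfl]
    · intro I _ hI
      rw [if_neg]
      simp [hI]
    · intro h _ hh
      exact Finset.sum_eq_zero fun I _ => by rw [if_neg]; simp [hh]
  have hfilter : ∀ T : ℕ → Finset (Fin n) → ℂ, ∑ h ∈ Finset.range (g + 1),
      ∑ I : Finset (Fin n) with (h, I) ≠ (0, ∅) ∧ (h, I) ≠ (g, Finset.univ), T h I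
      = ∑ h ∈ Finset.range (g + 1), ∑ I, T h I - T 0 ∅ - T g Finset.univ := by
    intro T
    rw [← single T 0 ∅ (Nat.zero_le _), ← single T g Finset.univ le_rfl,
      ← Finset.sum_sub_distrib, ← Finset.sum_sub_distrib]
    refine Finset.sum_congr rfl fun h _ => ?_
    rw [← Finset.sum_sub_distrib, ← Finset.sum_sub_distrib, Finset.sum_filter]
    refine Finset.sum_congr rfl fun I _ => ?_
    by_cases h1 : (h, I) = (0, ∅)
    · simp only [h1, ne_eq, not_true_eq_false, false_and, if_false, if_true]
      rw [if_neg hne]; ring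
    · by_cases h2 : (h, I) = (g, Finset.univ)
      · rw [if_neg (fun h => h.2 h2), if_neg h1, if_pos h2]; ring
      · rw [if_pos ⟨h1, h2⟩, if_neg h1, if_neg h2]; ring
  have cross : ∑ h ∈ Finset.range (g + 1), ∑ I, q h I * a (g - h) Iᶜ = ∑ k, b k * a g {k}ᶜ := by
    rw [Finset.sum_eq_single_of_mem 0 (Finset.mem_range.2 (by omega))]
    · simp only [hq, if_true, Finset.sum_mul, ite_mul, zero_mul, Nat.sub_zero]
      rw [Finset.sum_comm]
      simp
    · intro h _ hh
      simp [hq, hh]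
  have cross' : ∑ h ∈ Finset.range (g + 1), ∑ I, a h I * q (g - h) Iᶜ = ∑ k, b k * a g {k}ᶜ := by
    rw [← cross, ← sum_range_sum_compl]
    refine Finset.sum_congr rfl fun h hh => Finset.sum_congr rfl fun I _ => ?_
    rw [compl_compl, Nat.sub_sub_self (Nat.lt_succ_iff.1 (Finset.mem_range.1 hh)), mul_comm]
  rw [hfilter fun h I => (a h I + q h I) * (a (g - h) Iᶜ + q (g - h) Iᶜ)]
  simp only [add_mul, mul_add, Finset.sum_add_distrib, cross, cross', q0, qg, Nat.sub_zero,
    Nat.sub_self, Finset.compl_empty, Finset.compl_univ, mul_assoc, ← Finset.mul_sum]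
  ring

theorem map_pick {n : ℕ} (J : Fin n → ℂ) (I : Finset (Fin n)) :
    Finset.univ.val.map (pick J I) = I.val.map J := by
  have h1 : (Finset.univ : Finset (Fin I.card)).map (I.orderEmbOfFin rfl).toEmbedding = I := by
    ext k
    simp
  conv_rhs => rw [← h1, Finset.map_val, Multiset.map_map]
  rfl

theorem map_finCons {n : ℕ} (x : ℂ) (J : Fin n → ℂ) :
    Finset.univ.val.map (Fin.cons x J : Fin (n + 1) → ℂ) = x ::ₘ Finset.univ.val.map J := by
  rw [Fin.univ_succ, Finset.cons_val, Multiset.map_cons, Finset.map_val, Multiset.map_map]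
  rfl

end Combinatorics

variable {m : ℕ} {s : Fin m → ℂ} {hbar : ℂ} {dV : RatFunc ℂ} {G K : ℂ → ℂ → ℂ}

theorem IsKernelPair.sum_residue (h : IsKernelPair hbar dV s G K) (hs : Function.Injective s)
    (hdV : ∀ i, dV.denom.eval (s i) ≠ 0) {x₀ : ℂ} (hx₀ : x₀ ∉ Set.range s) {w : ℂ → ℂ}
    (hw : w ∈ polarSpace s) {F : ℂ → ℂ} (hF : ∀ i, ∃ g, AnalyticAt ℂ g (s i) ∧
      ∀ᶠ x in 𝓝[≠] (s i), F x + ((2 * hbar * ∑ j, 1 / (x - s j) - dV.eval (RingHom.id ℂ) x) * w x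
        + hbar * deriv w x) = g x) :
    ∑ i, residue (fun x => K x₀ x * F x) (s i) = w x₀ := by
  refine sum_residue_eq (A := fun i => 2 * hbar * K x₀ (s i)) hs hx₀ (h.analytic x₀ hx₀)
    (fun i => ?_) hw hF
  have hx : ∀ᶠ x in 𝓝[≠] (s i), x ≠ x₀ :=
    (continuousAt_id.eventually_ne fun e => hx₀ ⟨i, e⟩).filter_mono nhdsWithin_le_nhds
  filter_upwards [h.ode x₀ hx₀ i, eventually_notMem_range hs i, hx] with x h1 h2 h3
  rw [h1, h.eq_sum hs hdV hx₀ h2 h3]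

theorem analyticAt_dslope {f : ℂ → ℂ} {a : ℂ} (hf : AnalyticAt ℂ f a) :
    AnalyticAt ℂ (dslope f a) a := by
  obtain ⟨p, hp⟩ := hf
  exact ⟨_, hp.has_fpower_series_dslope_fslope⟩

/-- The two-point function. -/
theorem IsKernelPair.coeff_one_singleton (h : IsKernelPair hbar dV s G K) (hbar_ne : hbar ≠ 0)
    (hs : Function.Injective s) (hdV : ∀ i, dV.denom.eval (s i) ≠ 0)
    {w : ℂ → Multiset ℂ → PowerSeries ℂ}
    (hw : IsLoopSolution hbar s (fun x => dV.eval (RingHom.id ℂ) x) w) {x y : ℂ}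
    (hx : x ∉ Set.range s) (hy : y ∉ Set.range s) :
    PowerSeries.coeff 1 (w x {y})
      = 1 / 2 * ∑ i, 2 * hbar * K y (s i) * ((x - s i) ^ 2)⁻¹ := by
  set f : ℂ → ℂ := fun x => dV.eval (RingHom.id ℂ) x with hf
  have mem : (fun x => 1 / 2 * ∑ i, 2 * hbar * K y (s i) * ((x - s i) ^ 2)⁻¹) ∈ polarSpace s := by
    have : (fun x => 1 / 2 * ∑ i, 2 * hbar * K y (s i) * ((x - s i) ^ 2)⁻¹)
        = ∑ i, (1 / 2 * (2 * hbar * K y (s i))) • fun x : ℂ => ((x - s i) ^ (1 + 1))⁻¹ := by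
      funext x
      simp [Finset.mul_sum, mul_assoc]
    rw [this]
    exact Submodule.sum_mem _ fun i _ => Submodule.smul_mem _ _ (Submodule.subset_span ⟨(i, 1), rfl⟩)
  -- Both sides lie in `polarSpace s` and solve the same linear equation modulo regular functions,
  -- so the kernel recovers both from the same source `F`.
  refine (h.sum_residue hs hdV hx (hw.mem_polarSpace {y} 1)
    (F := fun x => hbar * (x - y)⁻¹ ^ 2 * ∑ j, 1 / (x - s j)) fun i => ?_).symm.trans
    (h.sum_residue hs hdV hx mem fun i => ?_)
  · obtain ⟨g, hg, he⟩ := hw.loop {y} (by simpa using hy) 1 i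
    refine ⟨g, hg, he.mono fun x hx => ?_⟩
    rw [← hx]
    have e1 : PowerSeries.coeff 1 (w x (x ::ₘ {y})) = 0 := by
      refine PowerSeries.X_pow_dvd_iff.1 (hw.dvd x _) 1 ?_
      simp
    have e2 : PowerSeries.coeff 0 (w x {y}) = 0 :=
      PowerSeries.X_pow_dvd_iff.1 (hw.dvd x _) 0 (by simp)
    have e3 : PowerSeries.coeff 1 (w x 0 * w x {y})
        = hbar * ∑ i, 1 / (x - s i) * PowerSeries.coeff 1 (w x {y}) := by
      rw [PowerSeries.coeff_mul, Finset.Nat.antidiagonal_succ]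
      simp only [Finset.Nat.antidiagonal_zero, Finset.map_singleton, Finset.sum_cons,
        Finset.sum_singleton]
      simp [e2, hw.zero x, mul_assoc, Finset.sum_mul, Finset.mul_sum]
    have e4 : (({y} : Multiset ℂ).antidiagonal.map fun p => w x p.1 * w x p.2).sum
        = w x 0 * w x {y} + w x 0 * w x {y} := by
      rw [← Multiset.cons_zero, Multiset.antidiagonal_cons]
      simp [mul_comm]
    have e5 : (({y} : Multiset ℂ).map fun z => ((x - z)⁻¹ ^ 2) • w x (({y} : Multiset ℂ).erase z)).sum
        = ((x - y)⁻¹ ^ 2) • w x 0 := by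
      rw [Multiset.map_singleton, Multiset.sum_singleton]
      congr 2
      rw [← Multiset.cons_zero, Multiset.erase_cons_head]
    have e6 : PowerSeries.coeff 1 (PowerSeries.X * ((x - y)⁻¹ ^ 2) • w x 0)
        = (x - y)⁻¹ ^ 2 * (hbar * ∑ i, 1 / (x - s i)) := by
      rw [show (1 : ℕ) = 0 + 1 from rfl, PowerSeries.coeff_succ_X_mul, PowerSeries.coeff_smul,
        hw.zero, smul_eq_mul]
    rw [map_add, map_add, e1, e4, e5, e6, map_add, e3, ← Finset.sum_mul]
    ring
  · have hρ0 := (h.exists_covariance hbar_ne hs hdV).1 i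
    set ρ := regularPart hbar s f i with hρ
    have hρA : AnalyticAt ℂ ρ (s i) :=
      analyticAt_regularPart hs (analyticAt_ratFunc_eval dV (hdV i))
    have hyi : s i - y ≠ 0 := sub_ne_zero.2 fun e => hy ⟨i, e⟩
    set a := 2 * hbar * K y (s i) with ha
    set q : ℂ → ℂ := fun x => 1 / 2 * ∑ j ∈ Finset.univ.erase i,
      2 * hbar * K y (s j) * ((x - s j) ^ 2)⁻¹ with hq
    have hqA : AnalyticAt ℂ q (s i) := analyticAt_const.mul (Finset.analyticAt_fun_sum _ fun j hj =>
      analyticAt_const.mul (((analyticAt_id.sub analyticAt_const).pow 2).inv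
        (pow_ne_zero _ (sub_ne_zero.2 (hs.ne (Finset.ne_of_mem_erase hj).symm)))))
    have hp : AnalyticAt ℂ (fun x => (x - y)⁻¹ ^ 2) (s i) :=
      ((analyticAt_id.sub analyticAt_const).inv hyi).pow 2
    -- The triple poles at `s i` cancel. What is left is `N x / (x - s i)` plus a regular function,
    -- and `N (s i) = 0` is the second-order relation of `expansion`.
    set N : ℂ → ℂ := fun x => hbar * (x - y)⁻¹ ^ 2 + 2 * hbar * q x
      + 1 / 2 * a * dslope ρ (s i) x with hN
    have hNA : AnalyticAt ℂ N (s i) := ((analyticAt_const.mul hp).add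
      (analyticAt_const.mul hqA)).add (analyticAt_const.mul (analyticAt_dslope hρA))
    have hN0 : N (s i) = 0 := by
      have h2 := (h.expansion hs hdV hy i hρ).2
      rw [hρ0, zero_mul, add_zero] at h2
      simp only [hN, hq, dslope_same, inv_pow, ha]
      linear_combination hbar * h2
    have hP : AnalyticAt ℂ (fun x => ∑ j ∈ Finset.univ.erase i, (x - s j)⁻¹) (s i) :=
      Finset.analyticAt_fun_sum _ fun j hj =>
        analyticAt_inv_sub_of_ne hs (Finset.ne_of_mem_erase hj)
    refine ⟨fun x => dslope N (s i) x + (hbar * (x - y)⁻¹ ^ 2 * ∑ j ∈ Finset.univ.erase i,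
      (x - s j)⁻¹ + ρ x * q x + hbar * deriv q x), (analyticAt_dslope hNA).add
        ((((analyticAt_const.mul hp).mul hP).add (hρA.mul hqA)).add
          (analyticAt_const.mul hqA.deriv)), ?_⟩
    have hqd : ∀ᶠ x in 𝓝[≠] (s i), DifferentiableAt ℂ q x :=
      (hqA.eventually_analyticAt.filter_mono nhdsWithin_le_nhds).mono fun x hx =>
        hx.differentiableAt
    filter_upwards [self_mem_nhdsWithin, hqd] with x hxi hqd
    have hne : x - s i ≠ 0 := sub_ne_zero.2 hxi
    have e0 : ∀ x, 1 / 2 * ∑ i, 2 * hbar * K y (s i) * ((x - s i) ^ 2)⁻¹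
        = 1 / 2 * a * ((x - s i) ^ 2)⁻¹ + q x := fun x => by
      rw [← Finset.add_sum_erase _ _ (Finset.mem_univ i)]; ring
    have e1 : deriv (fun x => 1 / 2 * ∑ i, 2 * hbar * K y (s i) * ((x - s i) ^ 2)⁻¹) x
        = 1 / 2 * a * -(2 * ((x - s i) ^ 3)⁻¹) + deriv q x := by
      rw [funext e0]
      have := ((hasDerivAt_inv_sub_pow hne 1).const_mul (1 / 2 * a)).add hqd.hasDerivAt
      refine this.deriv.trans ?_
      norm_num
    have e2 := sub_smul_dslope N (s i) x
    have e3 := sub_smul_dslope ρ (s i) x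
    have e4 : 2 * hbar * ∑ j, 1 / (x - s j) - dV.eval (RingHom.id ℂ) x
        = 2 * hbar * (x - s i)⁻¹ + ρ x := two_hbar_mul_sum_inv f i x
    rw [hN0, smul_eq_mul, sub_zero] at e2
    rw [hρ0, smul_eq_mul, sub_zero] at e3
    have e5 : ∑ j, 1 / (x - s j) = (x - s i)⁻¹ + ∑ j ∈ Finset.univ.erase i, (x - s j)⁻¹ := by
      simp only [one_div]
      rw [← Finset.add_sum_erase _ _ (Finset.mem_univ i)]
    have e6 : dslope N (s i) x = (x - s i)⁻¹ * N x := by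
      rw [← e2, inv_mul_cancel_left₀ hne]
    have e7 : dslope ρ (s i) x = (x - s i)⁻¹ * ρ x := by
      rw [← e3, inv_mul_cancel_left₀ hne]
    rw [e1, e4, e0, e5, e6, hN]
    simp only [e7]
    field_simp
    ring

end QuantumTR

end

/-! ### The correlators as coefficients of the loop solution -/

noncomputable section

namespace QuantumTR

variable {m : ℕ} {s : Fin m → ℂ} {hbar : ℂ} {dV : RatFunc ℂ} {G K : ℂ → ℂ → ℂ}

theorem IsKernelPair.tendsto_bergman_sub (h : IsKernelPair hbar dV s G K)
    (hs : Function.Injective s) (hdV : ∀ i, dV.denom.eval (s i) ≠ 0) {x : ℂ}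
    (hx : x ∉ Set.range s) :
    Tendsto (fun y => bergman G x y - 1 / (2 * (x - y) ^ 2)) (𝓝[≠] x)
      (𝓝 (1 / 2 * ∑ i, 2 * hbar * K x (s i) * ((x - s i) ^ 2)⁻¹)) := by
  have hc : ContinuousAt (fun y => 1 / 2 * ∑ i, 2 * hbar * K x (s i) * ((y - s i) ^ 2)⁻¹) x :=
    continuousAt_const.mul (tendsto_finsetSum _ fun i _ => continuousAt_const.mul
      (((continuousAt_id.sub continuousAt_const).pow 2).inv₀
        (pow_ne_zero _ (sub_ne_zero_of_notMem hx i))))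
  refine (hc.tendsto.mono_left nhdsWithin_le_nhds).congr' ?_
  have hy : ∀ᶠ y in 𝓝[≠] x, y ∉ Set.range s :=
    mem_nhdsWithin_of_mem_nhds ((Set.finite_range s).isClosed.isOpen_compl.mem_nhds hx)
  filter_upwards [hy, self_mem_nhdsWithin] with y hy hne
  rw [h.bergman_eq hs hdV hx hy hne, ← neg_sub x y, neg_sq, one_div (2 * _), mul_inv]
  ring

section Induction

variable {w : ℂ → Multiset ℂ → PowerSeries ℂ}

theorem IsKernelPair.W_zero_one_eq (h : IsKernelPair hbar dV s G K) (hbar_ne : hbar ≠ 0)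
    (hs : Function.Injective s) (hdV : ∀ i, dV.denom.eval (s i) ≠ 0)
    (hw : IsLoopSolution hbar s (fun x => dV.eval (RingHom.id ℂ) x) w) {x y : ℂ}
    (hx : x ∉ Set.range s) (hy : y ∉ Set.range s) (hne : y ≠ x) :
    bergman G x y = PowerSeries.coeff 1 (w x {y}) + 1 / 2 * ((x - y) ^ 2)⁻¹ := by
  rw [h.bergman_eq hs hdV hx hy hne, h.coeff_one_singleton hbar_ne hs hdV hw hx hy,
    h.sum_symm hs hdV hx hy, ← neg_sub x y, neg_sq]
  ring

theorem IsKernelPair.bergmanDiag_eq (h : IsKernelPair hbar dV s G K) (hbar_ne : hbar ≠ 0)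
    (hs : Function.Injective s) (hdV : ∀ i, dV.denom.eval (s i) ≠ 0)
    (hw : IsLoopSolution hbar s (fun x => dV.eval (RingHom.id ℂ) x) w) {x : ℂ}
    (hx : x ∉ Set.range s) : bergmanDiag G x = PowerSeries.coeff 1 (w x {x}) := by
  rw [bergmanDiag, (h.tendsto_bergman_sub hs hdV hx).limUnder_eq,
    h.coeff_one_singleton hbar_ne hs hdV hw hx hx]

/-- The bracket of the recursion in terms of the solution of the loop equations. -/
theorem IsKernelPair.bracket_eq (h : IsKernelPair hbar dV s G K) (hbar_ne : hbar ≠ 0)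
    (hs : Function.Injective s) (hdV : ∀ i, dV.denom.eval (s i) ≠ 0)
    (hw : IsLoopSolution hbar s (fun x => dV.eval (RingHom.id ℂ) x) w) {g n : ℕ}
    (hgn : 2 ≤ 2 * g + n)
    (ih : ∀ g' n', 2 ≤ 2 * g' + n' → 2 * g' + n' < 2 * g + n → ∀ (x : ℂ) (J : Fin n' → ℂ),
      x ∉ Set.range s → (∀ k, J k ∉ Set.range s) →
        W hbar s G K g' n' x J = PowerSeries.coeff (g' + n') (w x (Finset.univ.val.map J)))
    {J : Fin n → ℂ} (hJ : ∀ k, J k ∉ Set.range s) {q : ℂ → ℕ → Finset (Fin n) → ℂ}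
    (hq : ∀ x h I, q x h I
      = ∑ k, if h = 0 then if I = {k} then 1 / 2 * ((x - J k) ^ 2)⁻¹ else 0 else 0)
    {x : ℂ} (hx : x ∉ Set.range s) (hxJ : ∀ k, x ≠ J k) :
    bracket G (W hbar s G K) g n J x =
      PowerSeries.coeff (g + n) (w x (x ::ₘ Finset.univ.val.map J)
        + ((Finset.univ.val.map J).antidiagonal.map fun p => w x p.1 * w x p.2).sum
        + PowerSeries.X * ((Finset.univ.val.map J).map fun y =>
          ((x - y)⁻¹ ^ 2) • w x ((Finset.univ.val.map J).erase y)).sum)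
      - 2 * (hbar * ∑ i, 1 / (x - s i)) * PowerSeries.coeff (g + n) (w x (Finset.univ.val.map J))
      + ∑ h ∈ Finset.range (g + 1), ∑ I, q x h I * q x (g - h) Iᶜ := by
  set a : ℕ → Finset (Fin n) → ℂ := fun h I =>
    PowerSeries.coeff (h + I.card) (w x (I.val.map J)) with ha
  have hW : ∀ h ≤ g, ∀ I : Finset (Fin n), (h, I) ≠ (0, ∅) → (h, I) ≠ (g, Finset.univ) →
      W hbar s G K h I.card x (pick J I) = a h I + q x h I := by
    intro h' hh I h0 h1
    -- Stable factors come from the induction hypothesis. The only other factor not excluded by the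
    -- sum is `W₂⁽⁰⁾`, where the double pole `q` enters.
    by_cases hst : 2 ≤ 2 * h' + I.card
    · have hlt : 2 * h' + I.card < 2 * g + n := by
        have hle : I.card ≤ n := by simpa using I.card_le_univ
        rcases hle.lt_or_eq with hlt | heq
        · omega
        · have : I = Finset.univ := Finset.eq_univ_of_card I (by simpa using heq)
          subst this
          have : h' ≠ g := fun e => h1 (by rw [e])
          omega
      have hq0 : q x h' I = 0 := by
        rw [hq]
        refine Finset.sum_eq_zero fun k _ => ?_
        split_ifs with e1 e2
        · subst e1 e2
          simp at hst
        · rfl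
        · rfl
      rw [ih h' I.card hst hlt x (pick J I) hx fun k => hJ _, map_pick, hq0, add_zero]
    · have hh0 : h' = 0 := by omega
      subst hh0
      have hI0 : I ≠ ∅ := fun e => h0 (by rw [e])
      have hI1 : I.card = 1 := by
        have := Finset.card_pos.2 (Finset.nonempty_iff_ne_empty.2 hI0)
        omega
      obtain ⟨k, rfl⟩ := Finset.card_eq_one.1 hI1
      have e1 : W hbar s G K 0 ({k} : Finset (Fin n)).card x (pick J {k}) = bergman G x (J k) := by
        have e2 : pick J {k} = fun _ => J k := by
          funext l
          have := Finset.orderEmbOfFin_mem {k} rfl l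
          rw [Finset.mem_singleton] at this
          rw [pick, this]
        rw [e2]
        exact W_zero_one hbar s G K x _
      rw [e1, h.W_zero_one_eq hbar_ne hs hdV hw hx (hJ k) (hxJ k).symm, hq]
      simp [ha]
  have hfirst : (if g = 0 then 0 else if g = 1 ∧ n = 0 then bergmanDiag G x
      else W hbar s G K (g - 1) (n + 1) x (Fin.cons x J))
      = PowerSeries.coeff (g + n) (w x (x ::ₘ Finset.univ.val.map J)) := by
    -- For `g = 0` the first term is absent, consistently with `w x (x ::ₘ J)` being divisible by `X
    -- ^ (n + 1)`; for `g = 1`, `n = 0` it is the regularised `B`.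
    split_ifs with h0 h1
    · subst h0
      refine (PowerSeries.X_pow_dvd_iff.1 (hw.dvd x _) _ ?_).symm
      simp
    · obtain ⟨rfl, rfl⟩ := h1
      rw [h.bergmanDiag_eq hbar_ne hs hdV hw hx]
      rfl
    · rw [ih (g - 1) (n + 1) (by omega) (by omega) x _ hx ?_, map_finCons]
      · congr 2; omega
      · exact Fin.cases hx hJ
  have hsum : ∑ h ∈ Finset.range (g + 1),
      ∑ I : Finset (Fin n) with (h, I) ≠ (0, ∅) ∧ (h, I) ≠ (g, Finset.univ),
        W hbar s G K h I.card x (pick J I) * W hbar s G K (g - h) Iᶜ.card x (pick J Iᶜ)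
      = ∑ h ∈ Finset.range (g + 1),
      ∑ I : Finset (Fin n) with (h, I) ≠ (0, ∅) ∧ (h, I) ≠ (g, Finset.univ),
        (a h I + q x h I) * (a (g - h) Iᶜ + q x (g - h) Iᶜ) := by
    refine Finset.sum_congr rfl fun h' hh => Finset.sum_congr rfl fun I hI => ?_
    have hh' : h' ≤ g := Nat.lt_succ_iff.1 (Finset.mem_range.1 hh)
    simp only [Finset.mem_filter, Finset.mem_univ, true_and] at hI
    rw [hW h' hh' I hI.1 hI.2, hW (g - h') (Nat.sub_le _ _) Iᶜ]
    · intro e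
      rw [Prod.mk.injEq, Finset.compl_eq_empty_iff] at e
      exact hI.2 (by rw [e.2, show h' = g by omega])
    · intro e
      rw [Prod.mk.injEq, Finset.compl_eq_univ_iff] at e
      exact hI.1 (by rw [e.2, show h' = 0 by omega])
  have hcard : ∀ I : Finset (Fin n), (I.val.map J).card = I.card := fun I => Multiset.card_map _ _
  have hprod : PowerSeries.coeff (g + n)
      ((Finset.univ.val.map J).antidiagonal.map fun p => w x p.1 * w x p.2).sum
      = ∑ h ∈ Finset.range (g + 1), ∑ I, a h I * a (g - h) Iᶜ := by
    rw [sum_antidiagonal_map J Finset.univ fun p => w x p.1 * w x p.2, Finset.powerset_univ,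
      map_sum, Finset.sum_comm]
    refine Finset.sum_congr rfl fun I _ => ?_
    have hd1 := hw.dvd x (I.val.map J)
    have hd2 := hw.dvd x (Iᶜ.val.map J)
    rw [hcard] at hd1 hd2
    have := coeff_mul_of_dvd hd1 hd2 g
    rwa [show I.card + Iᶜ.card = n by simp] at this
  -- The contact terms of the loop equation are exactly the cross terms between `W₂⁽⁰⁾`'s double
  -- pole and the remaining correlator.
  have hsource : PowerSeries.coeff (g + n) (PowerSeries.X * ((Finset.univ.val.map J).map fun y =>
        ((x - y)⁻¹ ^ 2) • w x ((Finset.univ.val.map J).erase y)).sum)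
      = ∑ k, 2 * (1 / 2 * ((x - J k) ^ 2)⁻¹) * a g {k}ᶜ := by
    rw [Multiset.map_map]
    change PowerSeries.coeff (g + n) (PowerSeries.X * ∑ k, ((x - J k)⁻¹ ^ 2) •
      w x ((Finset.univ.val.map J).erase (J k))) = _
    rw [Finset.mul_sum, map_sum]
    refine Finset.sum_congr rfl fun k _ => ?_
    have hn : n = (n - 1) + 1 := by have := k.pos; omega
    have hk : (Finset.univ.val.map J).erase (J k) = ({k}ᶜ : Finset (Fin n)).val.map J := by
      have : (Finset.univ : Finset (Fin n)).val = k ::ₘ ({k}ᶜ : Finset (Fin n)).val := by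
        rw [← Finset.insert_val_of_notMem (by simp), Finset.insert_compl_self]
      rw [this, Multiset.map_cons, Multiset.erase_cons_head]
    have hc : ({k}ᶜ : Finset (Fin n)).card = n - 1 := by
      rw [Finset.card_compl, Fintype.card_fin, Finset.card_singleton]
    rw [hk, show g + n = (g + (n - 1)) + 1 by omega, PowerSeries.coeff_succ_X_mul,
      PowerSeries.coeff_smul, smul_eq_mul, inv_pow]
    simp only [ha, hc]
    ring
  have ha0 : a 0 ∅ = hbar * ∑ i, 1 / (x - s i) := hw.zero x
  have hag : a g Finset.univ = PowerSeries.coeff (g + n) (w x (Finset.univ.val.map J)) := by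
    simp [ha]
  rw [bracket, hfirst, hsum, sum_filter_mul_eq hgn a (q x) _ (hq x), map_add, map_add, hprod,
    hsource, ha0, hag]
  ring

/-- This is the loop equation rewritten for the bracket. The leftover products of two double poles
`(x - J k)⁻²` are harmless since no `J k` is one of the `sᵢ`. -/
theorem IsKernelPair.bracket_regular (h : IsKernelPair hbar dV s G K) (hbar_ne : hbar ≠ 0)
    (hs : Function.Injective s) (hdV : ∀ i, dV.denom.eval (s i) ≠ 0)
    (hw : IsLoopSolution hbar s (fun x => dV.eval (RingHom.id ℂ) x) w) {g n : ℕ}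
    (hgn : 2 ≤ 2 * g + n)
    (ih : ∀ g' n', 2 ≤ 2 * g' + n' → 2 * g' + n' < 2 * g + n → ∀ (x : ℂ) (J : Fin n' → ℂ),
      x ∉ Set.range s → (∀ k, J k ∉ Set.range s) →
        W hbar s G K g' n' x J = PowerSeries.coeff (g' + n') (w x (Finset.univ.val.map J)))
    {J : Fin n → ℂ} (hJ : ∀ k, J k ∉ Set.range s) (i : Fin m) :
    ∃ F, AnalyticAt ℂ F (s i) ∧ ∀ᶠ x in 𝓝[≠] (s i), bracket G (W hbar s G K) g n J x
      + ((2 * hbar * ∑ j, 1 / (x - s j) - dV.eval (RingHom.id ℂ) x)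
          * PowerSeries.coeff (g + n) (w x (Finset.univ.val.map J))
        + hbar * deriv (fun x => PowerSeries.coeff (g + n) (w x (Finset.univ.val.map J))) x)
      = F x := by
  obtain ⟨F, hF, he⟩ := hw.loop (Finset.univ.val.map J) (by simpa using hJ) (g + n) i
  set q : ℂ → ℕ → Finset (Fin n) → ℂ := fun x h I =>
    ∑ k, if h = 0 then if I = {k} then 1 / 2 * ((x - J k) ^ 2)⁻¹ else 0 else 0 with hq
  have hqA : ∀ h I, AnalyticAt ℂ (fun x => q x h I) (s i) := by
    intro h I
    refine Finset.analyticAt_fun_sum _ fun k _ => ?_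
    split_ifs
    · exact analyticAt_const.mul (((analyticAt_id.sub analyticAt_const).pow 2).inv
        (pow_ne_zero _ (sub_ne_zero.2 fun e => hJ k ⟨i, e⟩)))
    · exact analyticAt_const
    · exact analyticAt_const
  refine ⟨fun x => F x + ∑ h ∈ Finset.range (g + 1), ∑ I, q x h I * q x (g - h) Iᶜ,
    hF.add (Finset.analyticAt_fun_sum _ fun h _ => Finset.analyticAt_fun_sum _ fun I _ =>
      (hqA _ _).mul (hqA _ _)), ?_⟩
  have hxJ : ∀ᶠ x in 𝓝[≠] (s i), ∀ k, x ≠ J k := eventually_all.2 fun k =>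
    (continuousAt_id.eventually_ne fun e => hJ k ⟨i, e⟩).filter_mono nhdsWithin_le_nhds
  filter_upwards [he, eventually_notMem_range hs i, hxJ] with x h1 h2 h3
  rw [h.bracket_eq hbar_ne hs hdV hw hgn ih hJ (fun _ _ _ => rfl) h2 h3, ← h1]
  ring

/-- The correlators are the coefficients of the solution of the loop equations. -/
theorem IsKernelPair.W_eq_coeff (h : IsKernelPair hbar dV s G K) (hbar_ne : hbar ≠ 0)
    (hs : Function.Injective s) (hdV : ∀ i, dV.denom.eval (s i) ≠ 0)
    (hw : IsLoopSolution hbar s (fun x => dV.eval (RingHom.id ℂ) x) w) (g n : ℕ)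
    (hgn : 2 ≤ 2 * g + n) (x : ℂ) (J : Fin n → ℂ) (hx : x ∉ Set.range s)
    (hJ : ∀ k, J k ∉ Set.range s) :
    W hbar s G K g n x J = PowerSeries.coeff (g + n) (w x (Finset.univ.val.map J)) := by
  induction hN : 2 * g + n using Nat.strong_induction_on generalizing g n x J with
  | _ N ih =>
    subst hN
    rw [W_recursion hbar s G K g n hgn]
    exact h.sum_residue hs hdV hx (hw.mem_polarSpace _ _) fun i =>
      h.bracket_regular hbar_ne hs hdV hw hgn
        (fun g' n' h1 h2 x J hx hJ => ih _ h2 g' n' h1 x J hx hJ rfl) hJ i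

/-- By `bracket_regular` the bracket is near `s i` a regular function minus the loop operator
applied to an element of `polarSpace s`, hence meromorphic. -/
theorem IsKernelPair.meromorphicAt (h : IsKernelPair hbar dV s G K) (hbar_ne : hbar ≠ 0)
    (hs : Function.Injective s) (hdV : ∀ i, dV.denom.eval (s i) ≠ 0)
    (hw : IsLoopSolution hbar s (fun x => dV.eval (RingHom.id ℂ) x) w) {g n : ℕ}
    (hgn : 2 ≤ 2 * g + n) {x₀ : ℂ} {J : Fin n → ℂ} (hx₀ : x₀ ∉ Set.range s)
    (hJ : ∀ k, J k ∉ Set.range s) (i : Fin m) :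
    MeromorphicAt (fun x => K x₀ x * bracket G (W hbar s G K) g n J x) (s i) := by
  refine (h.analytic x₀ hx₀ i).meromorphicAt.mul ?_
  obtain ⟨F, hF, he⟩ := h.bracket_regular hbar_ne hs hdV hw hgn
    (fun g' n' h1 _ x J hx hJ => h.W_eq_coeff hbar_ne hs hdV hw g' n' h1 x J hx hJ) hJ i
  have hwM := meromorphicAt_of_mem_polarSpace
    (hw.mem_polarSpace (Finset.univ.val.map J) (g + n)) (s i)
  have hc : MeromorphicAt (fun x => 2 * hbar * ∑ j, 1 / (x - s j)
      - dV.eval (RingHom.id ℂ) x) (s i) := by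
    have e : (fun x => 2 * hbar * ∑ j, 1 / (x - s j) - dV.eval (RingHom.id ℂ) x)
        = fun x => 2 * hbar * (x - s i)⁻¹
          + regularPart hbar s (fun x => dV.eval (RingHom.id ℂ) x) i x :=
      funext (two_hbar_mul_sum_inv (fun x => dV.eval (RingHom.id ℂ) x) i)
    rw [e]
    exact ((MeromorphicAt.const _ _).mul (analyticAt_id.sub analyticAt_const).meromorphicAt.inv).add
      (analyticAt_regularPart hs (analyticAt_ratFunc_eval dV (hdV i))).meromorphicAt
  refine (hF.meromorphicAt.sub ((hc.mul hwM).add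
    ((MeromorphicAt.const hbar _).mul hwM.deriv))).congr ?_
  filter_upwards [he] with x hx
  exact sub_eq_of_eq_add hx.symm

/-- The solution of the loop equations is symmetric in all its arguments. -/
theorem IsLoopSolution.eq_of_map_eq {f : ℂ → ℂ} (hw : IsLoopSolution hbar s f w) {n : ℕ}
    {p p' : Fin (n + 1) → ℂ} (hp : Finset.univ.val.map p = Finset.univ.val.map p') :
    w (p 0) (Finset.univ.val.map (Fin.tail p)) = w (p' 0) (Finset.univ.val.map (Fin.tail p')) := by
  rw [← Fin.cons_self_tail p, ← Fin.cons_self_tail p', map_finCons, map_finCons,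
    -- Two such decompositions of a multiset either agree or differ by exchanging the distinguished
    -- point with another one, which is `hw.symm`.
    Multiset.cons_eq_cons] at hp
  rcases hp with ⟨h1, h2⟩ | ⟨_, t, h1, h2⟩
  · rw [h1, h2]
  · rw [h1, h2, hw.symm]

end Induction

end QuantumTR

end

/-! ### The theorem -/

theorem mainTheorem1 (hbar : ℂ) (hbar_ne : hbar ≠ 0) (dV : RatFunc ℂ)
    (m : ℕ) (s : Fin m → ℂ) (s_inj : Function.Injective s)
    (dV_reg : ∀ i, dV.denom.eval (s i) ≠ 0)
    (G K : ℂ → ℂ → ℂ) (hGK : QuantumTR.IsKernelPair hbar dV s G K) :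
    -- the recursion is meaningful: `W̄₂⁽⁰⁾(x,x)` exists, and all residues are taken of functions
    -- that are meromorphic at the point in question
    (∀ x, x ∉ Set.range s → ∃ c : ℂ,
      Filter.Tendsto (fun y => QuantumTR.bergman G x y - 1 / (2 * (x - y) ^ 2))
        (nhdsWithin x {x}ᶜ) (nhds c)) ∧
    (∀ (g n : ℕ), 2 ≤ 2 * g + n → ∀ (x₀ : ℂ) (J : Fin n → ℂ), x₀ ∉ Set.range s →
      (∀ k, J k ∉ Set.range s) → ∀ i, MeromorphicAt
        (fun x => K x₀ x * QuantumTR.bracket G (QuantumTR.W hbar s G K) g n J x) (s i)) ∧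
    -- the correlators are symmetric
    ∀ (g n : ℕ) (p : Fin (n + 1) → ℂ), (∀ k, p k ∉ Set.range s) →
      ∀ σ : Equiv.Perm (Fin (n + 1)),
        QuantumTR.correlator hbar s G K g n (p ∘ σ) = QuantumTR.correlator hbar s G K g n p := by
  obtain ⟨w, hw⟩ := hGK.exists_isLoopSolution hbar_ne s_inj dV_reg
  refine ⟨fun x hx => ⟨_, hGK.tendsto_bergman_sub s_inj dV_reg hx⟩,
    fun g n hgn x₀ J hx₀ hJ i => hGK.meromorphicAt hbar_ne s_inj dV_reg hw hgn hx₀ hJ i,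
    fun g n p hp σ => ?_⟩
  rw [QuantumTR.correlator, QuantumTR.correlator]
  by_cases hgn : 2 ≤ 2 * g + n
  · have hW : ∀ p' : Fin (n + 1) → ℂ, (∀ k, p' k ∉ Set.range s) → _ := fun p' hp' =>
      hGK.W_eq_coeff hbar_ne s_inj dV_reg hw g n hgn (p' 0) (Fin.tail p') (hp' 0) fun k => hp' _
    rw [hW (p ∘ σ) fun k => hp _, hW p hp]
    congr 1
    refine hw.eq_of_map_eq ?_
    rw [← Multiset.map_map]
    congr 1
    exact congrArg Finset.val (Finset.map_univ_equiv σ)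
  · obtain rfl : g = 0 := by omega
    obtain rfl | rfl : n = 0 ∨ n = 1 := by omega
    · have : σ = 1 := Equiv.ext fun k => Subsingleton.elim (α := Fin 1) _ _
      rw [this]
      rfl
    · rw [QuantumTR.W_zero_one, QuantumTR.W_zero_one]
      change QuantumTR.bergman G (p (σ 0)) (p (σ 1)) = QuantumTR.bergman G (p 0) (p 1)
      have h01 : σ 0 ≠ σ 1 := σ.injective.ne (by decide)
      -- The symmetry of `B` is assumed off the diagonal only; for coinciding arguments a
      -- permutation changes nothing.
      rcases eq_or_ne (p 0) (p 1) with e | hne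
      · have hc : ∀ k, p k = p 0 := Fin.forall_fin_two.2 ⟨rfl, e.symm⟩
        rw [hc (σ 0), hc (σ 1), hc 1]
      · generalize σ 0 = a at h01
        generalize σ 1 = b at h01
        fin_cases a <;> fin_cases b
        · exact absurd rfl h01
        · rfl
        · exact (hGK.bergman_symm _ _ (hp 0) (hp 1) hne).symm
        · exact absurd rfl h01
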